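/- **Theorem.** Let $G=(V,E)$, $V=\{0,\dots,n-1\}$, be a directed or undirected graph with positive real edge weights. For vertices $s,t$ let $d(s,t)$ be the weight of a shortest path from $s$ to $t$, $\sigma_{st}$ the number of shortest paths from $s$ to $t$ (so $\sigma_{ss}=1$), and $\sigma_{st}(v)$ the number of those that pass through $v$. The betweenness centrality of $v$ is $BC(v)=\sum_{s\ne v,\,t\ne v}\sigma_{st}(v)/\sigma_{st}$, where pairs $(s,t)$ with $t$ unreachable from $s$ contribute $0$. Let $DAG(s)$ be the set of (directed) edges that lie on shortest paths starting at $s$, and $DAG_R(s)$ the analogous set in the graph obtained by reversing all edges. (For an undirected graph each edge is read as its two orientations in the definitions of $DAG$ and $DAG_R$.) An *incremental update* at a vertex $v$ turns $G$ into a graph $G'$ on the same vertices by decreasing the weights of, or newly inserting, any subset of edges incident to $v$ (incoming or outgoing, if $G$ is directed). For a vertex $x$ let $m^*_x$ be the number of edges that lie on shortest paths through $x$ (paths that start or end at $x$ included), and let $m^*_{avg}=\frac1n\sum_{x\in V}m^*_x$. Put $m'=m^*_{avg}+m^*_v$, where each of the two terms is taken to be the maximum of its values in $G$ and in $G'$.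 Then there are a single program for a real RAM (unit-cost arithmetic and comparisons on reals, unit-cost addition, subtraction, comparison and array indexing on natural numbers) and an absolute constant $C$ such that the following holds for every such $G$, $v$ and $G'$, directed or undirected. Suppose the memory holds $n$, the matrix of edge weights of $G$, the values $d(s,t)$ and $\sigma_{st}$ for all $s,t$, the values $BC(x)$ for all $x$, and lists of the edges of $DAG(s)$ and of $DAG_R(s)$ for all $s$, together with $v$ and the weights in $G'$ of the edges into and out of $v$. Then the program halts after at most $C\,(m'\,n+n^2)$ steps, and the memory then holds the betweenness centralities of all vertices of $G'$, and all the other data listed above for $G'$ in place of $G$. -/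

import Mathlib

/-! ### Weighted graphs, shortest paths and betweenness centrality -/

/-- A directed graph with positive real edge weights. The value of `weight` on a pair that is not an
edge is irrelevant. -/
structure WDigraph (V : Type*) where
  Adj : V → V → Prop
  weight : V → V → ℝ
  weight_pos : ∀ a b, Adj a b → 0 < weight a b

namespace WDigraph

variable {V : Type*}

/-- The graph obtained by reversing every edge. -/
def reverse (G : WDigraph V) : WDigraph V where
  Adj a b := G.Adj b a
  weight a b := G.weight b a
  weight_pos a b h := G.weight_pos b a h

/-- Sum of the weights of the edges between consecutive vertices of a list. -/
def pathWeight (G : WDigraph V) : List V → ℝ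
  | a :: b :: l => G.weight a b + pathWeight G (b :: l)
  | _ => 0

/-- `p` is the vertex sequence of a path from `s` to `t`. -/
def IsPath (G : WDigraph V) (s t : V) (p : List V) : Prop :=
  p.head? = some s ∧ p.getLast? = some t ∧ p.IsChain G.Adj ∧ p.Nodup

def Reachable (G : WDigraph V) (s t : V) : Prop :=
  ∃ p, G.IsPath s t p

/-- `p` is a shortest (minimum weight) path from `s` to `t`. -/
def IsShortest (G : WDigraph V) (s t : V) (p : List V) : Prop :=
  G.IsPath s t p ∧ ∀ q, G.IsPath s t q → G.pathWeight p ≤ G.pathWeight q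

/-- The distance `d(s,t)`; only used for `t` reachable from `s`. -/
noncomputable def dist (G : WDigraph V) (s t : V) : ℝ :=
  sInf {x | ∃ p, G.IsPath s t p ∧ x = G.pathWeight p}

/-- `σ_st`, the number of shortest paths from `s` to `t`. -/
noncomputable def numShortest (G : WDigraph V) (s t : V) : ℕ :=
  Set.ncard {p : List V | G.IsShortest s t p}

/-- `σ_st(v)`, the number of shortest paths from `s` to `t` that pass through `v`. -/
noncomputable def numShortestThrough (G : WDigraph V) (s t v : V) : ℕ :=
  Set.ncard {p : List V | G.IsShortest s t p ∧ v ∈ p}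

/-- Betweenness centrality. A pair `s, t` with `t` unreachable from `s` contributes `0 / 0 = 0`. -/
noncomputable def betweenness [Fintype V] [DecidableEq V] (G : WDigraph V) (v : V) : ℝ :=
  ∑ s ∈ Finset.univ.filter (fun s => s ≠ v), ∑ t ∈ Finset.univ.filter (fun t => t ≠ v),
    (G.numShortestThrough s t v : ℝ) / (G.numShortest s t : ℝ)

/-- `(a, b)` is an edge of the single source shortest path DAG rooted at `s`: it lies on some
shortest path that starts at `s`. -/
def DagEdge (G : WDigraph V) (s a b : V) : Prop :=
  ∃ t p, G.IsShortest s t p ∧ [a, b] <:+: p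

/-- `(a, b)` lies on some shortest path through `x` (the endpoints of a path are on it). -/
def EdgeThrough (G : WDigraph V) (x a b : V) : Prop :=
  ∃ s t p, G.IsShortest s t p ∧ x ∈ p ∧ [a, b] <:+: p

/-- `m*_x`, the number of edges that lie on shortest paths through `x`. -/
noncomputable def mStar (G : WDigraph V) (x : V) : ℕ :=
  Set.ncard {e : V × V | G.EdgeThrough x e.1 e.2}

/-- `m*_avg`, the average of all `m*_x`. -/
noncomputable def mStarAvg [Fintype V] (G : WDigraph V) : ℝ :=
  (∑ x : V, (G.mStar x : ℝ)) / (Fintype.card V : ℝ)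

/-- `H` arises from `G` by an incremental update at `v`: edges incident to `v` may have been inserted
or have had their weight decreased, and nothing else has changed. -/
structure IncUpdate (G H : WDigraph V) (v : V) : Prop where
  adj_mono : ∀ a b, G.Adj a b → H.Adj a b
  weight_le : ∀ a b, G.Adj a b → H.weight a b ≤ G.weight a b
  adj_eq : ∀ a b, a ≠ v → b ≠ v → (H.Adj a b ↔ G.Adj a b)
  weight_eq : ∀ a b, a ≠ v → b ≠ v → G.Adj a b → H.weight a b = G.weight a b

/-- `m' = m*_avg + m*_v`, each term being the maximum over the graphs before and after the update. -/
noncomputable def mPrime [Fintype V] (G H : WDigraph V) (v : V) : ℝ :=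
  max G.mStarAvg H.mStarAvg + max (G.mStar v : ℝ) (H.mStar v : ℝ)

end WDigraph

/-- An undirected graph with positive real edge weights. -/
structure WGraph (V : Type*) where
  graph : SimpleGraph V
  weight : Sym2 V → ℝ
  weight_pos : ∀ e ∈ graph.edgeSet, 0 < weight e

namespace WGraph

variable {V : Type*}

/-- Every undirected edge read as its two orientations. A path of the undirected graph is the same
vertex sequence as a path of this directed graph. -/
def toDigraph (G : WGraph V) : WDigraph V where
  Adj a b := G.graph.Adj a b
  weight a b := G.weight s(a, b)
  weight_pos a b h := G.weight_pos s(a, b) ((SimpleGraph.mem_edgeSet G.graph).2 h)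

/-- `m*_x`, the number of undirected edges that lie on shortest paths through `x`. -/
noncomputable def mStar (G : WGraph V) (x : V) : ℕ :=
  Set.ncard {e : Sym2 V | ∃ a b, e = s(a, b) ∧ G.toDigraph.EdgeThrough x a b}

/-- `m*_avg`, the average of all `m*_x`. -/
noncomputable def mStarAvg [Fintype V] (G : WGraph V) : ℝ :=
  (∑ x : V, (G.mStar x : ℝ)) / (Fintype.card V : ℝ)

/-- `H` arises from `G` by an incremental update at `v`. -/
structure IncUpdate (G H : WGraph V) (v : V) : Prop where
  edge_mono : ∀ e ∈ G.graph.edgeSet, e ∈ H.graph.edgeSet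
  weight_le : ∀ e ∈ G.graph.edgeSet, H.weight e ≤ G.weight e
  edge_eq : ∀ e : Sym2 V, v ∉ e → (e ∈ H.graph.edgeSet ↔ e ∈ G.graph.edgeSet)
  weight_eq : ∀ e ∈ G.graph.edgeSet, v ∉ e → H.weight e = G.weight e

/-- `m' = m*_avg + m*_v`, each term being the maximum over the graphs before and after the update. -/
noncomputable def mPrime [Fintype V] (G H : WGraph V) (v : V) : ℝ :=
  max G.mStarAvg H.mStarAvg + max (G.mStar v : ℝ) (H.mStar v : ℝ)

end WGraph

/-! ### Real RAM programs with unit-cost operations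

A program is a finite imperative program over integer and real variables and one-dimensional integer
and real arrays. Indices are natural numbers with addition, truncated subtraction and comparison (no
multiplication); reals have the four arithmetic operations and comparison; nothing converts a
real into an index, and the only literals are natural numbers. -/

namespace RealRAM

/-- The memory: variables and arrays are named by natural numbers. -/
structure Store where
  ivar : ℕ → ℕ
  rvar : ℕ → ℝ
  iarr : ℕ → ℕ → ℕ
  rarr : ℕ → ℕ → ℝ

inductive IExp where
  | const (k : ℕ)
  | var (x : ℕ)
  | get (A : ℕ) (i : IExp)
  | add (e f : IExp)
  | sub (e f : IExp)

inductive RExp where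
  | const (k : ℕ)
  | var (x : ℕ)
  | get (A : ℕ) (i : IExp)
  | add (e f : RExp)
  | sub (e f : RExp)
  | mul (e f : RExp)
  | div (e f : RExp)

inductive BExp where
  | ieq (e f : IExp)
  | ilt (e f : IExp)
  | req (e f : RExp)
  | rlt (e f : RExp)
  | not (b : BExp)
  | and (b c : BExp)

inductive Cmd where
  | skip
  | iset (x : ℕ) (e : IExp)
  | rset (x : ℕ) (e : RExp)
  | iput (A : ℕ) (i : IExp) (e : IExp)
  | rput (A : ℕ) (i : IExp) (e : RExp)
  | seq (c d : Cmd)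
  | ite (b : BExp) (c d : Cmd)
  | while (b : BExp) (c : Cmd)

def IExp.eval (σ : Store) : IExp → ℕ
  | .const k => k
  | .var x => σ.ivar x
  | .get A i => σ.iarr A (i.eval σ)
  | .add e f => e.eval σ + f.eval σ
  | .sub e f => e.eval σ - f.eval σ

noncomputable def RExp.eval (σ : Store) : RExp → ℝ
  | .const k => (k : ℝ)
  | .var x => σ.rvar x
  | .get A i => σ.rarr A (i.eval σ)
  | .add e f => e.eval σ + f.eval σ
  | .sub e f => e.eval σ - f.eval σ
  | .mul e f => e.eval σ * f.eval σ
  | .div e f => e.eval σ / f.eval σ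

def BExp.holds (σ : Store) : BExp → Prop
  | .ieq e f => e.eval σ = f.eval σ
  | .ilt e f => e.eval σ < f.eval σ
  | .req e f => e.eval σ = f.eval σ
  | .rlt e f => e.eval σ < f.eval σ
  | .not b => ¬ b.holds σ
  | .and b c => b.holds σ ∧ c.holds σ

/-- Number of elementary operations (literals, reads, arithmetic) in the evaluation of an
expression. -/
def IExp.cost : IExp → ℕ
  | .const _ => 1
  | .var _ => 1
  | .get _ i => i.cost + 1
  | .add e f => e.cost + f.cost + 1
  | .sub e f => e.cost + f.cost + 1

def RExp.cost : RExp → ℕ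
  | .const _ => 1
  | .var _ => 1
  | .get _ i => i.cost + 1
  | .add e f => e.cost + f.cost + 1
  | .sub e f => e.cost + f.cost + 1
  | .mul e f => e.cost + f.cost + 1
  | .div e f => e.cost + f.cost + 1

def BExp.cost : BExp → ℕ
  | .ieq e f => e.cost + f.cost + 1
  | .ilt e f => e.cost + f.cost + 1
  | .req e f => e.cost + f.cost + 1
  | .rlt e f => e.cost + f.cost + 1
  | .not b => b.cost + 1
  | .and b c => b.cost + c.cost + 1

def Store.setIvar (σ : Store) (x k : ℕ) : Store :=
  { σ with ivar := Function.update σ.ivar x k }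

noncomputable def Store.setRvar (σ : Store) (x : ℕ) (r : ℝ) : Store :=
  { σ with rvar := Function.update σ.rvar x r }

def Store.setIarr (σ : Store) (A i k : ℕ) : Store :=
  { σ with iarr := Function.update σ.iarr A (Function.update (σ.iarr A) i k) }

noncomputable def Store.setRarr (σ : Store) (A i : ℕ) (r : ℝ) : Store :=
  { σ with rarr := Function.update σ.rarr A (Function.update (σ.rarr A) i r) }

/-- `Exec c σ t τ`: started in the memory `σ`, the program `c` halts after `t` steps in the
memory `τ`. -/
inductive Exec : Cmd → Store → ℕ → Store → Prop where
  | skip (σ : Store) : Exec .skip σ 1 σ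
  | iset (x : ℕ) (e : IExp) (σ : Store) :
      Exec (.iset x e) σ (e.cost + 1) (σ.setIvar x (e.eval σ))
  | rset (x : ℕ) (e : RExp) (σ : Store) :
      Exec (.rset x e) σ (e.cost + 1) (σ.setRvar x (e.eval σ))
  | iput (A : ℕ) (i e : IExp) (σ : Store) :
      Exec (.iput A i e) σ (i.cost + e.cost + 1) (σ.setIarr A (i.eval σ) (e.eval σ))
  | rput (A : ℕ) (i : IExp) (e : RExp) (σ : Store) :
      Exec (.rput A i e) σ (i.cost + e.cost + 1) (σ.setRarr A (i.eval σ) (e.eval σ))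
  | seq (c d : Cmd) (σ τ ρ : Store) (k l : ℕ) (h₁ : Exec c σ k τ) (h₂ : Exec d τ l ρ) :
      Exec (.seq c d) σ (k + l) ρ
  | ite_true (b : BExp) (c d : Cmd) (σ τ : Store) (k : ℕ) (hb : b.holds σ) (h : Exec c σ k τ) :
      Exec (.ite b c d) σ (b.cost + k + 1) τ
  | ite_false (b : BExp) (c d : Cmd) (σ τ : Store) (k : ℕ) (hb : ¬ b.holds σ)
      (h : Exec d σ k τ) : Exec (.ite b c d) σ (b.cost + k + 1) τ
  | while_false (b : BExp) (c : Cmd) (σ : Store) (hb : ¬ b.holds σ) :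
      Exec (.while b c) σ (b.cost + 1) σ
  | while_true (b : BExp) (c : Cmd) (σ τ ρ : Store) (k l : ℕ) (hb : b.holds σ)
      (h₁ : Exec c σ k τ) (h₂ : Exec (.while b c) τ l ρ) :
      Exec (.while b c) σ (b.cost + k + l + 1) ρ

end RealRAM

/-! ### The stored data -/

namespace BCData

open RealRAM

open scoped Classical in
/-- Weight of an edge as stored in memory; `-1` stands for a missing edge. -/
noncomputable def weightCode {V : Type*} (G : WDigraph V) (a b : V) : ℝ :=
  if G.Adj a b then G.weight a b else -1

open scoped Classical in
/-- Distance as stored in memory; `-1` stands for an infinite distance. -/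
noncomputable def distCode {V : Type*} (G : WDigraph V) (s t : V) : ℝ :=
  if G.Reachable s t then G.dist s t else -1

/-- The arrays `off`, `src`, `dst` store, for each vertex `s`, a list of the edges `(a, b)` with
`R s a b`: each one occurs exactly once, in some order, and the list of `s` occupies the positions
from `off s` to `off (s + 1) - 1`. -/
def StoresEdgeLists {n : ℕ} (off src dst : ℕ → ℕ) (R : Fin n → Fin n → Fin n → Prop) : Prop :=
  off 0 = 0 ∧
  ∀ s : Fin n, ∃ L : List (Fin n × Fin n),
    L.Nodup ∧ (∀ e : Fin n × Fin n, e ∈ L ↔ R s e.1 e.2) ∧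
    off ((s : ℕ) + 1) = off (s : ℕ) + L.length ∧
    ∀ (i : ℕ) (hi : i < L.length),
      src (off (s : ℕ) + i) = ((L[i]'hi).1 : ℕ) ∧ dst (off (s : ℕ) + i) = ((L[i]'hi).2 : ℕ)

/-- The memory `σ` holds the graph `G` on the vertices `0, …, n - 1` together with its distances, its
shortest path counts, its betweenness centralities, the shortest path DAGs `DAG(s)`, and the
shortest path DAGs `DAG_R(s)` of the reversed graph. Matrices are stored in row-major order. All
other cells are arbitrary. -/
structure Holds {n : ℕ} (G : WDigraph (Fin n)) (σ : Store) : Prop where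
  size : σ.ivar 0 = n
  weights : ∀ a b : Fin n, σ.rarr 0 ((a : ℕ) * n + (b : ℕ)) = weightCode G a b
  dists : ∀ s t : Fin n, σ.rarr 1 ((s : ℕ) * n + (t : ℕ)) = distCode G s t
  counts : ∀ s t : Fin n, σ.rarr 2 ((s : ℕ) * n + (t : ℕ)) = (G.numShortest s t : ℝ)
  centralities : ∀ x : Fin n, σ.rarr 3 (x : ℕ) = G.betweenness x
  dags : StoresEdgeLists (σ.iarr 0) (σ.iarr 1) (σ.iarr 2) G.DagEdge
  revDags : StoresEdgeLists (σ.iarr 3) (σ.iarr 4) (σ.iarr 5) G.reverse.DagEdge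

/-- The memory `σ` holds the description of an update at `v` that leads to the graph `H`: the vertex
`v`, and the weights in `H` of the edges into `v` and of the edges out of `v`. -/
structure HoldsUpdate {n : ℕ} (H : WDigraph (Fin n)) (v : Fin n) (σ : Store) : Prop where
  vertex : σ.ivar 1 = (v : ℕ)
  incoming : ∀ u : Fin n, σ.rarr 4 (u : ℕ) = weightCode H u v
  outgoing : ∀ u : Fin n, σ.rarr 5 (u : ℕ) = weightCode H v u

end BCData

/-!
The program updates the distances and path counts, then the shortest path DAGs, then the
centralities, and avoids what would exceed the time bound, above all a scan of all edges of the
graph for every source.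

*Distances and path counts.* A shortest path of the new graph `H` visits the updated vertex `v` at
most once. Hence a shortest path of `H` to `v` is a path of the old graph `G` followed by one edge
into `v` (`WDigraph.IncUpdate.isShortest_iff_extends`), so the new distances and counts to `v` are
obtained from the old ones in time `O(n)` per source; reversal gives those from `v`. All other
shortest paths of `H` either pass through `v`, and are pairs of a path to `v` and a path from `v`,
or are old shortest paths that avoid `v` (`WDigraph.IncUpdate.numShortest_eq`). This costs `O(n ^ 2)`.

*Shortest path DAGs.* The edge `(a, b)` belongs to the DAG of `s` if and only if it is tight:
`d(s, b) = d(s, a) + w(a, b)`. If `(a, b)` is tight for `s` in `H`, then it is tight for `v` in `H`,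
or ends at `v`, or was tight for `s` in `G` (`WDigraph.IncUpdate.tight_or`). So it suffices to test,
for each `s`, the new DAG of `v` (found once, in time `O(n ^ 2)`), the `n` pairs that end at `v`,
and the old DAG of `s`. Since the DAG of `s` has at most `m*_s` edges, the total is at most a constant
times `∑ s, m*_s + n * m*_v + n ^ 2`. The same program applied to the transposed matrices updates
the DAGs of the reversed graph.

*Centralities.* By Brandes' recursion (`WDigraph.dependency_eq_sum`), the dependency of `s` on `a`
is a sum over the edges out of `a` in the DAG of `s`. The edges of the DAG are removed one by one,
always those into a vertex whose outgoing edges have all been removed, as in topological sorting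
(`BCData.Peel`); sorting by distance, with its logarithmic factor, is avoided. Each edge is handled
once, so that this costs a constant times `∑ s, m*_s + n ^ 2`.

*Running time.* `∑ s, m*_s = m*_avg n`, so the sum of these bounds is `O(m' n + n ^ 2)`
(`WDigraph.sum_mStar_add_le`). An undirected graph is processed as the directed graph of the
orientations of its edges, which at most doubles all `m*_x`.

Programs are analyzed with a Hoare logic that bounds running times: `RealRAM.RunsIn` for total
correctness within a number of steps, weakest preconditions `RealRAM.Cmd.wp` for loop-free programs,
invariants (`RealRAM.Runs.forLoop`) for counting loops, and the frame property `RealRAM.Exec.frame`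
that a program only changes what it assigns syntactically. The programs refer to variables and
arrays by number; besides the arrays whose contents are prescribed, `10`, `11`, `12` hold the matrices or
lists that a subprogram reads.
-/

/-! ### Walks, shortest paths and distances -/

namespace WDigraph

variable {V : Type*} {G H : WDigraph V} {s t u v x a b : V} {p q r : List V}

/-- `p` is the vertex sequence of a walk from `s` to `t`: a path that may repeat vertices. -/
def IsWalk (G : WDigraph V) (s t : V) (p : List V) : Prop :=
  p.head? = some s ∧ p.getLast? = some t ∧ p.IsChain G.Adj

theorem IsPath.isWalk (h : G.IsPath s t p) : G.IsWalk s t p := ⟨h.1, h.2.1, h.2.2.1⟩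

theorem IsWalk.isPath (h : G.IsWalk s t p) (hn : p.Nodup) : G.IsPath s t p :=
  ⟨h.1, h.2.1, h.2.2, hn⟩

theorem isWalk_singleton (G : WDigraph V) (s : V) : G.IsWalk s s [s] := ⟨rfl, rfl, .singleton _⟩

theorem pathWeight_append_cons (G : WDigraph V) (p : List V) (x : V) (r : List V) :
    G.pathWeight (p ++ x :: r) = G.pathWeight (p ++ [x]) + G.pathWeight (x :: r) := by
  induction p with
  | nil => simp [pathWeight]
  | cons a p ih =>
    cases p with
    | nil => simp [pathWeight]
    | cons b p => simp only [List.cons_append, pathWeight] at ih ⊢; rw [ih]; ring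

theorem isWalk_append_cons :
    G.IsWalk s t (p ++ x :: r) ↔ G.IsWalk s x (p ++ [x]) ∧ G.IsWalk x t (x :: r) := by
  unfold IsWalk
  rw [List.isChain_split]
  have h1 : (p ++ x :: r).head? = (p ++ [x]).head? := by cases p <;> simp
  have h2 : (p ++ x :: r).getLast? = (x :: r).getLast? := by
    rw [List.getLast?_append]; simp [List.getLast?_cons]
  rw [h1, h2]
  simp
  tauto

theorem pathWeight_nonneg : ∀ {p : List V}, p.IsChain G.Adj → 0 ≤ G.pathWeight p
  | [], _ => le_rfl
  | [_], _ => le_rfl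
  | a :: b :: l, h => by
    rw [List.isChain_cons_cons] at h
    exact add_nonneg (G.weight_pos a b h.1).le (pathWeight_nonneg h.2)

theorem IsWalk.exists_eq_append (h : G.IsWalk s t p) : ∃ q, p = q ++ [t] := by
  rcases List.eq_nil_or_concat p with rfl | ⟨q, y, rfl⟩
  · simp [IsWalk] at h
  · have := h.2.1
    simp at this
    exact ⟨q, by simp [this]⟩

theorem IsWalk.exists_eq_cons (h : G.IsWalk s t p) : ∃ q, p = s :: q := by
  cases p with
  | nil => simp [IsWalk] at h
  | cons y q =>
    have := h.1
    simp at this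
    exact ⟨q, by rw [this]⟩

theorem IsWalk.head_mem (h : G.IsWalk s t p) : s ∈ p := by
  obtain ⟨q, rfl⟩ := h.exists_eq_cons; simp

theorem IsWalk.getLast_mem (h : G.IsWalk s t p) : t ∈ p := by
  obtain ⟨q, rfl⟩ := h.exists_eq_append; simp

/-- Cutting the cycles out of a walk leaves a path; if there was a cycle, it had positive weight. -/
theorem IsWalk.exists_isPath (h : G.IsWalk s t p) :
    ∃ q, G.IsPath s t q ∧ (q = p ∨ G.pathWeight q < G.pathWeight p) := by
  induction p generalizing s with
  | nil => simp [IsWalk] at h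
  | cons a p ih =>
    obtain rfl : a = s := by simpa using h.1
    cases p with
    | nil => exact ⟨[a], h.isPath (by simp), .inl rfl⟩
    | cons b l =>
      have hab : G.Adj a b := (List.isChain_cons_cons.1 h.2.2).1
      have hw : G.IsWalk b t (b :: l) :=
        ⟨rfl, by simpa [List.getLast?_cons_cons] using h.2.1, (List.isChain_cons_cons.1 h.2.2).2⟩
      obtain ⟨q, hq, hqw⟩ := ih hw
      have hle : G.pathWeight q ≤ G.pathWeight (b :: l) := by
        rcases hqw with rfl | h'
        · exact le_rfl
        · exact h'.le
      have hpos := G.weight_pos a b hab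
      by_cases ha : a ∈ q
      · obtain ⟨q₁, q₂, rfl⟩ := List.append_of_mem ha
        have hs := isWalk_append_cons.1 hq.isWalk
        refine ⟨a :: q₂, hs.2.isPath ((List.nodup_append.1 hq.2.2.2).2.1), .inr ?_⟩
        have := pathWeight_nonneg hs.1.2.2
        rw [pathWeight_append_cons] at hle
        simp only [pathWeight]
        linarith
      · obtain ⟨q', rfl⟩ := hq.isWalk.exists_eq_cons
        refine ⟨a :: b :: q', ⟨rfl, ?_, ?_, ?_⟩, ?_⟩
        · simpa [List.getLast?_cons_cons] using hq.2.1
        · exact List.isChain_cons_cons.2 ⟨hab, hq.2.2.1⟩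
        · exact List.nodup_cons.2 ⟨ha, hq.2.2.2⟩
        · rcases hqw with h' | h'
          · rw [h']; exact .inl rfl
          · right; simp only [pathWeight]; linarith

theorem IsWalk.reachable (h : G.IsWalk s t p) : G.Reachable s t := by
  obtain ⟨q, hq, -⟩ := h.exists_isPath
  exact ⟨q, hq⟩

theorem reachable_refl (G : WDigraph V) (s : V) : G.Reachable s s :=
  (isWalk_singleton G s).reachable

theorem IsWalk.concat (h : G.IsWalk s u p) (ha : G.Adj u v) : G.IsWalk s v (p ++ [v]) := by
  obtain ⟨q, rfl⟩ := h.exists_eq_append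
  rw [List.append_assoc, List.singleton_append, isWalk_append_cons]
  exact ⟨h, rfl, rfl, by simpa using ha⟩

theorem IsWalk.pathWeight_concat (h : G.IsWalk s u p) (v : V) :
    G.pathWeight (p ++ [v]) = G.pathWeight p + G.weight u v := by
  obtain ⟨q, rfl⟩ := h.exists_eq_append
  rw [List.append_assoc, List.singleton_append, pathWeight_append_cons]
  simp [pathWeight]

theorem finite_setOf_isPath [Finite V] (G : WDigraph V) (s t : V) :
    {p | G.IsPath s t p}.Finite := by
  classical
  have := Fintype.ofFinite V
  have : {p : List V | p.Nodup}.Finite :=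
    Set.finite_coe_iff.1 (Finite.of_fintype {p : List V // p.Nodup})
  exact this.subset fun p hp => hp.2.2.2

theorem finite_setOf_isShortest [Finite V] (G : WDigraph V) (s t : V) :
    {p | G.IsShortest s t p}.Finite :=
  (finite_setOf_isPath G s t).subset fun _ hp => hp.1

theorem Reachable.exists_isShortest [Finite V] (h : G.Reachable s t) : ∃ p, G.IsShortest s t p := by
  obtain ⟨p, hp, hmin⟩ := Set.exists_min_image _ G.pathWeight (finite_setOf_isPath G s t) h
  exact ⟨p, hp, hmin⟩

theorem IsShortest.pathWeight_eq (h : G.IsShortest s t p) : G.pathWeight p = G.dist s t := by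
  refine (IsLeast.csInf_eq ?_).symm
  exact ⟨⟨p, h.1, rfl⟩, by rintro _ ⟨q, hq, rfl⟩; exact h.2 q hq⟩

theorem IsWalk.dist_le [Finite V] (h : G.IsWalk s t p) : G.dist s t ≤ G.pathWeight p := by
  obtain ⟨q, hq, hqp⟩ := h.exists_isPath
  obtain ⟨r, hr⟩ := h.reachable.exists_isShortest
  rw [← hr.pathWeight_eq]
  refine (hr.2 q hq).trans ?_
  rcases hqp with rfl | h'
  · exact le_rfl
  · exact h'.le

/-- A shortest path is a walk whose weight is the distance: such a walk repeats no vertex, because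
the edge weights are positive. -/
theorem isShortest_iff [Finite V] :
    G.IsShortest s t p ↔ G.IsWalk s t p ∧ G.pathWeight p ≤ G.dist s t := by
  refine ⟨fun h => ⟨h.1.isWalk, h.pathWeight_eq.le⟩, fun ⟨h, hw⟩ => ?_⟩
  obtain ⟨q, hq, rfl | hqp⟩ := h.exists_isPath
  · exact ⟨hq, fun r hr => hw.trans hr.isWalk.dist_le⟩
  · exact absurd (hq.isWalk.dist_le) (by linarith)

theorem Reachable.exists_isWalk [Finite V] (h : G.Reachable s t) :
    ∃ p, G.IsWalk s t p ∧ G.pathWeight p = G.dist s t := by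
  obtain ⟨p, hp⟩ := h.exists_isShortest
  exact ⟨p, hp.1.isWalk, hp.pathWeight_eq⟩

theorem Reachable.dist_nonneg [Finite V] (h : G.Reachable s t) : 0 ≤ G.dist s t := by
  obtain ⟨p, hp, hw⟩ := h.exists_isWalk
  rw [← hw]; exact pathWeight_nonneg hp.2.2

theorem dist_self [Finite V] (G : WDigraph V) (s : V) : G.dist s s = 0 :=
  le_antisymm ((isWalk_singleton G s).dist_le) (reachable_refl G s).dist_nonneg

theorem isWalk_append (h₁ : G.IsWalk s u p) (h₂ : G.IsWalk u t q) :
    G.IsWalk s t (p.dropLast ++ q) ∧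
      G.pathWeight (p.dropLast ++ q) = G.pathWeight p + G.pathWeight q := by
  obtain ⟨p', rfl⟩ := h₁.exists_eq_append
  obtain ⟨q', rfl⟩ := h₂.exists_eq_cons
  rw [List.dropLast_concat]
  exact ⟨isWalk_append_cons.2 ⟨h₁, h₂⟩, pathWeight_append_cons ..⟩

theorem Reachable.trans [Finite V] (h₁ : G.Reachable s u) (h₂ : G.Reachable u t) :
    G.Reachable s t := by
  obtain ⟨p, hp, -⟩ := h₁.exists_isWalk
  obtain ⟨q, hq, -⟩ := h₂.exists_isWalk
  exact (isWalk_append hp hq).1.reachable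

theorem Reachable.dist_triangle [Finite V] (h₁ : G.Reachable s u) (h₂ : G.Reachable u t) :
    G.dist s t ≤ G.dist s u + G.dist u t := by
  obtain ⟨p, hp, hpw⟩ := h₁.exists_isWalk
  obtain ⟨q, hq, hqw⟩ := h₂.exists_isWalk
  rw [← hpw, ← hqw, ← (isWalk_append hp hq).2]
  exact (isWalk_append hp hq).1.dist_le

theorem reachable_of_adj (h : G.Adj a b) : G.Reachable a b :=
  ((isWalk_singleton G a).concat h).reachable

theorem dist_le_weight [Finite V] (h : G.Adj a b) : G.dist a b ≤ G.weight a b := by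
  have := ((isWalk_singleton G a).concat h).dist_le
  simpa [pathWeight] using this

theorem Reachable.dist_adj_le [Finite V] (h : G.Reachable s a) (hab : G.Adj a b) :
    G.dist s b ≤ G.dist s a + G.weight a b :=
  (h.dist_triangle (reachable_of_adj hab)).trans (by linarith [dist_le_weight hab])

/-! ### Shortest paths through a vertex -/

/-- The vertex `v` lies on a shortest path from `s` to `t`, in terms of distances. -/
def Between (G : WDigraph V) (s v t : V) : Prop :=
  G.Reachable s v ∧ G.Reachable v t ∧ G.dist s v + G.dist v t = G.dist s t

theorem isShortest_append_cons [Finite V] :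
    G.IsShortest s t (p ++ v :: r) ↔
      G.Between s v t ∧ G.IsShortest s v (p ++ [v]) ∧ G.IsShortest v t (v :: r) := by
  rw [isShortest_iff, isShortest_iff, isShortest_iff, isWalk_append_cons, pathWeight_append_cons]
  constructor
  · rintro ⟨⟨h₁, h₂⟩, hw⟩
    have t1 := h₁.reachable.dist_triangle h₂.reachable
    have t2 := h₁.dist_le
    have t3 := h₂.dist_le
    exact ⟨⟨h₁.reachable, h₂.reachable, by linarith⟩, ⟨h₁, by linarith⟩, ⟨h₂, by linarith⟩⟩
  · rintro ⟨hb, ⟨h₁, hw₁⟩, h₂, hw₂⟩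
    exact ⟨⟨h₁, h₂⟩, by linarith [hb.2.2]⟩

theorem isShortest_and_mem_iff [Finite V] :
    G.IsShortest s t p ∧ v ∈ p ↔
      G.Between s v t ∧ ∃ q r, G.IsShortest s v q ∧ G.IsShortest v t r ∧ q.dropLast ++ r = p := by
  constructor
  · rintro ⟨h, hv⟩
    obtain ⟨q, r, rfl⟩ := List.append_of_mem hv
    obtain ⟨h1, h2, h3⟩ := isShortest_append_cons.1 h
    exact ⟨h1, _, _, h2, h3, by simp⟩
  · rintro ⟨hb, q, r, hq, hr, rfl⟩
    obtain ⟨q', rfl⟩ := hq.1.isWalk.exists_eq_append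
    obtain ⟨r', rfl⟩ := hr.1.isWalk.exists_eq_cons
    rw [List.dropLast_concat]
    exact ⟨isShortest_append_cons.2 ⟨hb, hq, hr⟩, by simp⟩

open scoped Classical in
/-- The shortest paths from `s` to `t` through `v` are the pairs of a shortest path from `s` to `v`
and one from `v` to `t`. -/
theorem numShortestThrough_eq [Finite V] (G : WDigraph V) (s t v : V) :
    G.numShortestThrough s t v =
      if G.Between s v t then G.numShortest s v * G.numShortest v t else 0 := by
  unfold numShortestThrough
  split_ifs with hb
  · have : {p | G.IsShortest s t p ∧ v ∈ p} = (fun pq : List V × List V => pq.1.dropLast ++ pq.2) ''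
        ({q | G.IsShortest s v q} ×ˢ {r | G.IsShortest v t r}) := by
      ext p
      simp only [Set.mem_ofPred_eq, isShortest_and_mem_iff, Set.mem_image, Set.mem_prod,
        Prod.exists]
      simp [hb, and_assoc]
    rw [this, Set.InjOn.ncard_image, Set.ncard_prod]
    · rfl
    · rintro ⟨q₁, r₁⟩ ⟨hq₁, hr₁⟩ ⟨q₂, r₂⟩ ⟨hq₂, hr₂⟩ h
      simp only [Set.mem_ofPred_eq] at hq₁ hr₁ hq₂ hr₂ h
      have n₁ := hq₁.1.2.2.2
      have n₂ := hq₂.1.2.2.2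
      obtain ⟨q₁, rfl⟩ := hq₁.1.isWalk.exists_eq_append
      obtain ⟨q₂, rfl⟩ := hq₂.1.isWalk.exists_eq_append
      obtain ⟨r₁, rfl⟩ := hr₁.1.isWalk.exists_eq_cons
      obtain ⟨r₂, rfl⟩ := hr₂.1.isWalk.exists_eq_cons
      rw [List.dropLast_concat, List.dropLast_concat] at h
      have d₁ : v ∉ q₁ := fun hv => by simp [List.nodup_append] at n₁; exact n₁.2 v hv rfl
      have d₂ : v ∉ q₂ := fun hv => by simp [List.nodup_append] at n₂; exact n₂.2 v hv rfl
      have hpre : q₁ = q₂ ∧ r₁ = r₂ := by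
        clear * - h d₁ d₂
        induction q₁ generalizing q₂ with
        | nil => cases q₂ with
          | nil => simpa using h
          | cons => simp at h d₂; exact absurd h.1 d₂.1
        | cons a q₁ ih => cases q₂ with
          | nil => simp at h d₁; exact absurd h.1.symm d₁.1
          | cons b q₂ =>
            simp at h d₁ d₂
            have := ih q₂ h.2 d₁.2 d₂.2
            exact ⟨by rw [h.1, this.1], this.2⟩
      rw [hpre.1, hpre.2]
  · have : {p | G.IsShortest s t p ∧ v ∈ p} = ∅ := by
      ext p
      simp [isShortest_and_mem_iff, hb]
    rw [this, Set.ncard_empty]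

theorem numShortest_pos [Finite V] (h : G.Reachable s t) : 0 < G.numShortest s t := by
  rw [numShortest, Set.ncard_pos (finite_setOf_isShortest G s t)]
  exact h.exists_isShortest

theorem numShortest_eq_zero (h : ¬ G.Reachable s t) : G.numShortest s t = 0 := by
  have : {p | G.IsShortest s t p} = ∅ := by
    ext p
    simp only [Set.mem_ofPred_eq, Set.mem_empty_iff_false, iff_false]
    exact fun hp => h ⟨p, hp.1⟩
  rw [numShortest, this, Set.ncard_empty]

theorem between_right [Finite V] (h : G.Reachable s t) : G.Between s t t :=
  ⟨h, reachable_refl G t, by rw [dist_self, add_zero]⟩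

theorem numShortest_self [Finite V] (G : WDigraph V) (s : V) : G.numShortest s s = 1 := by
  have : {p | G.IsShortest s s p} = {[s]} := by
    ext p
    simp only [Set.mem_ofPred_eq, Set.mem_singleton_iff]
    constructor
    · intro h
      have hn := h.1.2.2.2
      have hl := h.1.2.1
      obtain ⟨q, rfl⟩ := h.1.isWalk.exists_eq_cons
      cases q with
      | nil => rfl
      | cons b q =>
        rw [List.getLast?_cons_cons] at hl
        exact absurd (List.mem_of_getLast? hl) (List.nodup_cons.1 hn).1
    · rintro rfl
      exact isShortest_iff.2 ⟨isWalk_singleton G s, by simp [pathWeight, dist_self]⟩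
  rw [numShortest, this, Set.ncard_singleton]

/-! ### Edges of shortest path DAGs -/

/-- In terms of distances, `(a, b)` is the last edge of a shortest path from `s` to `b`. -/
def Tight (G : WDigraph V) (s a b : V) : Prop :=
  G.Reachable s a ∧ G.Adj a b ∧ G.dist s b = G.dist s a + G.weight a b

theorem Tight.isShortest_concat [Finite V] (h : G.Tight s a b) (hp : G.IsShortest s a p) :
    G.IsShortest s b (p ++ [b]) := by
  rw [isShortest_iff, hp.1.isWalk.pathWeight_concat, h.2.2, hp.pathWeight_eq]
  exact ⟨hp.1.isWalk.concat h.2.1, le_rfl⟩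

theorem Tight.reachable [Finite V] (h : G.Tight s a b) : G.Reachable s b :=
  h.1.trans (reachable_of_adj h.2.1)

theorem Tight.dist_lt (h : G.Tight s a b) : G.dist s a < G.dist s b := by
  have := G.weight_pos a b h.2.1
  rw [h.2.2]; linarith

/-- The edges of the shortest path DAG of `s` are the tight ones. -/
theorem dagEdge_iff_tight [Finite V] : G.DagEdge s a b ↔ G.Tight s a b := by
  constructor
  · rintro ⟨t, p, hp, l, r, rfl⟩
    rw [List.append_assoc, show [a, b] ++ r = a :: (b :: r) from rfl] at hp
    obtain ⟨hb, h1, h2⟩ := isShortest_append_cons.1 hp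
    rw [show l ++ a :: b :: r = (l ++ [a]) ++ b :: r by simp] at hp
    obtain ⟨hb', h3, -⟩ := isShortest_append_cons.1 hp
    have hab : G.Adj a b := (List.isChain_cons_cons.1 h2.1.2.2.1).1
    exact ⟨hb.1, hab, by rw [← h3.pathWeight_eq, h1.1.isWalk.pathWeight_concat, h1.pathWeight_eq]⟩
  · intro h
    obtain ⟨p, hp⟩ := h.1.exists_isShortest
    refine ⟨b, _, h.isShortest_concat hp, ?_⟩
    obtain ⟨q, rfl⟩ := hp.1.isWalk.exists_eq_append
    exact ⟨q, [], by simp⟩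

/-! ### Reversal -/

theorem isWalk_reverse : G.reverse.IsWalk s t p ↔ G.IsWalk t s p.reverse := by
  unfold IsWalk
  rw [List.head?_reverse, List.getLast?_reverse, List.isChain_reverse]
  tauto

theorem pathWeight_reverse (G : WDigraph V) (p : List V) :
    G.reverse.pathWeight p = G.pathWeight p.reverse := by
  induction p with
  | nil => rfl
  | cons a p ih =>
    cases p with
    | nil => rfl
    | cons b p =>
      simp only [pathWeight, ih, List.reverse_cons, List.append_assoc, List.singleton_append]
      rw [pathWeight_append_cons G _ b [a]]
      simp [pathWeight, reverse, add_comm]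

theorem isPath_reverse : G.reverse.IsPath s t p ↔ G.IsPath t s p.reverse := by
  have := isWalk_reverse (G := G) (s := s) (t := t) (p := p)
  unfold IsWalk at this
  unfold IsPath
  rw [List.nodup_reverse]
  tauto

theorem isShortest_reverse : G.reverse.IsShortest s t p ↔ G.IsShortest t s p.reverse := by
  unfold IsShortest
  rw [isPath_reverse, pathWeight_reverse]
  refine and_congr_right fun _ => ⟨fun h q hq => ?_, fun h q hq => ?_⟩
  · have := h q.reverse (isPath_reverse.2 (by simpa using hq))
    rwa [pathWeight_reverse, List.reverse_reverse] at this
  · rw [pathWeight_reverse]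
    exact h _ (isPath_reverse.1 hq)

theorem reachable_reverse : G.reverse.Reachable s t ↔ G.Reachable t s := by
  constructor
  · rintro ⟨p, hp⟩; exact ⟨_, isPath_reverse.1 hp⟩
  · rintro ⟨p, hp⟩; exact ⟨p.reverse, isPath_reverse.2 (by simpa using hp)⟩

theorem dist_reverse (G : WDigraph V) (s t : V) : G.reverse.dist s t = G.dist t s := by
  unfold dist
  congr 1
  ext x
  constructor
  · rintro ⟨p, hp, rfl⟩; exact ⟨_, isPath_reverse.1 hp, pathWeight_reverse G p⟩
  · rintro ⟨p, hp, rfl⟩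
    exact ⟨p.reverse, isPath_reverse.2 (by simpa using hp), by simp [pathWeight_reverse]⟩

theorem numShortest_reverse (G : WDigraph V) (s t : V) :
    G.reverse.numShortest s t = G.numShortest t s := by
  unfold numShortest
  have : {p | G.reverse.IsShortest s t p} = List.reverse '' {p | G.IsShortest t s p} := by
    ext p
    simp only [Set.mem_ofPred_eq, isShortest_reverse, Set.mem_image]
    exact ⟨fun h => ⟨_, h, by simp⟩, by rintro ⟨q, hq, rfl⟩; simpa using hq⟩
  rw [this, Set.ncard_image_of_injective _ List.reverse_injective]

theorem edgeThrough_of_dagEdge (h : G.DagEdge s a b) : G.EdgeThrough s a b := by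
  obtain ⟨t, p, hp, hab⟩ := h
  exact ⟨s, t, p, hp, hp.1.isWalk.head_mem, hab⟩

theorem edgeThrough_of_dagEdge_reverse (h : G.reverse.DagEdge s a b) : G.EdgeThrough s b a := by
  obtain ⟨t, p, hp, hab⟩ := h
  refine ⟨t, s, p.reverse, isShortest_reverse.1 hp, by simpa using hp.1.isWalk.head_mem, ?_⟩
  rw [show [b, a] = [a, b].reverse from rfl, List.reverse_infix]
  exact hab

end WDigraph

/-! ### Distances and path counts after an incremental update -/

namespace WDigraph

variable {V : Type*} {G H : WDigraph V} {s t u v x a b : V} {p q r : List V}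

theorem IncUpdate.refl (G : WDigraph V) (v : V) : G.IncUpdate G v :=
  ⟨fun _ _ h => h, fun _ _ _ => le_rfl, fun _ _ _ _ => Iff.rfl, fun _ _ _ _ _ => rfl⟩

theorem IncUpdate.reverse (h : G.IncUpdate H v) : G.reverse.IncUpdate H.reverse v :=
  ⟨fun a b => h.adj_mono b a, fun a b => h.weight_le b a, fun a b ha hb => h.adj_eq b a hb ha,
    fun a b ha hb => h.weight_eq b a hb ha⟩

theorem IncUpdate.pathWeight_le (h : G.IncUpdate H v) :
    ∀ {p : List V}, p.IsChain G.Adj → H.pathWeight p ≤ G.pathWeight p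
  | [], _ => le_rfl
  | [_], _ => le_rfl
  | a :: b :: l, hp => by
    rw [List.isChain_cons_cons] at hp
    exact add_le_add (h.weight_le a b hp.1) (h.pathWeight_le hp.2)

theorem IncUpdate.isWalk (h : G.IncUpdate H v) (hp : G.IsWalk s t p) : H.IsWalk s t p :=
  ⟨hp.1, hp.2.1, hp.2.2.imp fun a b => h.adj_mono a b⟩

theorem IncUpdate.isChain_of_notMem (h : G.IncUpdate H v) :
    ∀ {p : List V}, p.IsChain H.Adj → v ∉ p → p.IsChain G.Adj ∧ G.pathWeight p = H.pathWeight p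
  | [], _, _ => ⟨.nil, rfl⟩
  | [_], _, _ => ⟨.singleton _, rfl⟩
  | a :: b :: l, hp, hv => by
    rw [List.isChain_cons_cons] at hp
    simp only [List.mem_cons, not_or] at hv
    have hab := (h.adj_eq a b (Ne.symm hv.1) (Ne.symm hv.2.1)).1 hp.1
    obtain ⟨h1, h2⟩ := h.isChain_of_notMem hp.2 (by simp [hv.2])
    refine ⟨List.isChain_cons_cons.2 ⟨hab, h1⟩, ?_⟩
    simp only [pathWeight, h2, h.weight_eq a b (Ne.symm hv.1) (Ne.symm hv.2.1) hab]

/-- Walks that avoid `v` are the same, with the same weights, before and after the update. -/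
theorem IncUpdate.isWalk_of_notMem (h : G.IncUpdate H v) (hp : H.IsWalk s t p) (hv : v ∉ p) :
    G.IsWalk s t p ∧ G.pathWeight p = H.pathWeight p :=
  have := h.isChain_of_notMem hp.2.2 hv
  ⟨⟨hp.1, hp.2.1, this.1⟩, this.2⟩

theorem IncUpdate.reachable (h : G.IncUpdate H v) (hr : G.Reachable s t) : H.Reachable s t := by
  obtain ⟨p, hp⟩ := hr
  exact (h.isWalk hp.isWalk).reachable

theorem IncUpdate.dist_le [Finite V] (h : G.IncUpdate H v) (hr : G.Reachable s t) :
    H.dist s t ≤ G.dist s t := by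
  obtain ⟨p, hp, hw⟩ := hr.exists_isWalk
  rw [← hw]
  exact (h.isWalk hp).dist_le.trans (h.pathWeight_le hp.2.2)

/-- `u` is reachable from `s` in the graph `G` before the update, and `(u, v)` is an edge of the
graph `H` after it. -/
def Extends (G H : WDigraph V) (s u v : V) : Prop := G.Reachable s u ∧ H.Adj u v

theorem IncUpdate.dist_le_of_extends [Finite V] (h : G.IncUpdate H v) (he : G.Extends H s u v) :
    H.Reachable s v ∧ H.dist s v ≤ G.dist s u + H.weight u v := by
  have hr := h.reachable he.1
  refine ⟨hr.trans (reachable_of_adj he.2), (hr.dist_adj_le he.2).trans ?_⟩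
  linarith [h.dist_le he.1]

/-- A shortest path to `v` in the new graph is a shortest path of the old graph followed by an edge
into `v`, since it visits `v` only once. -/
theorem IncUpdate.isShortest_iff_extends [Finite V] (h : G.IncUpdate H v) (hs : s ≠ v) :
    H.IsShortest s v p ↔ ∃ u q, G.Extends H s u v ∧ G.dist s u + H.weight u v = H.dist s v ∧
      G.IsShortest s u q ∧ q ++ [v] = p := by
  constructor
  · intro hp
    have hn := hp.1.2.2.2
    obtain ⟨q, rfl⟩ := hp.1.isWalk.exists_eq_append
    rcases List.eq_nil_or_concat q with rfl | ⟨q, u, rfl⟩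
    · have := hp.1.1
      simp at this
      exact absurd this.symm hs
    · have hvq : v ∉ q ++ [u] := fun hv => by
        rw [List.concat_eq_append, List.nodup_append] at hn
        exact hn.2.2 v hv v (by simp) rfl
      rw [List.concat_eq_append] at hp hn ⊢
      have hp' := hp.1.isWalk
      have hpw := hp.pathWeight_eq
      rw [List.append_assoc, List.singleton_append, isWalk_append_cons] at hp'
      have hadj : H.Adj u v := by simpa using hp'.2.2.2
      rw [hp'.1.pathWeight_concat] at hpw
      obtain ⟨hq, hqw⟩ := h.isWalk_of_notMem hp'.1 hvq
      have he : G.Extends H s u v := ⟨hq.reachable, hadj⟩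
      have h1 := (h.dist_le_of_extends he).2
      have h2 := hq.dist_le
      exact ⟨u, q ++ [u], he, by linarith, isShortest_iff.2 ⟨hq, by linarith⟩, rfl⟩
  · rintro ⟨u, q, he, hw, hq, rfl⟩
    have hqH := h.isWalk hq.1.isWalk
    rw [isShortest_iff, hqH.pathWeight_concat]
    refine ⟨hqH.concat he.2, ?_⟩
    have := h.pathWeight_le hq.1.2.2.1
    rw [hq.pathWeight_eq] at this
    linarith

theorem IncUpdate.exists_extends [Finite V] (h : G.IncUpdate H v) (hs : s ≠ v)
    (hr : H.Reachable s v) :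
    ∃ u, G.Extends H s u v ∧ G.dist s u + H.weight u v = H.dist s v := by
  obtain ⟨p, hp⟩ := hr.exists_isShortest
  obtain ⟨u, q, he, hw, -⟩ := (h.isShortest_iff_extends hs).1 hp
  exact ⟨u, he, hw⟩

open scoped Classical in
/-- The shortest paths to `v` after the update, counted by their last edges: a single pass over the
edges into `v` and the old counts suffices. -/
theorem IncUpdate.numShortest_eq_sum [Fintype V] (h : G.IncUpdate H v) (hs : s ≠ v) :
    H.numShortest s v = ∑ u with G.Extends H s u v ∧ G.dist s u + H.weight u v = H.dist s v,
      G.numShortest s u := by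
  unfold numShortest
  set U := Finset.univ.filter fun u =>
    G.Extends H s u v ∧ G.dist s u + H.weight u v = H.dist s v
  have hS : {p | H.IsShortest s v p} =
      ↑(U.biUnion fun u => (finite_setOf_isShortest G s u).toFinset.image (· ++ [v])) := by
    ext p
    simp only [Set.mem_ofPred_eq, h.isShortest_iff_extends hs, Finset.coe_biUnion, Set.mem_iUnion,
      Finset.mem_coe, Finset.mem_image, Set.Finite.mem_toFinset, U, Finset.mem_filter,
      Finset.mem_univ, true_and, exists_prop, exists_and_left, and_assoc]
  rw [hS, Set.ncard_coe_finset, Finset.card_biUnion]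
  · refine Finset.sum_congr rfl fun u _ => ?_
    rw [Finset.card_image_of_injective _ (List.append_left_injective _),
      Set.ncard_eq_toFinset_card _ (finite_setOf_isShortest G s u)]
  · intro u₁ _ u₂ _ hne
    rw [Function.onFun, Finset.disjoint_left]
    simp only [Finset.mem_image, Set.Finite.mem_toFinset, Set.mem_ofPred_eq]
    rintro _ ⟨q₁, hq₁, rfl⟩ ⟨q₂, hq₂, hq⟩
    obtain rfl := List.append_left_injective _ hq
    exact hne (Option.some_injective _ (hq₁.1.2.1.symm.trans hq₂.1.2.1))

/-- A shortest path of the new graph either passes through `v` or is a path of the old graph. -/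
theorem IncUpdate.between_or [Finite V] (h : G.IncUpdate H v) (hr : H.Reachable s t) :
    H.Between s v t ∨ G.Reachable s t ∧ G.dist s t = H.dist s t := by
  obtain ⟨p, hp⟩ := hr.exists_isShortest
  by_cases hv : v ∈ p
  · exact .inl (isShortest_and_mem_iff.1 ⟨hp, hv⟩).1
  · obtain ⟨h1, h2⟩ := h.isWalk_of_notMem hp.1.isWalk hv
    refine .inr ⟨h1.reachable, le_antisymm ?_ (h.dist_le h1.reachable)⟩
    rw [← hp.pathWeight_eq, ← h2]
    exact h1.dist_le

open scoped Classical in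
/-- The shortest paths of the new graph: those through `v`, and those of the old graph that avoid
`v`, provided the distance has not changed. -/
theorem IncUpdate.numShortest_eq [Finite V] (h : G.IncUpdate H v) (s t : V) :
    (H.numShortest s t : ℝ) =
      (if G.Reachable s t ∧ G.dist s t = H.dist s t then (G.numShortest s t : ℝ) -
        (if G.Between s v t then (G.numShortest s v : ℝ) * G.numShortest v t else 0) else 0) +
      (if H.Between s v t then (H.numShortest s v : ℝ) * H.numShortest v t else 0) := by
  have key : ∀ K : WDigraph V, K.numShortest s t =
      ({p | K.IsShortest s t p ∧ v ∉ p}).ncard + K.numShortestThrough s t v := by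
    intro K
    unfold numShortest numShortestThrough
    rw [← Set.ncard_union_eq (Set.disjoint_left.2 fun p hp hp' => hp.2 hp'.2)
      ((finite_setOf_isShortest K s t).subset fun p hp => hp.1)
      ((finite_setOf_isShortest K s t).subset fun p hp => hp.1)]
    congr 1
    ext p
    simp only [Set.mem_ofPred_eq, Set.mem_union]
    tauto
  have e1 : (H.numShortestThrough s t v : ℝ) =
      if H.Between s v t then (H.numShortest s v : ℝ) * H.numShortest v t else 0 := by
    rw [numShortestThrough_eq]; push_cast; rfl
  have e2 : (G.numShortestThrough s t v : ℝ) =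
      if G.Between s v t then (G.numShortest s v : ℝ) * G.numShortest v t else 0 := by
    rw [numShortestThrough_eq]; push_cast; rfl
  rw [← e1, ← e2, key H, key G]
  push_cast
  congr 1
  split_ifs with hc
  · have : {p | H.IsShortest s t p ∧ v ∉ p} = {p | G.IsShortest s t p ∧ v ∉ p} := by
      ext p
      simp only [Set.mem_ofPred_eq, isShortest_iff]
      constructor
      · rintro ⟨⟨hp, hw⟩, hv⟩
        obtain ⟨h1, h2⟩ := h.isWalk_of_notMem hp hv
        exact ⟨⟨h1, by rw [h2, hc.2]; exact hw⟩, hv⟩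
      · rintro ⟨⟨hp, hw⟩, hv⟩
        exact ⟨⟨h.isWalk hp, (h.pathWeight_le hp.2.2).trans (hc.2 ▸ hw)⟩, hv⟩
    rw [this]; ring
  · have : {p | H.IsShortest s t p ∧ v ∉ p} = ∅ := by
      ext p
      simp only [Set.mem_ofPred_eq, Set.mem_empty_iff_false, iff_false]
      rintro ⟨hp, hv⟩
      obtain ⟨h1, h2⟩ := h.isWalk_of_notMem hp.1.isWalk hv
      refine hc ⟨h1.reachable, le_antisymm ?_ (h.dist_le h1.reachable)⟩
      rw [← hp.pathWeight_eq, ← h2]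
      exact h1.dist_le
    rw [this]; simp

/-- A new edge of the shortest path DAG of `s` enters `v` or lies behind `v`, hence in the shortest
path DAG of `v`. -/
theorem IncUpdate.tight_or [Finite V] (h : G.IncUpdate H v) (ht : H.Tight s a b) :
    H.Tight v a b ∨ b = v ∨ G.Tight s a b := by
  by_cases hb : b = v
  · exact .inr (.inl hb)
  obtain ⟨p, hp⟩ := ht.1.exists_isShortest
  by_cases hv : v ∈ p
  · left
    have hbt := (isShortest_and_mem_iff.1 ⟨hp, hv⟩).1
    refine ⟨hbt.2.1, ht.2.1, le_antisymm (hbt.2.1.dist_adj_le ht.2.1) ?_⟩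
    have := hbt.1.dist_triangle (hbt.2.1.trans (reachable_of_adj ht.2.1))
    linarith [hbt.2.2, ht.2.2]
  · right; right
    have hpb := ht.isShortest_concat hp
    have hvb : v ∉ p ++ [b] := by simp [hv, Ne.symm hb]
    have hav : a ≠ v := fun hav => hv (hav ▸ hp.1.isWalk.getLast_mem)
    have hadj := (h.adj_eq a b hav hb).1 ht.2.1
    obtain ⟨h1, h2⟩ := h.isWalk_of_notMem hpb.1.isWalk hvb
    obtain ⟨h3, h4⟩ := h.isWalk_of_notMem hp.1.isWalk hv
    refine ⟨h3.reachable, hadj, le_antisymm (h3.reachable.dist_adj_le hadj) ?_⟩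
    rw [← h.weight_eq a b hav hb hadj]
    have e1 := h.dist_le h1.reachable
    have e2 := h3.dist_le
    rw [h4, hp.pathWeight_eq] at e2
    linarith [ht.2.2]

theorem not_tight_self_right [Finite V] (G : WDigraph V) (s a : V) : ¬ G.Tight s a s := fun h => by
  have := h.dist_lt
  rw [dist_self] at this
  linarith [h.1.dist_nonneg]

/-! ### Dependencies -/

open scoped Classical in
/-- The shortest paths from `a` to `t`, counted by their first edges. -/
theorem numShortest_eq_sum_first [Fintype V] (G : WDigraph V) (h : a ≠ t) :
    G.numShortest a t = ∑ b with G.Adj a b ∧ G.Reachable b t ∧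
      G.weight a b + G.dist b t = G.dist a t, G.numShortest b t := by
  -- the count by last edges in the reversed graph, for the update that changes nothing
  have := (IncUpdate.refl G.reverse a).numShortest_eq_sum h.symm
  simp only [numShortest_reverse, Extends, reachable_reverse, dist_reverse] at this
  rw [this]
  refine Finset.sum_congr (Finset.filter_congr fun b _ => ?_) fun _ _ => rfl
  simp only [reverse]
  rw [add_comm]
  tauto

/-- The dependency of `s` on `a`: the contribution of the source `s` to the betweenness centrality
of `a`. -/
noncomputable def dependency [Fintype V] [DecidableEq V] (G : WDigraph V) (s a : V) : ℝ :=
  ∑ t with t ≠ a, (G.numShortestThrough s t a : ℝ) / (G.numShortest s t : ℝ)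

theorem betweenness_eq_sum_dependency [Fintype V] [DecidableEq V] (G : WDigraph V) (x : V) :
    G.betweenness x = ∑ s with s ≠ x, G.dependency s x := rfl

theorem tight_and_between_iff [Finite V] :
    G.Between s a t ∧ (G.Adj a b ∧ G.Reachable b t ∧ G.weight a b + G.dist b t = G.dist a t) ↔
      G.Tight s a b ∧ G.Between s b t := by
  constructor
  · rintro ⟨⟨h1, h2, h3⟩, h4, h5, h6⟩
    have e1 := h1.dist_adj_le h4
    have e2 := (h1.trans (reachable_of_adj h4)).dist_triangle h5
    exact ⟨⟨h1, h4, by linarith⟩, h1.trans (reachable_of_adj h4), h5, by linarith⟩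
  · rintro ⟨⟨h1, h2, h3⟩, h4, h5, h6⟩
    have hr := (reachable_of_adj h2).trans h5
    have e1 := h1.dist_triangle hr
    have e2 := (reachable_of_adj h2).dist_triangle h5
    have e3 := dist_le_weight h2
    exact ⟨⟨h1, hr, by linarith⟩, h2, h5, by linarith⟩

open scoped Classical in
/-- Brandes' recursion: dependencies are accumulated backwards along the shortest path DAG of `s`.
For `t ≠ a`, the shortest paths from `s` to `t` through `a` are split by the successor of `a`. -/
theorem dependency_eq_sum [Fintype V] [DecidableEq V] (G : WDigraph V) (s a : V) :
    G.dependency s a = ∑ b with G.Tight s a b,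
      (G.numShortest s a : ℝ) / G.numShortest s b * (1 + G.dependency s b) := by
  have hR : ∀ b ∈ Finset.univ.filter fun b => G.Tight s a b,
      (G.numShortest s a : ℝ) / G.numShortest s b * (1 + G.dependency s b) =
      ∑ t with t ≠ a, if G.Between s b t then
        (G.numShortest s a : ℝ) * G.numShortest b t / G.numShortest s t else 0 := by
    intro b hb
    have hb := (Finset.mem_filter.1 hb).2
    have hpos : (G.numShortest s b : ℝ) ≠ 0 := by exact_mod_cast (numShortest_pos hb.reachable).ne'
    have h1 : 1 + G.dependency s b =
        ∑ t, (G.numShortestThrough s t b : ℝ) / (G.numShortest s t : ℝ) := by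
      rw [dependency, ← Finset.add_sum_erase _ _ (Finset.mem_univ b)]
      congr 1
      · rw [numShortestThrough_eq, if_pos (between_right hb.reachable), numShortest_self, mul_one,
          div_self hpos]
      · congr 1; ext t; simp
    rw [h1, ← Finset.add_sum_erase _ _ (Finset.mem_univ a)]
    have hza : G.numShortestThrough s a b = 0 := by
      rw [numShortestThrough_eq, if_neg]
      intro hbt
      have := hbt.2.1.dist_nonneg
      linarith [hb.dist_lt, hbt.2.2]
    rw [hza, Nat.cast_zero, zero_div, zero_add, Finset.mul_sum]
    refine Finset.sum_congr (by ext t; simp) fun t _ => ?_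
    rw [numShortestThrough_eq]
    split_ifs
    · push_cast; field_simp
    · simp
  rw [Finset.sum_congr rfl hR, Finset.sum_comm, dependency]
  refine Finset.sum_congr rfl fun t ht => ?_
  have ht := (Finset.mem_filter.1 ht).2
  rw [numShortestThrough_eq, ← Finset.sum_filter, Finset.filter_filter]
  have hset : (Finset.univ.filter fun b => G.Tight s a b ∧ G.Between s b t) =
      Finset.univ.filter fun b => G.Between s a t ∧ (G.Adj a b ∧ G.Reachable b t ∧
        G.weight a b + G.dist b t = G.dist a t) :=
    Finset.filter_congr fun b _ => tight_and_between_iff.symm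
  rw [hset]
  split_ifs with hbt
  · rw [numShortest_eq_sum_first G ht.symm]
    simp only [hbt, true_and]
    push_cast
    rw [Finset.mul_sum, Finset.sum_div]
  · simp [hbt]

/-! ### Sizes -/

theorem ncard_dagEdge_le [Finite V] (G : WDigraph V) (s : V) :
    {e : V × V | G.DagEdge s e.1 e.2}.ncard ≤ G.mStar s :=
  Set.ncard_le_ncard (fun _ h => edgeThrough_of_dagEdge h) (Set.toFinite _)

theorem ncard_dagEdge_reverse_le [Finite V] (G : WDigraph V) (s : V) :
    {e : V × V | G.reverse.DagEdge s e.1 e.2}.ncard ≤ G.mStar s := by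
  unfold mStar
  rw [← Set.ncard_image_of_injective _ Prod.swap_injective]
  refine Set.ncard_le_ncard ?_ (Set.toFinite _)
  rintro _ ⟨e, he, rfl⟩
  exact edgeThrough_of_dagEdge_reverse he

theorem mStarAvg_mul [Fintype V] [Nonempty V] (G : WDigraph V) :
    G.mStarAvg * (Fintype.card V : ℝ) = ∑ x, (G.mStar x : ℝ) := by
  unfold mStarAvg
  have : (Fintype.card V : ℝ) ≠ 0 := by exact_mod_cast Fintype.card_ne_zero
  field_simp

/-- The total size of all shortest path DAGs before and after the update, together with the time for
scanning the new shortest path DAG of `v` once for every source, is `O(m' n)`. -/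
theorem sum_mStar_add_le [Fintype V] [Nonempty V] (G H : WDigraph V) (v : V) :
    ((∑ x, G.mStar x + ∑ x, H.mStar x + Fintype.card V * H.mStar v : ℕ) : ℝ) ≤
      2 * (WDigraph.mPrime G H v * (Fintype.card V : ℝ)) := by
  push_cast
  rw [← mStarAvg_mul, ← mStarAvg_mul, mPrime]
  have h0 : (0 : ℝ) ≤ Fintype.card V := Nat.cast_nonneg _
  have h1 := mul_le_mul_of_nonneg_right (le_max_left G.mStarAvg H.mStarAvg) h0
  have h2 := mul_le_mul_of_nonneg_right (le_max_right G.mStarAvg H.mStarAvg) h0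
  have h3 := mul_le_mul_of_nonneg_right (le_max_right (G.mStar v : ℝ) (H.mStar v : ℝ)) h0
  have h4 : (0 : ℝ) ≤ max (G.mStar v : ℝ) (H.mStar v : ℝ) * Fintype.card V := by positivity
  nlinarith

end WDigraph

namespace WGraph

variable {V : Type*}

theorem IncUpdate.toDigraph {G H : WGraph V} {v : V} (h : G.IncUpdate H v) :
    G.toDigraph.IncUpdate H.toDigraph v where
  adj_mono a b hab := h.edge_mono s(a, b) hab
  weight_le a b hab := h.weight_le s(a, b) hab
  adj_eq a b ha hb := h.edge_eq s(a, b) (by simp [ha.symm, hb.symm])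
  weight_eq a b ha hb hab := h.weight_eq s(a, b) hab (by simp [ha.symm, hb.symm])

/-- Every undirected edge has two orientations. -/
theorem mStar_toDigraph_le [Finite V] (G : WGraph V) (x : V) :
    G.toDigraph.mStar x ≤ 2 * G.mStar x := by
  classical
  obtain ⟨f, hf⟩ := Countable.exists_injective_nat V
  unfold mStar WDigraph.mStar
  set T := {e : Sym2 V | ∃ a b, e = s(a, b) ∧ G.toDigraph.EdgeThrough x a b}
  have hT : (T ×ˢ (Set.univ : Set Bool)).ncard = 2 * T.ncard := by
    rw [Set.ncard_prod, Set.ncard_univ, mul_comm]; simp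
  rw [← hT]
  refine Set.ncard_le_ncard_of_injOn (fun e => (s(e.1, e.2), decide (f e.1 < f e.2))) ?_ ?_
    (Set.toFinite _)
  · rintro ⟨a, b⟩ hab
    exact ⟨⟨a, b, rfl, hab⟩, trivial⟩
  · rintro ⟨a, b⟩ - ⟨c, d⟩ - he
    simp only [Prod.mk.injEq, Sym2.eq_iff, decide_eq_decide] at he
    obtain ⟨⟨rfl, rfl⟩ | ⟨rfl, rfl⟩, h⟩ := he
    · rfl
    · have : f a = f b := by omega
      rw [hf this]

theorem mPrime_toDigraph_le [Fintype V] (G H : WGraph V) (v : V) :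
    WDigraph.mPrime G.toDigraph H.toDigraph v ≤ 2 * mPrime G H v := by
  have h1 : ∀ (K : WGraph V) x, (K.toDigraph.mStar x : ℝ) ≤ 2 * K.mStar x := fun K x => by
    exact_mod_cast mStar_toDigraph_le K x
  have h2 : ∀ K : WGraph V, K.toDigraph.mStarAvg ≤ 2 * K.mStarAvg := fun K => by
    unfold mStarAvg WDigraph.mStarAvg
    rw [← mul_div_assoc, Finset.mul_sum]
    gcongr with x
    exact h1 K x
  unfold mPrime WDigraph.mPrime
  rw [mul_add, mul_max_of_nonneg _ _ zero_le_two, mul_max_of_nonneg _ _ zero_le_two]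
  exact add_le_add (max_le_max (h2 G) (h2 H)) (max_le_max (h1 G v) (h1 H v))

end WGraph

/-! ### Reasoning about programs -/

namespace RealRAM

attribute [simp] IExp.eval RExp.eval BExp.holds Store.setIvar Store.setRvar Store.setIarr
  Store.setRarr Function.update_apply

infixr:60 " ;; " => Cmd.seq

/-- `c` may assign the integer variable `x`. -/
def Cmd.setsI : Cmd → ℕ → Bool
  | .iset y _, x => y == x
  | .seq c d, x => c.setsI x || d.setsI x
  | .ite _ c d, x => c.setsI x || d.setsI x
  | .while _ c, x => c.setsI x
  | _, _ => false

/-- `c` may assign the real variable `x`. -/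
def Cmd.setsR : Cmd → ℕ → Bool
  | .rset y _, x => y == x
  | .seq c d, x => c.setsR x || d.setsR x
  | .ite _ c d, x => c.setsR x || d.setsR x
  | .while _ c, x => c.setsR x
  | _, _ => false

/-- `c` may write to the integer array `A`. -/
def Cmd.putsI : Cmd → ℕ → Bool
  | .iput B _ _, A => B == A
  | .seq c d, A => c.putsI A || d.putsI A
  | .ite _ c d, A => c.putsI A || d.putsI A
  | .while _ c, A => c.putsI A
  | _, _ => false

/-- `c` may write to the real array `A`. -/
def Cmd.putsR : Cmd → ℕ → Bool
  | .rput B _ _, A => B == A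
  | .seq c d, A => c.putsR A || d.putsR A
  | .ite _ c d, A => c.putsR A || d.putsR A
  | .while _ c, A => c.putsR A
  | _, _ => false

/-- The memories `σ` and `τ` differ only in variables and arrays that `c` may write. -/
structure Frame (c : Cmd) (σ τ : Store) : Prop where
  ivar : ∀ x, c.setsI x = false → τ.ivar x = σ.ivar x
  rvar : ∀ x, c.setsR x = false → τ.rvar x = σ.rvar x
  iarr : ∀ A, c.putsI A = false → τ.iarr A = σ.iarr A
  rarr : ∀ A, c.putsR A = false → τ.rarr A = σ.rarr A

theorem Frame.refl (c : Cmd) (σ : Store) : Frame c σ σ :=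
  ⟨fun _ _ => rfl, fun _ _ => rfl, fun _ _ => rfl, fun _ _ => rfl⟩

theorem Frame.trans {c : Cmd} {σ τ ρ : Store} (h₁ : Frame c σ τ) (h₂ : Frame c τ ρ) :
    Frame c σ ρ :=
  ⟨fun x h => (h₂.ivar x h).trans (h₁.ivar x h), fun x h => (h₂.rvar x h).trans (h₁.rvar x h),
    fun x h => (h₂.iarr x h).trans (h₁.iarr x h), fun x h => (h₂.rarr x h).trans (h₁.rarr x h)⟩

theorem Frame.mono {c d : Cmd} {σ τ : Store} (h : Frame c σ τ)
    (h₁ : ∀ x, d.setsI x = false → c.setsI x = false)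
    (h₂ : ∀ x, d.setsR x = false → c.setsR x = false)
    (h₃ : ∀ x, d.putsI x = false → c.putsI x = false)
    (h₄ : ∀ x, d.putsR x = false → c.putsR x = false) : Frame d σ τ :=
  ⟨fun x hx => h.ivar x (h₁ x hx), fun x hx => h.rvar x (h₂ x hx),
    fun x hx => h.iarr x (h₃ x hx), fun x hx => h.rarr x (h₄ x hx)⟩

theorem Frame.seq_left {c d : Cmd} {σ τ : Store} (h : Frame c σ τ) : Frame (c ;; d) σ τ := by
  apply h.mono <;> intro x hx <;>
    simp only [Cmd.setsI, Cmd.setsR, Cmd.putsI, Cmd.putsR, Bool.or_eq_false_iff] at hx <;>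
    exact hx.1

theorem Frame.seq_right {c d : Cmd} {σ τ : Store} (h : Frame d σ τ) : Frame (c ;; d) σ τ := by
  apply h.mono <;> intro x hx <;>
    simp only [Cmd.setsI, Cmd.setsR, Cmd.putsI, Cmd.putsR, Bool.or_eq_false_iff] at hx <;>
    exact hx.2

theorem Exec.frame {c : Cmd} {σ τ : Store} {t : ℕ} (h : Exec c σ t τ) : Frame c σ τ := by
  induction h with
  | skip σ => exact Frame.refl _ _
  | iset x e σ =>
    refine ⟨fun y hy => ?_, fun _ _ => rfl, fun _ _ => rfl, fun _ _ => rfl⟩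
    simp only [Cmd.setsI, beq_eq_false_iff_ne] at hy
    simp [hy.symm]
  | rset x e σ =>
    refine ⟨fun _ _ => rfl, fun y hy => ?_, fun _ _ => rfl, fun _ _ => rfl⟩
    simp only [Cmd.setsR, beq_eq_false_iff_ne] at hy
    simp [hy.symm]
  | iput A i e σ =>
    refine ⟨fun _ _ => rfl, fun _ _ => rfl, fun y hy => ?_, fun _ _ => rfl⟩
    simp only [Cmd.putsI, beq_eq_false_iff_ne] at hy
    simp [hy.symm]
  | rput A i e σ =>
    refine ⟨fun _ _ => rfl, fun _ _ => rfl, fun _ _ => rfl, fun y hy => ?_⟩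
    simp only [Cmd.putsR, beq_eq_false_iff_ne] at hy
    simp [hy.symm]
  | seq c d σ τ ρ k l _ _ ih₁ ih₂ => exact ih₁.seq_left.trans ih₂.seq_right
  | ite_true b c d σ τ k _ _ ih =>
    exact (ih.seq_left (d := d)).mono (fun _ h => h) (fun _ h => h) (fun _ h => h) (fun _ h => h)
  | ite_false b c d σ τ k _ _ ih =>
    exact (ih.seq_right (c := c)).mono (fun _ h => h) (fun _ h => h) (fun _ h => h) (fun _ h => h)
  | while_false b c σ _ => exact Frame.refl _ _
  | while_true b c σ τ ρ k l _ _ _ ih₁ ih₂ =>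
    exact (ih₁.mono (d := .while b c) (fun _ h => h) (fun _ h => h) (fun _ h => h)
      (fun _ h => h)).trans ih₂

/-- Started in the memory `σ`, the program `c` halts after some number `t` of steps in some memory
`τ` such that `Q t τ`. -/
def Runs (c : Cmd) (σ : Store) (Q : ℕ → Store → Prop) : Prop :=
  ∃ t τ, Exec c σ t τ ∧ Q t τ

/-- Started in the memory `σ`, the program `c` halts after at most `T` steps in some memory `τ` such
that `Q τ`. -/
def RunsIn (c : Cmd) (σ : Store) (T : ℕ) (Q : Store → Prop) : Prop :=
  Runs c σ fun t τ => t ≤ T ∧ Q τ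

theorem Runs.mono {c : Cmd} {σ : Store} {Q Q' : ℕ → Store → Prop} (h : Runs c σ Q)
    (hQ : ∀ t τ, Frame c σ τ → Q t τ → Q' t τ) : Runs c σ Q' :=
  let ⟨t, τ, he, hq⟩ := h
  ⟨t, τ, he, hQ t τ he.frame hq⟩

theorem Runs.seq {c d : Cmd} {σ : Store} {Q₁ Q : ℕ → Store → Prop} (h : Runs c σ Q₁)
    (hd : ∀ t τ, Frame c σ τ → Q₁ t τ → Runs d τ fun t' ρ => Q (t + t') ρ) :
    Runs (c ;; d) σ Q := by
  obtain ⟨t, τ, he, hq⟩ := h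
  obtain ⟨t', ρ, he', hq'⟩ := hd t τ he.frame hq
  exact ⟨t + t', ρ, .seq _ _ _ _ _ _ _ he he', hq'⟩

theorem RunsIn.mono {c : Cmd} {σ : Store} {T T' : ℕ} {Q Q' : Store → Prop} (h : RunsIn c σ T Q)
    (hT : T ≤ T') (hQ : ∀ τ, Frame c σ τ → Q τ → Q' τ) : RunsIn c σ T' Q' :=
  Runs.mono h fun _ τ hF hq => ⟨hq.1.trans hT, hQ τ hF hq.2⟩

theorem RunsIn.seq {c d : Cmd} {σ : Store} {T₁ T₂ : ℕ} {Q₁ Q : Store → Prop}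
    (h : RunsIn c σ T₁ Q₁) (hd : ∀ τ, Frame c σ τ → Q₁ τ → RunsIn d τ T₂ Q) :
    RunsIn (c ;; d) σ (T₁ + T₂) Q :=
  Runs.seq h fun _ τ hF hq => Runs.mono (hd τ hF hq.2) fun _ _ _ hq' =>
    ⟨Nat.add_le_add hq.1 hq'.1, hq'.2⟩

/-- A bound for the running time of a loop-free program. -/
def Cmd.maxCost : Cmd → ℕ
  | .skip => 1
  | .iset _ e => e.cost + 1
  | .rset _ e => e.cost + 1
  | .iput _ i e => i.cost + e.cost + 1
  | .rput _ i e => i.cost + e.cost + 1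
  | .seq c d => c.maxCost + d.maxCost
  | .ite b c d => b.cost + (c.maxCost + d.maxCost) + 1
  | .while _ _ => 0

/-- The weakest precondition of `Q` for a loop-free program. -/
@[simp] def Cmd.wp : Cmd → (Store → Prop) → Store → Prop
  | .skip, Q, σ => Q σ
  | .iset x e, Q, σ => Q (σ.setIvar x (e.eval σ))
  | .rset x e, Q, σ => Q (σ.setRvar x (e.eval σ))
  | .iput A i e, Q, σ => Q (σ.setIarr A (i.eval σ) (e.eval σ))
  | .rput A i e, Q, σ => Q (σ.setRarr A (i.eval σ) (e.eval σ))
  | .seq c d, Q, σ => c.wp (d.wp Q) σ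
  | .ite b c d, Q, σ => (b.holds σ → c.wp Q σ) ∧ (¬ b.holds σ → d.wp Q σ)
  | .while _ _, _, _ => False

theorem RunsIn.of_wp : ∀ (c : Cmd) (Q : Store → Prop) (σ : Store), c.wp Q σ →
    RunsIn c σ c.maxCost Q
  | .skip, _, σ, h => ⟨_, _, .skip σ, le_rfl, h⟩
  | .iset x e, _, σ, h => ⟨_, _, .iset x e σ, le_rfl, h⟩
  | .rset x e, _, σ, h => ⟨_, _, .rset x e σ, le_rfl, h⟩
  | .iput A i e, _, σ, h => ⟨_, _, .iput A i e σ, le_rfl, h⟩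
  | .rput A i e, _, σ, h => ⟨_, _, .rput A i e σ, le_rfl, h⟩
  | .seq c d, Q, σ, h => (RunsIn.of_wp c _ σ h).seq fun τ _ hτ => RunsIn.of_wp d Q τ hτ
  | .ite b c d, Q, σ, h => by
    by_cases hb : b.holds σ
    · obtain ⟨t, τ, he, ht, hQ⟩ := RunsIn.of_wp c Q σ (h.1 hb)
      refine ⟨_, τ, .ite_true _ _ _ _ _ _ hb he, ?_, hQ⟩
      rw [Cmd.maxCost]; omega
    · obtain ⟨t, τ, he, ht, hQ⟩ := RunsIn.of_wp d Q σ (h.2 hb)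
      refine ⟨_, τ, .ite_false _ _ _ _ _ _ hb he, ?_, hQ⟩
      rw [Cmd.maxCost]; omega

theorem RunsIn.straight {c : Cmd} {σ : Store} {T : ℕ} {Q : Store → Prop}
    (hT : c.maxCost ≤ T) (hQ : c.wp Q σ) : RunsIn c σ T Q :=
  (RunsIn.of_wp c Q σ hQ).mono hT fun _ _ h => h

/-- `for x = 0, …, b - 1 do c`, where `b` is a variable. -/
def forLoop (x b : ℕ) (c : Cmd) : Cmd :=
  .iset x (.const 0) ;; .while (.ilt (.var x) (.var b)) (c ;; .iset x (.add (.var x) (.const 1)))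

/-- The rule for counting loops, with an invariant that may mention the time spent so far. An
iteration costs eight steps in addition to those of the body. -/
theorem Runs.forLoop {x b m : ℕ} {c : Cmd} {σ : Store} (hm : σ.ivar b = m)
    (hxb : x ≠ b) (hx : c.setsI x = false) (hb : c.setsI b = false)
    (I : ℕ → ℕ → Store → Prop) (h0 : I 0 0 (σ.setIvar x 0))
    (hstep : ∀ i t τ, i < m → τ.ivar x = i → Frame (forLoop x b c) σ τ → I i t τ →
      Runs c τ fun t' τ' => I (i + 1) (t + t' + 8) (τ'.setIvar x (i + 1))) :
    Runs (forLoop x b c) σ fun t τ => ∃ t', t = t' + 6 ∧ I m t' τ := by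
  have key : ∀ k i t τ, k + i = m → τ.ivar x = i → Frame (RealRAM.forLoop x b c) σ τ → I i t τ →
      Runs (.while (.ilt (.var x) (.var b)) (c ;; .iset x (.add (.var x) (.const 1)))) τ
        fun t' τ' => ∃ u, t + t' = u + 4 ∧ I m u τ' := by
    intro k
    induction k with
    | zero =>
      intro i t τ hk hi hF hI
      refine ⟨_, τ, .while_false _ _ _ ?_, t, ?_, ?_⟩
      · have := hF.ivar b (by simp [RealRAM.forLoop, Cmd.setsI, hb, hxb])
        simp only [BExp.holds, IExp.eval]; omega
      · simp [BExp.cost, IExp.cost]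
      · obtain rfl : i = m := by omega
        exact hI
    | succ k ih =>
      intro i t τ hk hi hF hI
      obtain ⟨t₁, τ₁, he₁, h₁⟩ := hstep i t τ (by omega) hi hF hI
      have hx₁ : τ₁.ivar x = i := (he₁.frame.ivar x hx).trans hi
      have he₂ := Exec.iset x (.add (.var x) (.const 1)) τ₁
      have hev : (IExp.add (.var x) (.const 1)).eval τ₁ = i + 1 := by simp [hx₁]
      rw [hev] at he₂
      have hF' : Frame (RealRAM.forLoop x b c) σ (τ₁.setIvar x (i + 1)) := by
        refine hF.trans ?_
        have := (Exec.seq _ _ _ _ _ _ _ he₁ he₂).frame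
        apply this.mono <;> intro y hy <;>
          simp [RealRAM.forLoop, Cmd.setsI, Cmd.setsR, Cmd.putsI, Cmd.putsR] at hy ⊢ <;> tauto
      obtain ⟨t₂, τ₂, he₃, u, hu, hI₂⟩ :=
        ih (i + 1) _ _ (by omega) (by simp) hF' h₁
      refine ⟨_, τ₂, .while_true _ _ _ _ _ _ _ ?_ (.seq _ _ _ _ _ _ _ he₁ he₂) he₃, u, ?_, hI₂⟩
      · have := hF.ivar b (by simp [RealRAM.forLoop, Cmd.setsI, hb, hxb])
        simp only [BExp.holds, IExp.eval]; omega
      · simp only [BExp.cost, IExp.cost]; omega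
  have he := Exec.iset x (.const 0) σ
  have hF : Frame (RealRAM.forLoop x b c) σ (σ.setIvar x 0) := he.frame.seq_left
  obtain ⟨t, τ, he', u, hu, hI⟩ := key m 0 0 (σ.setIvar x 0) (by omega) (by simp) hF h0
  refine ⟨_, τ, .seq _ _ _ _ _ _ _ he he', u, ?_, hI⟩
  simp only [IExp.cost]; omega

/-- The rule for counting loops whose iterations all obey the same time bound. -/
theorem RunsIn.forLoop {x b m : ℕ} {c : Cmd} {σ : Store} (hm : σ.ivar b = m)
    (hxb : x ≠ b) (hx : c.setsI x = false) (hb : c.setsI b = false) (T : ℕ)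
    (I : ℕ → Store → Prop) (h0 : I 0 (σ.setIvar x 0))
    (hstep : ∀ i τ, i < m → τ.ivar x = i → Frame (forLoop x b c) σ τ → I i τ →
      RunsIn c τ T fun τ' => I (i + 1) (τ'.setIvar x (i + 1))) :
    RunsIn (forLoop x b c) σ (m * (T + 8) + 6) (I m) := by
  refine (Runs.forLoop hm hxb hx hb (fun i t τ => t ≤ i * (T + 8) ∧ I i τ) ⟨by simp, h0⟩ ?_).mono ?_
  · rintro i t τ hi hxi hF ⟨ht, hI⟩
    refine Runs.mono (hstep i τ hi hxi hF hI) ?_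
    rintro t' τ' - ⟨ht', hI'⟩
    exact ⟨by rw [Nat.succ_mul]; omega, hI'⟩
  · rintro t τ - ⟨t', rfl, ht', hI⟩
    exact ⟨by omega, hI⟩

end RealRAM

/-! ### Matrices and the distances to and from the updated vertex -/

namespace BCData

open RealRAM

/-- The variables and the array that stay fixed while the program runs: the size `n`, the vertex `v`
of the update, and the array `6` that holds the offset `a * n` of row `a` of a matrix. As indices
cannot be multiplied, these offsets are computed by repeated addition and looked up later. -/
structure Env (n v : ℕ) (σ : Store) : Prop where
  size : σ.ivar 0 = n
  vertex : σ.ivar 1 = v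
  rows : ∀ a < n, σ.iarr 6 a = a * n

theorem Env.of_frame {n v : ℕ} {c : Cmd} {σ τ : Store} (h : Env n v σ) (hF : Frame c σ τ)
    (h0 : c.setsI 0 = false) (h1 : c.setsI 1 = false) (h6 : c.putsI 6 = false) : Env n v τ :=
  ⟨(hF.ivar 0 h0).trans h.size, (hF.ivar 1 h1).trans h.vertex, by rw [hF.iarr 6 h6]; exact h.rows⟩

/-- `M` is the matrix `f`, in row-major order. -/
def IsMat {n : ℕ} (M : ℕ → ℝ) (f : Fin n → Fin n → ℝ) : Prop :=
  ∀ a b : Fin n, M ((a : ℕ) * n + (b : ℕ)) = f a b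

/-- The entry of the matrix `A` whose row and column are the values of the variables `x`, `y`. -/
def cell (A x y : ℕ) : RExp := .get A (.add (.get 6 (.var x)) (.var y))

@[simp] theorem eval_cell (A x y : ℕ) (σ : Store) :
    (cell A x y).eval σ = σ.rarr A (σ.iarr 6 (σ.ivar x) + σ.ivar y) := rfl

/-- Computes the offsets of the rows. -/
def rowOffsets : Cmd :=
  .iset 2 (.const 0) ;;
    forLoop 3 0 (.iput 6 (.var 3) (.var 2) ;; .iset 2 (.add (.var 2) (.var 0)))

theorem runsIn_rowOffsets {n : ℕ} {σ : Store} (hn : σ.ivar 0 = n) :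
    RunsIn rowOffsets σ (n * 20 + 10) fun τ => ∀ a < n, τ.iarr 6 a = a * n := by
  refine RunsIn.mono (RunsIn.seq (T₁ := 2) (T₂ := n * (8 + 8) + 6) (RunsIn.straight (by decide)
    (Q := fun τ => τ.ivar 2 = 0) (by simp)) fun τ hF h2 => RunsIn.forLoop
      (m := n) ((hF.ivar 0 rfl).trans hn) (by decide) rfl rfl 8
      (fun i τ => τ.ivar 2 = i * n ∧ ∀ a < i, τ.iarr 6 a = a * n) ?_ ?_) ?_ ?_
  · simp [h2]
  · rintro i τ' hi h3 hF' ⟨hI2, hI⟩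
    refine RunsIn.straight (by decide) ⟨?_, fun a ha => ?_⟩
    · simp [hI2, hF'.ivar 0 rfl, hF.ivar 0 rfl, hn, Nat.succ_mul]
    · simp only [IExp.eval, Store.setIvar, Store.setIarr, Function.update_apply, if_true,
        h3, hI2]
      split_ifs with hai
      · rw [hai]
      · exact hI a (by omega)
  · omega
  · exact fun _ _ h => h.2

/-- Fills the matrix `A`: the entry in row `3`, column `4` is the real variable `0` after `c`. -/
def fillMat (A : ℕ) (c : Cmd) : Cmd :=
  forLoop 3 0 (forLoop 4 0 (c ;; .rput A (.add (.get 6 (.var 3)) (.var 4)) (.var 0)))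

theorem runsIn_fillMat {A n v : ℕ} {c : Cmd} {σ : Store} (hE : Env n v σ) (hn : 0 < n)
    (h0 : c.setsI 0 = false) (h3 : c.setsI 3 = false)
    (h4 : c.setsI 4 = false) (h6 : c.putsI 6 = false) (hA : c.putsR A = false)
    (f : Fin n → Fin n → ℝ) (K : ℕ) (hK : c.maxCost + 34 ≤ K)
    (hf : ∀ (s t : Fin n) (τ : Store), Frame (fillMat A c) σ τ → τ.ivar 3 = s → τ.ivar 4 = t →
      c.wp (fun τ' => τ'.rvar 0 = f s t) τ) :
    RunsIn (fillMat A c) σ (K * n ^ 2) fun τ => IsMat (τ.rarr A) f := by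
  set g : ℕ → ℝ := fun k =>
    if h : k / n < n then f ⟨k / n, h⟩ ⟨k % n, Nat.mod_lt _ hn⟩ else 0 with hg
  have hgf : ∀ s t : Fin n, g (s * n + t) = f s t := by
    intro s t
    have h1 : ((s : ℕ) * n + t) / n = s := by
      rw [mul_comm, Nat.mul_add_div hn, Nat.div_eq_of_lt t.2, add_zero]
    have h2 : ((s : ℕ) * n + t) % n = t := by
      rw [mul_comm, Nat.mul_add_mod, Nat.mod_eq_of_lt t.2]
    simp only [hg, h1, h2, s.2, dif_pos]
  refine RunsIn.mono (RunsIn.forLoop hE.size (by decide) (by simp [forLoop, Cmd.setsI, h3])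
    (by simp [forLoop, Cmd.setsI, h0]) (n * ((c.maxCost + 6) + 8) + 6)
    (fun i τ => ∀ k < i * n, τ.rarr A k = g k) (by simp) ?_) ?_
    fun τ _ h a b => (h _ (by nlinarith [a.2, b.2])).trans (hgf a b)
  · intro i τ hi hτ3 hF hI
    refine RunsIn.mono (RunsIn.forLoop (m := n) ?_ (by decide) (by simp [Cmd.setsI, h4])
      (by simp [Cmd.setsI, h0]) (c.maxCost + 6)
      (fun j τ => ∀ k < i * n + j, τ.rarr A k = g k) ?_ ?_) le_rfl ?_
    · rw [hF.ivar 0 (by simp [forLoop, Cmd.setsI, h0])]; exact hE.size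
    · simpa using hI
    · intro j τ' hj hτ4 hF' hJ
      have hF3 := hF.trans (hF'.mono (d := fillMat A c) ?_ ?_ ?_ ?_)
      · have e3 : τ'.ivar 3 = i := (hF'.ivar 3 (by simp [forLoop, Cmd.setsI, h3])).trans hτ3
        refine RunsIn.seq (RunsIn.of_wp c _ τ' (hf ⟨i, hi⟩ ⟨j, hj⟩ τ' hF3 e3 hτ4)) fun ρ hFρ hv =>
          RunsIn.straight (T := 6) (by simp [Cmd.maxCost, IExp.cost, RExp.cost]) ?_
        have hrow := hF3.iarr 6 (by simp [forLoop, Cmd.putsI, h6])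
        intro k hk
        simp only [IExp.eval, RExp.eval, Store.setIvar, Store.setRarr, Function.update_apply,
          if_true, hFρ.ivar 3 h3, hFρ.ivar 4 h4, hFρ.iarr 6 h6, hFρ.rarr A hA, hrow, e3, hτ4,
          hE.rows i hi, hv]
        split_ifs with hki
        · rw [hki]; exact (hgf ⟨i, hi⟩ ⟨j, hj⟩).symm
        · exact hJ k (by omega)
      all_goals
        intro x hx
        simp [fillMat, forLoop, Cmd.setsI, Cmd.setsR, Cmd.putsI, Cmd.putsR] at hx ⊢
        tauto
    · intro τ' _ h k hk
      exact h k (by rw [Nat.succ_mul] at hk; exact hk)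
  · have : c.maxCost + 34 ≤ K := hK
    have h2 : n ≤ n ^ 2 := by nlinarith
    have h3 : 1 ≤ n ^ 2 := by nlinarith
    calc n * (n * (c.maxCost + 6 + 8) + 6 + 8) + 6
        = (c.maxCost + 14) * n ^ 2 + 14 * n + 6 := by ring
      _ ≤ (c.maxCost + 34) * n ^ 2 := by nlinarith
      _ ≤ K * n ^ 2 := Nat.mul_le_mul_right _ hK

/-- Copies the matrix `A` to `B`. -/
def copyMat (A B : ℕ) : Cmd := fillMat B (.rset 0 (cell A 3 4))

/-- Writes the transpose of the matrix `A` to `B`. -/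
def transposeMat (A B : ℕ) : Cmd := fillMat B (.rset 0 (cell A 4 3))

theorem runsIn_copyMat {A B n v : ℕ} {σ : Store} (hE : Env n v σ) (hn : 0 < n) (hAB : B ≠ A)
    {f : Fin n → Fin n → ℝ} (hf : IsMat (σ.rarr A) f) :
    RunsIn (copyMat A B) σ (50 * n ^ 2) fun τ => IsMat (τ.rarr B) f := by
  refine runsIn_fillMat hE hn rfl rfl rfl rfl rfl f 50
    (by simp [Cmd.maxCost, RExp.cost, IExp.cost, cell]) fun s t τ hF h3 h4 => ?_
  simp [h3, h4, hF.iarr 6 rfl, hF.rarr A (by simp [fillMat, forLoop, Cmd.putsR, hAB]),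
    hE.rows s s.2, hf s t]

theorem runsIn_transposeMat {A B n v : ℕ} {σ : Store} (hE : Env n v σ) (hn : 0 < n) (hAB : B ≠ A)
    {f : Fin n → Fin n → ℝ} (hf : IsMat (σ.rarr A) f) :
    RunsIn (transposeMat A B) σ (50 * n ^ 2) fun τ => IsMat (τ.rarr B) fun s t => f t s := by
  refine runsIn_fillMat hE hn rfl rfl rfl rfl rfl _ 50
    (by simp [Cmd.maxCost, RExp.cost, IExp.cost, cell]) fun s t τ hF h3 h4 => ?_
  simp [h3, h4, hF.iarr 6 rfl, hF.rarr A (by simp [fillMat, forLoop, Cmd.putsR, hAB]),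
    hE.rows t t.2, hf t s]

/-- Copies the first `n` entries of the real array `A` to `B`. -/
def copyVec (A B : ℕ) : Cmd := forLoop 3 0 (.rput B (.var 3) (.get A (.var 3)))

theorem runsIn_copyVec {A B n v : ℕ} {σ : Store} (hE : Env n v σ) (hn : 0 < n) (hAB : B ≠ A) :
    RunsIn (copyVec A B) σ (50 * n ^ 2) fun τ => ∀ i < n, τ.rarr B i = σ.rarr A i := by
  refine RunsIn.mono (RunsIn.forLoop hE.size (by decide) rfl rfl 10
    (fun i τ => ∀ k < i, τ.rarr B k = σ.rarr A k) (by simp) ?_) (by nlinarith) fun _ _ h => h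
  intro i τ hi h3 hF hI
  refine RunsIn.straight (by simp [Cmd.maxCost, RExp.cost, IExp.cost]) fun k hk => ?_
  have := hF.rarr A (by simp [forLoop, Cmd.putsR, hAB])
  simp only [IExp.eval, RExp.eval, Store.setIvar, Store.setRarr, Function.update_apply,
    if_true, h3, this]
  split_ifs with hki
  · rw [hki]
  · exact hI k (by omega)

section Codes

variable {V : Type*} {G : WDigraph V} {a b s t : V}

theorem weightCode_of_adj (h : G.Adj a b) : weightCode G a b = G.weight a b := if_pos h

theorem distCode_of_reachable (h : G.Reachable s t) : distCode G s t = G.dist s t := if_pos h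

theorem distCode_of_not_reachable (h : ¬ G.Reachable s t) : distCode G s t = -1 := if_neg h

theorem weightCode_nonneg_iff : 0 ≤ weightCode G a b ↔ G.Adj a b := by
  unfold weightCode
  split_ifs with h
  · simp [h, (G.weight_pos a b h).le]
  · simp [h]

theorem distCode_nonneg_iff [Finite V] : 0 ≤ distCode G s t ↔ G.Reachable s t := by
  unfold distCode
  split_ifs with h
  · simp [h, h.dist_nonneg]
  · simp [h]

theorem weightCode_eq_old {H : WDigraph V} {v : V} (h : G.IncUpdate H v)
    (ha : a ≠ v) (hb : b ≠ v) :
    weightCode H a b = weightCode G a b := by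
  unfold weightCode
  by_cases hab : G.Adj a b
  · rw [if_pos hab, if_pos ((h.adj_eq a b ha hb).2 hab), h.weight_eq a b ha hb hab]
  · rw [if_neg hab, if_neg fun h' => hab ((h.adj_eq a b ha hb).1 h')]

theorem distCode_reverse (G : WDigraph V) (s t : V) :
    distCode G.reverse s t = distCode G t s := by
  unfold distCode
  rw [WDigraph.dist_reverse, WDigraph.reachable_reverse]

end Codes

open scoped Classical in
/-- `r` is the minimum of `cand` over the valid numbers below `i`, or `-1` if there are none, and
`k` is the sum of `cnt` over the valid numbers that attain the minimum. -/
structure MinCount (valid : ℕ → Prop) (cand cnt : ℕ → ℝ) (i : ℕ) (r k : ℝ) : Prop where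
  le : ∀ u < i, valid u → 0 ≤ r ∧ r ≤ cand u
  attained : r = -1 ∨ ∃ u < i, valid u ∧ cand u = r
  count : k = ∑ u ∈ Finset.range i, if valid u ∧ cand u = r then cnt u else 0

namespace MinCount

variable {valid : ℕ → Prop} {cand cnt : ℕ → ℝ} {i : ℕ} {r k : ℝ}

theorem zero : MinCount valid cand cnt 0 (-1) 0 := ⟨by simp, .inl rfl, by simp⟩

theorem of_not_valid (h : MinCount valid cand cnt i r k) (hi : ¬ valid i) :
    MinCount valid cand cnt (i + 1) r k where
  le u hu hv := by
    rcases Nat.lt_succ_iff_lt_or_eq.1 hu with h' | rfl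
    · exact h.le u h' hv
    · exact absurd hv hi
  attained := h.attained.imp_right fun ⟨u, hu, hv⟩ => ⟨u, hu.trans (Nat.lt_succ_self i), hv⟩
  count := by rw [Finset.sum_range_succ, ← h.count]; simp [hi]

theorem of_lt (h : MinCount valid cand cnt i r k) (hi : valid i) (h0 : 0 ≤ cand i)
    (hr : r < 0 ∨ cand i < r) : MinCount valid cand cnt (i + 1) (cand i) (cnt i) where
  le u hu hv := by
    rcases Nat.lt_succ_iff_lt_or_eq.1 hu with h' | rfl
    · have := h.le u h' hv
      exact ⟨h0, by rcases hr with hr | hr <;> linarith⟩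
    · exact ⟨h0, le_rfl⟩
  attained := .inr ⟨i, Nat.lt_succ_self i, hi, rfl⟩
  count := by
    rw [Finset.sum_range_succ, Finset.sum_eq_zero]
    · simp [hi]
    · intro u hu
      refine if_neg fun ⟨hv, he⟩ => ?_
      have := h.le u (Finset.mem_range.1 hu) hv
      rcases hr with hr | hr <;> linarith

theorem of_eq (h : MinCount valid cand cnt i r k) (hi : valid i) (h0 : 0 ≤ cand i)
    (hr : cand i = r) : MinCount valid cand cnt (i + 1) r (k + cnt i) where
  le u hu hv := by
    rcases Nat.lt_succ_iff_lt_or_eq.1 hu with h' | rfl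
    · exact h.le u h' hv
    · exact ⟨hr ▸ h0, hr.ge⟩
  attained := .inr ⟨i, Nat.lt_succ_self i, hi, hr⟩
  count := by rw [Finset.sum_range_succ, ← h.count]; simp [hi, hr]

theorem of_gt (h : MinCount valid cand cnt i r k) (h0 : 0 ≤ r) (hr : r < cand i) :
    MinCount valid cand cnt (i + 1) r k where
  le u hu hv := by
    rcases Nat.lt_succ_iff_lt_or_eq.1 hu with h' | rfl
    · exact h.le u h' hv
    · exact ⟨h0, hr.le⟩
  attained := h.attained.imp_right fun ⟨u, hu, hv⟩ => ⟨u, hu.trans (Nat.lt_succ_self i), hv⟩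
  count := by rw [Finset.sum_range_succ, ← h.count]; simp [hr.ne']

end MinCount

/-- Takes the edge from `u` (variable `4`) to `v` into account as the last edge of a path from `s`
(variable `3`): the real variables `1`, `2` are the least distance found so far and the number of
paths that attain it. Arrays `10`, `11`, `12`: weights, distances, numbers of shortest paths. -/
def relax : Cmd :=
  .ite (.and (.not (.rlt (cell 10 4 1) (.const 0))) (.not (.rlt (cell 11 3 4) (.const 0))))
    (.rset 3 (.add (cell 11 3 4) (cell 10 4 1)) ;;
      .ite (.and (.not (.rlt (.var 1) (.const 0))) (.not (.rlt (.var 3) (.var 1))))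
        (.ite (.req (.var 3) (.var 1)) (.rset 2 (.add (.var 2) (cell 12 3 4))) .skip)
        (.rset 1 (.var 3) ;; .rset 2 (cell 12 3 4)))
    .skip

/-- Computes the distances and the numbers of shortest paths to `v` after the update, from the new
weights (array `10`), the old distances (`11`) and the old numbers of shortest paths (`12`); the
results are the arrays `13` and `14`. -/
def distTo : Cmd :=
  forLoop 3 0 (
    (.rset 1 (.sub (.const 0) (.const 1)) ;; .rset 2 (.const 0)) ;;
    forLoop 4 0 relax ;;
    .ite (.ieq (.var 3) (.var 1)) (.rset 1 (.const 0) ;; .rset 2 (.const 1)) .skip ;;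
    .rput 13 (.var 3) (.var 1) ;; .rput 14 (.var 3) (.var 2))

theorem runsIn_relaxLoop {n : ℕ} {v s : Fin n} {σ : Store} (hE : Env n v σ)
    (w d c : Fin n → Fin n → ℝ)
    (hw : IsMat (σ.rarr 10) w) (hd : IsMat (σ.rarr 11) d) (hc : IsMat (σ.rarr 12) c)
    (h3 : σ.ivar 3 = s) (h1 : σ.rvar 1 = -1) (h2 : σ.rvar 2 = 0)
    (valid : ℕ → Prop) (cand cnt : ℕ → ℝ)
    (hvalid : ∀ u : Fin n, valid u ↔ 0 ≤ w u v ∧ 0 ≤ d s u)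
    (hcand : ∀ u : Fin n, cand u = d s u + w u v) (hcnt : ∀ u : Fin n, cnt u = c s u) :
    RunsIn (forLoop 4 0 relax) σ (n * 80 + 6) fun τ =>
      MinCount valid cand cnt n (τ.rvar 1) (τ.rvar 2) := by
  refine RunsIn.forLoop hE.size (by decide) rfl rfl 72
    (fun i τ => MinCount valid cand cnt i (τ.rvar 1) (τ.rvar 2)) ?_ ?_
  · simpa [h1, h2] using MinCount.zero
  intro i τ hi h4 hF hI
  refine RunsIn.straight (by decide) ?_
  have e3 : τ.ivar 3 = s := (hF.ivar 3 rfl).trans h3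
  have ev : τ.ivar 1 = v := (hF.ivar 1 rfl).trans hE.vertex
  have r1 := hE.rows s s.2
  have r2 := hE.rows i hi
  have m1 := hw ⟨i, hi⟩ v
  have m2 := hd s ⟨i, hi⟩
  have m3 := hc s ⟨i, hi⟩
  have hva := hvalid ⟨i, hi⟩
  have hca := hcand ⟨i, hi⟩
  have hcn := hcnt ⟨i, hi⟩
  simp only at m1 m2 m3 hva hca hcn
  have h0 : valid i → 0 ≤ cand i := fun hv => by
    rw [hca]; exact add_nonneg (hva.1 hv).2 (hva.1 hv).1
  simp only [relax, Cmd.wp, BExp.holds, RExp.eval, eval_cell, Store.setRvar, Store.setIvar, h4, e3,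
    ev, hF.iarr 6 rfl, hF.rarr 10 rfl, hF.rarr 11 rfl, hF.rarr 12 rfl, r1, r2, m1, m2, m3,
    Nat.cast_zero, not_lt, ← hva, ← hca, ← hcn]
  refine ⟨fun hv => ⟨fun ha => ⟨fun hb => ?_, fun hb => ?_⟩, fun ha => ?_⟩, hI.of_not_valid⟩
  · simpa using hI.of_eq hv (h0 hv) hb
  · simp at ha hb
    simpa using hI.of_gt ha.1 (lt_of_le_of_ne ha.2 (Ne.symm hb))
  · simp only [not_and_or, not_le] at ha
    simpa using hI.of_lt hv (h0 hv) ha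

theorem distCode_of_minCount {n : ℕ} {G H : WDigraph (Fin n)} {s v : Fin n} (h : G.IncUpdate H v)
    (hs : s ≠ v) {valid : ℕ → Prop} {cand cnt : ℕ → ℝ} {r k : ℝ}
    (hvalid : ∀ u : Fin n, valid u ↔ 0 ≤ weightCode H u v ∧ 0 ≤ distCode G s u)
    (hcand : ∀ u : Fin n, cand u = distCode G s u + weightCode H u v)
    (hcnt : ∀ u : Fin n, cnt u = G.numShortest s u)
    (hM : MinCount valid cand cnt n r k) :
    r = distCode H s v ∧ k = H.numShortest s v := by
  classical
  have hv : ∀ u : Fin n, valid u ↔ G.Extends H s u v := fun u => by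
    rw [hvalid, weightCode_nonneg_iff, distCode_nonneg_iff, and_comm]; rfl
  have hc : ∀ u : Fin n, valid u → cand u = G.dist s u + H.weight u v := fun u hu => by
    rw [hcand, distCode_of_reachable ((hv u).1 hu).1, weightCode_of_adj ((hv u).1 hu).2]
  have hk := hM.count
  rw [Finset.sum_range] at hk
  by_cases hr : H.Reachable s v
  · have hrd : r = H.dist s v := by
      obtain ⟨u, hu, huw⟩ := h.exists_extends hs hr
      have hle := hM.le u u.2 ((hv u).2 hu)
      rw [hc u ((hv u).2 hu), huw] at hle
      refine le_antisymm hle.2 ?_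
      rcases hM.attained with h1 | ⟨u', hu', hv', hcu⟩
      · linarith
      · rw [← hcu, hc ⟨u', hu'⟩ hv']
        exact (h.dist_le_of_extends ((hv ⟨u', hu'⟩).1 hv')).2
    refine ⟨by rw [hrd, distCode_of_reachable hr], ?_⟩
    rw [h.numShortest_eq_sum hs, hk, Nat.cast_sum, Finset.sum_filter]
    refine Finset.sum_congr rfl fun u _ => ?_
    rw [hcnt]
    refine if_congr ?_ rfl rfl
    rw [hrd, ← hv]
    exact and_congr_right fun hu => by rw [hc u hu]
  · have hnv : ∀ u : Fin n, ¬ valid u := fun u hu =>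
      hr (h.dist_le_of_extends ((hv u).1 hu)).1
    rw [distCode_of_not_reachable hr, WDigraph.numShortest_eq_zero hr, hk]
    refine ⟨?_, by simp [hnv]⟩
    rcases hM.attained with h1 | ⟨u', hu', hv', -⟩
    · exact h1
    · exact absurd hv' (hnv ⟨u', hu'⟩)

theorem runsIn_distTo {n : ℕ} {G H : WDigraph (Fin n)} {v : Fin n} {σ : Store}
    (hGH : G.IncUpdate H v) (hE : Env n v σ)
    (hw : IsMat (σ.rarr 10) (weightCode H)) (hd : IsMat (σ.rarr 11) (distCode G))
    (hc : IsMat (σ.rarr 12) fun s t => (G.numShortest s t : ℝ)) :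
    RunsIn distTo σ (250 * n ^ 2) fun τ => ∀ s : Fin n,
      τ.rarr 13 s = distCode H s v ∧ τ.rarr 14 s = H.numShortest s v := by
  have hn : 0 < n := v.pos
  refine RunsIn.mono (RunsIn.forLoop hE.size (by decide) rfl rfl (10 + (n * 80 + 6 + 30))
    (fun i τ => ∀ s : Fin n, (s : ℕ) < i →
      τ.rarr 13 s = distCode H s v ∧ τ.rarr 14 s = H.numShortest s v) (by simp) ?_)
    (by nlinarith) fun τ _ h s => h s s.2
  intro i τ hi h3 hF hI
  refine RunsIn.mono (RunsIn.seq (T₁ := 6) (Q₁ := fun τ' => τ'.rvar 1 = -1 ∧ τ'.rvar 2 = 0)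
    (RunsIn.straight (by decide) (by simp)) fun τ₂ hF₂ hr₂ => ?_) (T := 6 + (n * 80 + 6 + 34))
    (by omega) fun _ _ h => h
  have hE₂ : Env n v τ₂ := (hE.of_frame hF rfl rfl rfl).of_frame hF₂ rfl rfl rfl
  have e3 : τ₂.ivar 3 = i := by rw [hF₂.ivar 3 rfl, h3]
  have hloop := runsIn_relaxLoop (v := v) (s := ⟨i, hi⟩) hE₂ (weightCode H) (distCode G)
    (fun s t => (G.numShortest s t : ℝ))
    (by rw [hF₂.rarr 10 rfl, hF.rarr 10 rfl]; exact hw)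
    (by rw [hF₂.rarr 11 rfl, hF.rarr 11 rfl]; exact hd)
    (by rw [hF₂.rarr 12 rfl, hF.rarr 12 rfl]; exact hc)
    e3 hr₂.1 hr₂.2
    (fun u => ∃ h : u < n, 0 ≤ weightCode H ⟨u, h⟩ v ∧ 0 ≤ distCode G ⟨i, hi⟩ ⟨u, h⟩)
    (fun u => if h : u < n then distCode G ⟨i, hi⟩ ⟨u, h⟩ + weightCode H ⟨u, h⟩ v else 0)
    (fun u => if h : u < n then G.numShortest ⟨i, hi⟩ ⟨u, h⟩ else 0)
    (by simp) (by simp) (by simp)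
  refine RunsIn.mono (RunsIn.seq hloop fun τ₃ hF₃ hM => ?_) (T := n * 80 + 6 + 34)
    (by omega) fun _ _ h => h
  refine RunsIn.straight (by decide) ?_
  have e3' : τ₃.ivar 3 = i := by rw [hF₃.ivar 3 rfl, e3]
  have ev : τ₃.ivar 1 = v := by rw [hF₃.ivar 1 rfl, hE₂.vertex]
  have e13 : τ₃.rarr 13 = τ.rarr 13 := by rw [hF₃.rarr 13 rfl, hF₂.rarr 13 rfl]
  have e14 : τ₃.rarr 14 = τ.rarr 14 := by rw [hF₃.rarr 14 rfl, hF₂.rarr 14 rfl]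
  simp only [Cmd.wp, BExp.holds, IExp.eval, RExp.eval, Store.setRvar, Store.setIvar,
    Store.setRarr, e3', ev]
  have hother : ∀ s : Fin n, (s : ℕ) < i + 1 → (s : ℕ) ≠ i →
      τ₃.rarr 13 s = distCode H s v ∧ τ₃.rarr 14 s = H.numShortest s v := fun s hs hsi => by
    rw [e13, e14]; exact hI s (by omega)
  refine ⟨fun hiv s hs => ?_, fun hiv s hs => ?_⟩
  · by_cases hsi : (s : ℕ) = i
    · obtain rfl : s = v := Fin.ext (hsi.trans hiv)
      simp [hsi, distCode_of_reachable (H.reachable_refl _), H.dist_self, H.numShortest_self]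
    · simpa [hsi] using hother s hs hsi
  · by_cases hsi : (s : ℕ) = i
    · have := distCode_of_minCount hGH (s := s) (fun h => hiv (by rw [← hsi, h]))
        (by simp [← hsi]) (by simp [← hsi]) (by simp [← hsi]) hM
      simp [hsi, ← this.1, ← this.2]
    · simpa [hsi] using hother s hs hsi

end BCData

/-! ### The new weights, distances and path counts -/

namespace BCData

open RealRAM

theorem IsMat.of_frame {n A : ℕ} {f : Fin n → Fin n → ℝ} {c : Cmd} {σ τ : Store}
    (h : IsMat (σ.rarr A) f) (hF : Frame c σ τ) (hA : c.putsR A = false) : IsMat (τ.rarr A) f := by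
  rw [hF.rarr A hA]; exact h

section Codes

variable {V : Type*} [Finite V] {G H : WDigraph V} {s t v a b : V}

theorem between_iff_distCode : G.Between s v t ↔
    0 ≤ distCode G s v ∧ 0 ≤ distCode G v t ∧ distCode G s v + distCode G v t = distCode G s t := by
  rw [distCode_nonneg_iff, distCode_nonneg_iff]
  refine and_congr_right fun h1 => and_congr_right fun h2 => ?_
  rw [distCode_of_reachable h1, distCode_of_reachable h2, distCode_of_reachable (h1.trans h2)]

theorem tight_iff_distCode : G.Tight s a b ↔
    0 ≤ distCode G s a ∧ 0 ≤ weightCode G a b ∧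
      distCode G s b = distCode G s a + weightCode G a b := by
  rw [distCode_nonneg_iff, weightCode_nonneg_iff]
  refine and_congr_right fun h1 => and_congr_right fun h2 => ?_
  rw [distCode_of_reachable h1, weightCode_of_adj h2,
    distCode_of_reachable (h1.trans (WDigraph.reachable_of_adj h2))]

theorem reachable_and_dist_eq_iff (h : G.IncUpdate H v) :
    G.Reachable s t ∧ G.dist s t = H.dist s t ↔
      0 ≤ distCode G s t ∧ distCode G s t = distCode H s t := by
  rw [distCode_nonneg_iff]
  refine and_congr_right fun h1 => ?_
  rw [distCode_of_reachable h1, distCode_of_reachable (h.reachable h1)]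

/-- The shorter way through `v`. -/
theorem distCode_eq_add (h : G.IncUpdate H v) (hsv : 0 ≤ distCode H s v) (hvt : 0 ≤ distCode H v t)
    (hd : 0 ≤ distCode G s t → distCode H s v + distCode H v t < distCode G s t) :
    distCode H s t = distCode H s v + distCode H v t := by
  rw [distCode_nonneg_iff] at hsv hvt
  have hst := hsv.trans hvt
  rw [distCode_nonneg_iff] at hd
  rw [distCode_of_reachable hsv, distCode_of_reachable hvt] at hd ⊢
  rw [distCode_of_reachable hst]
  rcases h.between_or hst with hb | ⟨hr, he⟩
  · exact hb.2.2.symm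
  · have := hd hr
    rw [distCode_of_reachable hr] at this
    linarith [hsv.dist_triangle hvt]

theorem distCode_eq_old (h : G.IncUpdate H v)
    (hd : 0 ≤ distCode H s v → 0 ≤ distCode H v t →
      0 ≤ distCode G s t ∧ distCode G s t ≤ distCode H s v + distCode H v t) :
    distCode H s t = distCode G s t := by
  simp only [distCode_nonneg_iff] at hd
  by_cases hr : H.Reachable s t
  · rcases h.between_or hr with hb | ⟨hr', he⟩
    · obtain ⟨h1, h2⟩ := hd hb.1 hb.2.1
      rw [distCode_of_reachable h1, distCode_of_reachable hb.1, distCode_of_reachable hb.2.1] at h2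
      rw [distCode_of_reachable h1, distCode_of_reachable hr]
      exact le_antisymm (h.dist_le h1) (by linarith [hb.2.2])
    · rw [distCode_of_reachable hr, distCode_of_reachable hr', he]
  · rw [distCode_of_not_reachable hr, distCode_of_not_reachable fun h' => hr (h.reachable h')]

end Codes

/-- Writes the new weights to the matrix `15`. -/
def newWeights : Cmd :=
  fillMat 15 (.ite (.ieq (.var 4) (.var 1)) (.rset 0 (.get 4 (.var 3)))
    (.ite (.ieq (.var 3) (.var 1)) (.rset 0 (.get 5 (.var 4))) (.rset 0 (cell 0 3 4))))

theorem runsIn_newWeights {n : ℕ} {G H : WDigraph (Fin n)} {v : Fin n} {σ : Store}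
    (hGH : G.IncUpdate H v) (hE : Env n v σ) (hw : IsMat (σ.rarr 0) (weightCode G))
    (hin : ∀ u : Fin n, σ.rarr 4 u = weightCode H u v)
    (hout : ∀ u : Fin n, σ.rarr 5 u = weightCode H v u) :
    RunsIn newWeights σ (60 * n ^ 2) fun τ => IsMat (τ.rarr 15) (weightCode H) := by
  refine runsIn_fillMat hE v.pos rfl rfl rfl rfl rfl _ 60 (by decide) fun s t τ hF h3 h4 => ?_
  have e1 := (hF.ivar 1 rfl).trans hE.vertex
  simp only [Cmd.wp, BExp.holds, IExp.eval, RExp.eval, eval_cell, h3, h4, e1, hF.rarr 4 rfl,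
    hF.rarr 5 rfl, hF.rarr 0 rfl, hF.iarr 6 rfl, hE.rows s s.2, hw s t, hin, hout, Store.setRvar,
    Function.update_self]
  refine ⟨fun h => ?_, fun h => ⟨fun h' => ?_, fun h' => ?_⟩⟩
  · rw [Fin.ext h]
  · rw [Fin.ext h']
  · exact (weightCode_eq_old hGH (fun e => h' (by rw [e])) fun e => h (by rw [e])).symm

/-- The test whether a real number is nonnegative. -/
def nonneg (e : RExp) : BExp := .not (.rlt e (.const 0))

@[simp] theorem holds_nonneg (e : RExp) (σ : Store) : (nonneg e).holds σ ↔ 0 ≤ e.eval σ := by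
  simp [nonneg]

/-- Writes the new distances to the matrix `20`. The arrays `16` and `18` hold the new distances to
and from `v`, and the matrix `1` the old distances. -/
def newDists : Cmd :=
  fillMat 20 (.rset 1 (.get 16 (.var 3)) ;; .rset 2 (.get 18 (.var 4)) ;; .rset 0 (cell 1 3 4) ;;
    .ite (.and (.and (nonneg (.var 1)) (nonneg (.var 2)))
        (.not (.and (nonneg (.var 0)) (.not (.rlt (.add (.var 1) (.var 2)) (.var 0))))))
      (.rset 0 (.add (.var 1) (.var 2))) .skip)

theorem runsIn_newDists {n : ℕ} {G H : WDigraph (Fin n)} {v : Fin n} {σ : Store}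
    (hGH : G.IncUpdate H v) (hE : Env n v σ) (hd : IsMat (σ.rarr 1) (distCode G))
    (hto : ∀ s : Fin n, σ.rarr 16 s = distCode H s v)
    (hfrom : ∀ t : Fin n, σ.rarr 18 t = distCode H v t) :
    RunsIn newDists σ (90 * n ^ 2) fun τ => IsMat (τ.rarr 20) (distCode H) := by
  refine runsIn_fillMat hE v.pos rfl rfl rfl rfl rfl _ 90 (by decide) fun s t τ hF h3 h4 => ?_
  simp only [Cmd.wp, BExp.holds, IExp.eval, RExp.eval, eval_cell, h3, h4, hF.rarr 16 rfl,
    hF.rarr 18 rfl, hF.rarr 1 rfl, hF.iarr 6 rfl, hE.rows s s.2, hd s t, hto, hfrom, Store.setRvar,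
    Function.update_apply, holds_nonneg, not_lt]
  norm_num
  refine ⟨fun h1 h2 h => (distCode_eq_add hGH h1 h2 h).symm,
    fun h => (distCode_eq_old hGH fun h1 h2 => h h1 h2).symm⟩

/-- Writes the new numbers of shortest paths to the matrix `21`. The matrices `1`, `2`, `20` hold
the old distances, the old numbers of shortest paths and the new distances; the arrays `16`, `17`
(`18`, `19`) hold the new distances and numbers of shortest paths to (from) `v`. -/
def newCounts : Cmd :=
  fillMat 21 (.rset 0 (.const 0) ;;
    .ite (.and (nonneg (cell 1 3 4)) (.req (cell 1 3 4) (cell 20 3 4)))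
      (.rset 0 (cell 2 3 4) ;;
        .ite (.and (nonneg (cell 1 3 1)) (.and (nonneg (cell 1 1 4))
            (.req (.add (cell 1 3 1) (cell 1 1 4)) (cell 1 3 4))))
          (.rset 0 (.sub (.var 0) (.mul (cell 2 3 1) (cell 2 1 4)))) .skip)
      .skip ;;
    .ite (.and (nonneg (.get 16 (.var 3))) (.and (nonneg (.get 18 (.var 4)))
        (.req (.add (.get 16 (.var 3)) (.get 18 (.var 4))) (cell 20 3 4))))
      (.rset 0 (.add (.var 0) (.mul (.get 17 (.var 3)) (.get 19 (.var 4))))) .skip)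

theorem runsIn_newCounts {n : ℕ} {G H : WDigraph (Fin n)} {v : Fin n} {σ : Store}
    (hGH : G.IncUpdate H v) (hE : Env n v σ) (hd : IsMat (σ.rarr 1) (distCode G))
    (hc : IsMat (σ.rarr 2) fun s t => (G.numShortest s t : ℝ))
    (hd' : IsMat (σ.rarr 20) (distCode H))
    (hto : ∀ s : Fin n, σ.rarr 16 s = distCode H s v)
    (hfrom : ∀ t : Fin n, σ.rarr 18 t = distCode H v t)
    (hcto : ∀ s : Fin n, σ.rarr 17 s = H.numShortest s v)
    (hcfrom : ∀ t : Fin n, σ.rarr 19 t = H.numShortest v t) :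
    RunsIn newCounts σ (200 * n ^ 2) fun τ =>
      IsMat (τ.rarr 21) fun s t => (H.numShortest s t : ℝ) := by
  refine runsIn_fillMat hE v.pos rfl rfl rfl rfl rfl _ 200 (by decide) fun s t τ hF h3 h4 => ?_
  have e1 := (hF.ivar 1 rfl).trans hE.vertex
  simp only [Cmd.wp, BExp.holds, IExp.eval, RExp.eval, eval_cell, h3, h4, e1, hF.rarr 16 rfl,
    hF.rarr 17 rfl, hF.rarr 18 rfl, hF.rarr 19 rfl, hF.rarr 20 rfl, hF.rarr 1 rfl, hF.rarr 2 rfl,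
    hF.iarr 6 rfl, hE.rows s s.2, hE.rows v v.2, hd s t, hd s v, hd v t, hc s t, hc s v, hc v t,
    hd' s t, hto, hfrom, hcto, hcfrom, Store.setRvar, Function.update_apply, holds_nonneg,
    ← between_iff_distCode, ← reachable_and_dist_eq_iff hGH, if_true, Nat.cast_zero]
  rw [hGH.numShortest_eq s t]
  refine ⟨fun h1 => ⟨fun h2 => ⟨fun h3 => ?_, fun h3 => ?_⟩,
    fun h2 => ⟨fun h3 => ?_, fun h3 => ?_⟩⟩,
    fun h1 => ⟨fun h3 => ?_, fun h3 => ?_⟩⟩ <;> simp [*]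

/-- Copies the new weights, the old distances and the old numbers of shortest paths to the matrices
`10`, `11`, `12`, computes distances and numbers of shortest paths to `v`, and stores them as the
arrays `16` and `17`. -/
def distToVertex : Cmd :=
  copyMat 15 10 ;; copyMat 1 11 ;; copyMat 2 12 ;; distTo ;; copyVec 13 16 ;; copyVec 14 17

/-- The same for the distances and numbers of shortest paths from `v`, which are those to `v` in the
reversed graph. -/
def distFromVertex : Cmd :=
  transposeMat 15 10 ;; transposeMat 1 11 ;; transposeMat 2 12 ;; distTo ;; copyVec 13 18 ;;
    copyVec 14 19

theorem runsIn_distToVertex {n : ℕ} {G H : WDigraph (Fin n)} {v : Fin n} {σ : Store}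
    (hGH : G.IncUpdate H v) (hE : Env n v σ)
    (hw : IsMat (σ.rarr 15) (weightCode H)) (hd : IsMat (σ.rarr 1) (distCode G))
    (hc : IsMat (σ.rarr 2) fun s t => (G.numShortest s t : ℝ)) :
    RunsIn distToVertex σ (500 * n ^ 2) fun τ => ∀ s : Fin n,
      τ.rarr 16 s = distCode H s v ∧ τ.rarr 17 s = H.numShortest s v := by
  have hn := v.pos
  refine RunsIn.mono (T := 50 * n ^ 2 + (50 * n ^ 2 + (50 * n ^ 2 + (250 * n ^ 2 +
    (50 * n ^ 2 + 50 * n ^ 2))))) ?_ (by omega) fun _ _ h => h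
  refine (runsIn_copyMat hE hn (by decide) hw).seq fun τ₁ hF₁ h₁ => ?_
  have hE₁ := hE.of_frame hF₁ rfl rfl rfl
  refine (runsIn_copyMat hE₁ hn (by decide) (hd.of_frame hF₁ rfl)).seq fun τ₂ hF₂ h₂ => ?_
  have hE₂ := hE₁.of_frame hF₂ rfl rfl rfl
  refine (runsIn_copyMat hE₂ hn (by decide)
    ((hc.of_frame hF₁ rfl).of_frame hF₂ rfl)).seq fun τ₃ hF₃ h₃ => ?_
  have hE₃ := hE₂.of_frame hF₃ rfl rfl rfl
  refine (runsIn_distTo hGH hE₃ ((h₁.of_frame hF₂ rfl).of_frame hF₃ rfl) (h₂.of_frame hF₃ rfl)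
    h₃).seq fun τ₄ hF₄ h₄ => ?_
  have hE₄ := hE₃.of_frame hF₄ rfl rfl rfl
  refine (runsIn_copyVec (A := 13) (B := 16) hE₄ hn (by decide)).seq fun τ₅ hF₅ h₅ => ?_
  have hE₅ := hE₄.of_frame hF₅ rfl rfl rfl
  refine (runsIn_copyVec (A := 14) (B := 17) hE₅ hn (by decide)).mono le_rfl
    fun τ₆ hF₆ h₆ s => ⟨?_, ?_⟩
  · rw [hF₆.rarr 16 rfl, h₅ s s.2, (h₄ s).1]
  · rw [h₆ s s.2, hF₅.rarr 14 rfl, (h₄ s).2]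

theorem runsIn_distFromVertex {n : ℕ} {G H : WDigraph (Fin n)} {v : Fin n} {σ : Store}
    (hGH : G.IncUpdate H v) (hE : Env n v σ)
    (hw : IsMat (σ.rarr 15) (weightCode H)) (hd : IsMat (σ.rarr 1) (distCode G))
    (hc : IsMat (σ.rarr 2) fun s t => (G.numShortest s t : ℝ)) :
    RunsIn distFromVertex σ (500 * n ^ 2) fun τ => ∀ t : Fin n,
      τ.rarr 18 t = distCode H v t ∧ τ.rarr 19 t = H.numShortest v t := by
  have hn := v.pos
  refine RunsIn.mono (T := 50 * n ^ 2 + (50 * n ^ 2 + (50 * n ^ 2 + (250 * n ^ 2 +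
    (50 * n ^ 2 + 50 * n ^ 2))))) ?_ (by omega) fun _ _ h => h
  refine (runsIn_transposeMat hE hn (by decide) hw).seq fun τ₁ hF₁ h₁ => ?_
  have hE₁ := hE.of_frame hF₁ rfl rfl rfl
  refine (runsIn_transposeMat hE₁ hn (by decide) (hd.of_frame hF₁ rfl)).seq fun τ₂ hF₂ h₂ => ?_
  have hE₂ := hE₁.of_frame hF₂ rfl rfl rfl
  refine (runsIn_transposeMat hE₂ hn (by decide)
    ((hc.of_frame hF₁ rfl).of_frame hF₂ rfl)).seq fun τ₃ hF₃ h₃ => ?_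
  have hE₃ := hE₂.of_frame hF₃ rfl rfl rfl
  refine (runsIn_distTo hGH.reverse hE₃ ((h₁.of_frame hF₂ rfl).of_frame hF₃ rfl)
    (fun s t => (h₂.of_frame hF₃ rfl s t).trans (distCode_reverse G s t).symm)
    (fun s t => (h₃ s t).trans (by simp only [WDigraph.numShortest_reverse]))).seq
    fun τ₄ hF₄ h₄ => ?_
  have hE₄ := hE₃.of_frame hF₄ rfl rfl rfl
  refine (runsIn_copyVec (A := 13) (B := 18) hE₄ hn (by decide)).seq fun τ₅ hF₅ h₅ => ?_
  have hE₅ := hE₄.of_frame hF₅ rfl rfl rfl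
  refine (runsIn_copyVec (A := 14) (B := 19) hE₅ hn (by decide)).mono le_rfl
    fun τ₆ hF₆ h₆ s => ⟨?_, ?_⟩
  · rw [hF₆.rarr 18 rfl, h₅ s s.2, (h₄ s).1, distCode_reverse]
  · rw [h₆ s s.2, hF₅.rarr 14 rfl, (h₄ s).2, WDigraph.numShortest_reverse]

/-- Updates the weights, the distances and the numbers of shortest paths. -/
def updateMatrices : Cmd :=
  newWeights ;; distToVertex ;; distFromVertex ;; newDists ;; newCounts ;;
    copyMat 15 0 ;; copyMat 20 1 ;; copyMat 21 2

theorem runsIn_updateMatrices {n : ℕ} {G H : WDigraph (Fin n)} {v : Fin n} {σ : Store}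
    (hGH : G.IncUpdate H v) (hE : Env n v σ) (hG : Holds G σ) (hH : HoldsUpdate H v σ) :
    RunsIn updateMatrices σ (1500 * n ^ 2) fun τ =>
      IsMat (τ.rarr 0) (weightCode H) ∧ IsMat (τ.rarr 1) (distCode H) ∧
        IsMat (τ.rarr 2) fun s t => (H.numShortest s t : ℝ) := by
  have hn := v.pos
  refine RunsIn.mono (T := 60 * n ^ 2 + (500 * n ^ 2 + (500 * n ^ 2 + (90 * n ^ 2 +
    (200 * n ^ 2 + (50 * n ^ 2 + (50 * n ^ 2 + 50 * n ^ 2))))))) ?_ (by omega) fun _ _ h => h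
  have hd : IsMat (σ.rarr 1) (distCode G) := hG.dists
  have hc : IsMat (σ.rarr 2) fun s t => (G.numShortest s t : ℝ) := hG.counts
  refine (runsIn_newWeights hGH hE hG.weights hH.incoming hH.outgoing).seq fun τ₁ hF₁ hw => ?_
  replace hE := hE.of_frame hF₁ rfl rfl rfl
  replace hd := hd.of_frame hF₁ rfl
  replace hc := hc.of_frame hF₁ rfl
  refine (runsIn_distToVertex hGH hE hw hd hc).seq fun τ₂ hF₂ h₂ => ?_
  replace hE := hE.of_frame hF₂ rfl rfl rfl
  replace hd := hd.of_frame hF₂ rfl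
  replace hc := hc.of_frame hF₂ rfl
  replace hw := hw.of_frame hF₂ rfl
  refine (runsIn_distFromVertex hGH hE hw hd hc).seq fun τ₃ hF₃ h₃ => ?_
  replace hE := hE.of_frame hF₃ rfl rfl rfl
  replace hd := hd.of_frame hF₃ rfl
  replace hc := hc.of_frame hF₃ rfl
  replace hw := hw.of_frame hF₃ rfl
  rw [← hF₃.rarr 16 rfl, ← hF₃.rarr 17 rfl] at h₂
  refine (runsIn_newDists hGH hE hd (fun s => (h₂ s).1) fun t => (h₃ t).1).seq
    fun τ₄ hF₄ hd' => ?_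
  replace hE := hE.of_frame hF₄ rfl rfl rfl
  replace hd := hd.of_frame hF₄ rfl
  replace hc := hc.of_frame hF₄ rfl
  replace hw := hw.of_frame hF₄ rfl
  rw [← hF₄.rarr 16 rfl, ← hF₄.rarr 17 rfl] at h₂
  rw [← hF₄.rarr 18 rfl, ← hF₄.rarr 19 rfl] at h₃
  refine (runsIn_newCounts hGH hE hd hc hd' (fun s => (h₂ s).1) (fun t => (h₃ t).1)
    (fun s => (h₂ s).2) fun t => (h₃ t).2).seq fun τ₅ hF₅ hc' => ?_
  replace hE := hE.of_frame hF₅ rfl rfl rfl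
  replace hd' := hd'.of_frame hF₅ rfl
  replace hw := hw.of_frame hF₅ rfl
  refine (runsIn_copyMat hE hn (by decide) hw).seq fun τ₆ hF₆ hw => ?_
  replace hE := hE.of_frame hF₆ rfl rfl rfl
  replace hd' := hd'.of_frame hF₆ rfl
  replace hc' := hc'.of_frame hF₆ rfl
  refine (runsIn_copyMat hE hn (by decide) hd').seq fun τ₇ hF₇ hd' => ?_
  replace hE := hE.of_frame hF₇ rfl rfl rfl
  replace hc' := hc'.of_frame hF₇ rfl
  replace hw := hw.of_frame hF₇ rfl
  exact (runsIn_copyMat hE hn (by decide) hc').mono le_rfl fun τ₈ hF₈ hc' =>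
    ⟨hw.of_frame hF₈ rfl, hd'.of_frame hF₈ rfl, hc'⟩

end BCData

/-! ### Edge lists -/

namespace RealRAM

/-- The rule for counting loops whose iterations need not obey the same time bound: `Φ i` bounds the
time spent on the first `i` iterations. -/
theorem RunsIn.forLoop_of_potential {x b m : ℕ} {c : Cmd} {σ : Store} (hm : σ.ivar b = m)
    (hxb : x ≠ b) (hx : c.setsI x = false) (hb : c.setsI b = false) (Φ : ℕ → ℕ)
    (I : ℕ → Store → Prop) (h0 : I 0 (σ.setIvar x 0))
    (hstep : ∀ i τ, i < m → τ.ivar x = i → Frame (RealRAM.forLoop x b c) σ τ → I i τ →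
      ∃ T, Φ i + T + 8 ≤ Φ (i + 1) ∧
        RunsIn c τ T fun τ' => I (i + 1) (τ'.setIvar x (i + 1))) :
    RunsIn (RealRAM.forLoop x b c) σ (Φ m + 6) (I m) := by
  refine (Runs.forLoop hm hxb hx hb (fun i t τ => t ≤ Φ i ∧ I i τ) ⟨by simp, h0⟩ ?_).mono ?_
  · rintro i t τ hi hxi hF ⟨ht, hI⟩
    obtain ⟨T, hT, hrun⟩ := hstep i τ hi hxi hF hI
    refine Runs.mono hrun ?_
    rintro t' τ' - ⟨ht', hI'⟩
    exact ⟨by omega, hI'⟩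
  · rintro t τ - ⟨t', rfl, ht', hI⟩
    exact ⟨by omega, hI⟩

end RealRAM

namespace BCData

open RealRAM

/-- The arrays `src` and `dst` hold the list `L` of edges from position `p` on. -/
def Seg {n : ℕ} (src dst : ℕ → ℕ) (p : ℕ) (L : List (Fin n × Fin n)) : Prop :=
  ∀ (i : ℕ) (hi : i < L.length), src (p + i) = ((L[i]'hi).1 : ℕ) ∧ dst (p + i) = ((L[i]'hi).2 : ℕ)

theorem Seg.congr {n p : ℕ} {src dst src' dst' : ℕ → ℕ} {L : List (Fin n × Fin n)}
    (h : Seg src dst p L) (h' : ∀ j < p + L.length, src' j = src j ∧ dst' j = dst j) :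
    Seg src' dst' p L := fun i hi => by
  rw [(h' (p + i) (by omega)).1, (h' (p + i) (by omega)).2]
  exact h i hi

theorem Seg.concat {n p : ℕ} {src dst : ℕ → ℕ} {L : List (Fin n × Fin n)} (h : Seg src dst p L)
    (e : Fin n × Fin n) :
    Seg (Function.update src (p + L.length) e.1) (Function.update dst (p + L.length) e.2) p
      (L ++ [e]) := by
  intro i hi
  rw [List.length_append, List.length_singleton] at hi
  by_cases hiL : i < L.length
  · rw [List.getElem_append_left hiL, Function.update_of_ne (by omega),
      Function.update_of_ne (by omega)]
    exact h i hiL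
  · obtain rfl : i = L.length := by omega
    simp

/-- Position of the list of `i` if the lists `L 0`, `L 1`, … are stored one after the other. -/
def offset {n : ℕ} (L : Fin n → List (Fin n × Fin n)) (i : ℕ) : ℕ :=
  ∑ j ∈ Finset.range i, if h : j < n then (L ⟨j, h⟩).length else 0

theorem offset_zero {n : ℕ} (L : Fin n → List (Fin n × Fin n)) : offset L 0 = 0 := rfl

theorem offset_succ {n : ℕ} (L : Fin n → List (Fin n × Fin n)) (s : Fin n) :
    offset L (s + 1) = offset L s + (L s).length := by
  rw [offset, Finset.sum_range_succ, offset, dif_pos s.2]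

theorem offset_mono {n : ℕ} (L : Fin n → List (Fin n × Fin n)) : Monotone (offset L) :=
  monotone_nat_of_le_succ fun i => by rw [offset, offset, Finset.sum_range_succ]; omega

theorem offset_last {n : ℕ} (L : Fin n → List (Fin n × Fin n)) :
    offset L n = ∑ s, (L s).length := by
  rw [offset, Finset.sum_range]
  simp

/-- The arrays `off`, `src`, `dst` store the lists `L`. -/
structure HasLists {n : ℕ} (off src dst : ℕ → ℕ) (L : Fin n → List (Fin n × Fin n)) : Prop where
  off_eq : ∀ i ≤ n, off i = offset L i
  seg : ∀ s : Fin n, Seg src dst (offset L s) (L s)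

/-- The lists `L` enumerate the relations `R s`. -/
structure Lists {n : ℕ} (L : Fin n → List (Fin n × Fin n)) (R : Fin n → Fin n → Fin n → Prop) :
    Prop where
  nodup : ∀ s, (L s).Nodup
  mem_iff : ∀ s e, e ∈ L s ↔ R s e.1 e.2

theorem storesEdgeLists_iff {n : ℕ} {off src dst : ℕ → ℕ} {R : Fin n → Fin n → Fin n → Prop} :
    StoresEdgeLists off src dst R ↔ ∃ L, Lists L R ∧ HasLists off src dst L := by
  constructor
  · rintro ⟨h0, h⟩
    choose L hn hm hl hs using h
    have hoff : ∀ i ≤ n, off i = offset L i := by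
      intro i
      induction i with
      | zero => exact fun _ => h0
      | succ i ih =>
        intro hi
        rw [offset_succ L ⟨i, hi⟩, ← ih (by omega)]
        exact hl ⟨i, hi⟩
    exact ⟨L, ⟨hn, hm⟩, hoff, fun s => by rw [← hoff s s.2.le]; exact hs s⟩
  · rintro ⟨L, ⟨hn, hm⟩, hoff, hs⟩
    refine ⟨hoff 0 (Nat.zero_le n), fun s => ⟨L s, hn s, hm s, ?_, ?_⟩⟩
    · rw [hoff _ s.2, hoff _ s.2.le, offset_succ]
    · rw [hoff _ s.2.le]; exact hs s

theorem HasLists.congr {n : ℕ} {off src dst off' src' dst' : ℕ → ℕ}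
    {L : Fin n → List (Fin n × Fin n)} (h : HasLists off src dst L)
    (h₁ : ∀ i < n + 1, off' i = off i)
    (h₂ : ∀ j < offset L n, src' j = src j) (h₃ : ∀ j < offset L n, dst' j = dst j) :
    HasLists off' src' dst' L where
  off_eq i hi := (h₁ i (by omega)).trans (h.off_eq i hi)
  seg s := (h.seg s).congr fun j hj => by
    have := offset_mono L (show (s : ℕ) + 1 ≤ n from s.2)
    rw [offset_succ] at this
    exact ⟨h₂ j (by omega), h₃ j (by omega)⟩

theorem Lists.length_eq {n : ℕ} {L : Fin n → List (Fin n × Fin n)}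
    {R : Fin n → Fin n → Fin n → Prop} (h : Lists L R) (s : Fin n) :
    (L s).length = {e : Fin n × Fin n | R s e.1 e.2}.ncard := by
  classical
  rw [← List.toFinset_card_of_nodup (h.nodup s), ← Set.ncard_coe_finset]
  congr 1
  ext e
  simp [h.mem_iff]

theorem Lists.offset_le {n : ℕ} {L : Fin n → List (Fin n × Fin n)} {G : WDigraph (Fin n)}
    (h : Lists L G.DagEdge) : offset L n ≤ ∑ x, G.mStar x := by
  rw [offset_last]
  exact Finset.sum_le_sum fun s _ => (h.length_eq s).trans_le (G.ncard_dagEdge_le s)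

theorem Lists.offset_le_of_reverse {n : ℕ} {L : Fin n → List (Fin n × Fin n)}
    {G : WDigraph (Fin n)} (h : Lists L G.reverse.DagEdge) : offset L n ≤ ∑ x, G.mStar x := by
  rw [offset_last]
  exact Finset.sum_le_sum fun s _ => (h.length_eq s).trans_le (G.ncard_dagEdge_reverse_le s)

/-- Copies as many entries of the integer array `A` to `B` as the variable `2` says. -/
def copyArr (A B : ℕ) : Cmd := forLoop 3 2 (.iput B (.var 3) (.get A (.var 3)))

theorem runsIn_copyArr {A B m : ℕ} {σ : Store} (hm : σ.ivar 2 = m) (hAB : B ≠ A) :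
    RunsIn (copyArr A B) σ (m * 18 + 6) fun τ => ∀ i < m, τ.iarr B i = σ.iarr A i := by
  refine RunsIn.forLoop hm (by decide) rfl rfl 10
    (fun i τ => ∀ k < i, τ.iarr B k = σ.iarr A k) (by simp) ?_
  intro i τ hi h3 hF hI
  refine RunsIn.straight (by simp [Cmd.maxCost, IExp.cost]) fun k hk => ?_
  have := hF.iarr A (by simp [forLoop, Cmd.putsI, hAB])
  simp only [IExp.eval, Store.setIvar, Store.setIarr, Function.update_apply, if_true, h3, this]
  split_ifs with hki
  · rw [hki]
  · exact hI k (by omega)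

/-- Copies the edge lists in the integer arrays `A`, `A + 1`, `A + 2` to `B`, `B + 1`, `B + 2`. -/
def copyLists (A B : ℕ) : Cmd :=
  .iset 2 (.add (.var 0) (.const 1)) ;; copyArr A B ;;
  .iset 2 (.get A (.var 0)) ;; copyArr (A + 1) (B + 1) ;; copyArr (A + 2) (B + 2)

theorem runsIn_copyLists {n A B : ℕ} {σ : Store} (hn : σ.ivar 0 = n)
    (hAB : A + 2 < B ∨ B + 2 < A) {L : Fin n → List (Fin n × Fin n)}
    (hL : HasLists (σ.iarr A) (σ.iarr (A + 1)) (σ.iarr (A + 2)) L) :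
    RunsIn (copyLists A B) σ (n * 18 + 36 * offset L n + 60) fun τ =>
      HasLists (τ.iarr B) (τ.iarr (B + 1)) (τ.iarr (B + 2)) L := by
  refine RunsIn.mono (T := 4 + (((n + 1) * 18 + 6) + (3 + ((offset L n * 18 + 6) +
    (offset L n * 18 + 6))))) ?_ (by omega) fun _ _ h => h
  refine (RunsIn.straight (Q := fun τ => τ.ivar 2 = n + 1) (by decide) (by simp [hn])).seq
    fun τ₁ hF₁ h₁ => ?_
  refine (runsIn_copyArr h₁ (by omega)).seq fun τ₂ hF₂ h₂ => ?_
  have hA : ∀ k < 3, τ₂.iarr (A + k) = σ.iarr (A + k) := fun k hk => by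
    rw [hF₂.iarr (A + k) (by simp [copyArr, forLoop, Cmd.putsI]; omega),
      hF₁.iarr (A + k) (by simp [Cmd.putsI])]
  refine (RunsIn.straight (Q := fun τ => τ.ivar 2 = offset L n)
    (by simp [Cmd.maxCost, IExp.cost]) ?_).seq fun τ₃ hF₃ h₃ => ?_
  · have := hA 0 (by omega)
    simp only [add_zero] at this
    simp [this, hF₂.ivar 0 rfl, hF₁.ivar 0 rfl, hn, hL.off_eq n le_rfl]
  refine (runsIn_copyArr h₃ (by omega)).seq fun τ₄ hF₄ h₄ => ?_
  refine (runsIn_copyArr ((hF₄.ivar 2 rfl).trans h₃) (by omega)).mono le_rfl fun τ₅ hF₅ h₅ => ?_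
  refine hL.congr (fun i hi => ?_) (fun j hj => ?_) fun j hj => ?_
  · rw [hF₅.iarr B (by simp [copyArr, forLoop, Cmd.putsI]),
      hF₄.iarr B (by simp [copyArr, forLoop, Cmd.putsI]), hF₃.iarr B rfl, h₂ i hi, hF₁.iarr A rfl]
  · rw [hF₅.iarr (B + 1) (by simp [copyArr, forLoop, Cmd.putsI]), h₄ j hj,
      hF₃.iarr (A + 1) rfl, hA 1 (by omega)]
  · rw [h₅ j hj, hF₄.iarr (A + 2) (by simp [copyArr, forLoop, Cmd.putsI]; omega),
      hF₃.iarr (A + 2) rfl, hA 2 (by omega)]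

/-- Appends the edge from `6` to `7` to the list in the arrays `S`, `D`, which ends at `k`. -/
def push (S D k : ℕ) : Cmd :=
  .iput S (.var k) (.var 6) ;; .iput D (.var k) (.var 7) ;; .iset k (.add (.var k) (.const 1))

/-- For all `x` less than the variable `b`, sets the variables `6`, `7` to the edge number `x` by
means of `fetch` and appends it to a list if it passes a test. -/
def filterLoop (x b : ℕ) (fetch : Cmd) (test : BExp) (S D k : ℕ) : Cmd :=
  forLoop x b (fetch ;; .ite test (push S D k) .skip)

open scoped Classical in
theorem runsIn_filterLoop {n x b S D k p : ℕ} {fetch : Cmd} {test : BExp} {σ : Store}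
    (M Out : List (Fin n × Fin n)) (P : Fin n × Fin n → Prop) (K : ℕ)
    (hb : σ.ivar b = M.length) (hxb : x ≠ b) (hkx : k ≠ x) (hkb : k ≠ b) (hSD : S ≠ D)
    (fx : fetch.setsI x = false) (fb : fetch.setsI b = false) (fk : fetch.setsI k = false)
    (fS : fetch.putsI S = false) (fD : fetch.putsI D = false)
    (hK : fetch.maxCost + test.cost + 24 ≤ K)
    (hk : σ.ivar k = p + Out.length) (hOut : Seg (σ.iarr S) (σ.iarr D) p Out)
    (hf : ∀ (i : ℕ) (hi : i < M.length) (τ : Store),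
      Frame (filterLoop x b fetch test S D k) σ τ → τ.ivar x = i →
      fetch.wp (fun τ' => τ'.ivar 6 = (M[i].1 : ℕ) ∧ τ'.ivar 7 = (M[i].2 : ℕ) ∧
        (test.holds τ' ↔ P M[i])) τ) :
    RunsIn (filterLoop x b fetch test S D k) σ (M.length * K + 6) fun τ =>
      Seg (τ.iarr S) (τ.iarr D) p (Out ++ M.filter P) ∧
      τ.ivar k = p + (Out ++ M.filter P).length ∧
      ∀ j < p, τ.iarr S j = σ.iarr S j ∧ τ.iarr D j = σ.iarr D j := by
  set I : ℕ → Store → Prop := fun i τ =>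
    Seg (τ.iarr S) (τ.iarr D) p (Out ++ (M.take i).filter P) ∧
      τ.ivar k = p + (Out ++ (M.take i).filter P).length ∧
      ∀ j < p, τ.iarr S j = σ.iarr S j ∧ τ.iarr D j = σ.iarr D j with hI
  have hcx : (fetch ;; .ite test (push S D k) .skip).setsI x = false := by
    simp [push, Cmd.setsI, fx, hkx]
  have hcb : (fetch ;; .ite test (push S D k) .skip).setsI b = false := by
    simp [push, Cmd.setsI, fb, hkb]
  refine RunsIn.mono (RunsIn.forLoop hb hxb hcx hcb
    (fetch.maxCost + (test.cost + 16)) I ?_ ?_) ?_ ?_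
  · simp [hI, hOut, hk, hkx]
  · rintro i τ hi hxi hF ⟨hseg, hlen, hlow⟩
    refine (RunsIn.of_wp fetch _ τ (hf i hi τ hF hxi)).seq fun ρ hFρ ⟨h6, h7, ht⟩ => ?_
    have htake : M.take (i + 1) = M.take i ++ [M[i]] := by simp
    refine RunsIn.straight (by simp only [Cmd.maxCost, push, IExp.cost]; omega) ?_
    have eS := hFρ.iarr S fS
    have eD := hFρ.iarr D fD
    have ek := (hFρ.ivar k fk).trans hlen
    refine ⟨fun hh => ?_, fun hh => ?_⟩
    · have hP := ht.1 hh
      have hcon := hseg.concat M[i]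
      simp only [hI, htake, List.filter_append, List.filter_singleton, hP, decide_true,
        push, Cmd.wp, IExp.eval, Store.setIvar, Store.setIarr, Function.update_self,
        Function.update_of_ne hSD.symm, Function.update_of_ne hSD, Function.update_of_ne hkx,
        eS, eD, ek, h6, h7, ← List.append_assoc, Bool.cond_true]
      refine ⟨hcon, ?_, fun j hj => ?_⟩
      · rw [List.length_append (bs := [M[i]])]; rfl
      · rw [Function.update_of_ne (by omega), Function.update_of_ne (by omega)]
        exact hlow j hj
    · have hP : ¬ P M[i] := fun hP => hh (ht.2 hP)
      simp only [hI, htake, List.filter_append, List.filter_singleton, hP, decide_false,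
        Cmd.wp, Store.setIvar, Function.update_of_ne hkx, eS, eD, ek, List.append_nil,
        Bool.cond_false]
      exact ⟨hseg, trivial, hlow⟩
  · have : M.length * (fetch.maxCost + (test.cost + 16) + 8) ≤ M.length * K :=
      Nat.mul_le_mul_left _ (by omega)
    omega
  · rintro τ - h
    simpa only [hI, List.take_length] using h

end BCData

/-! ### The new shortest path DAGs -/

namespace BCData

open RealRAM

/-- The test whether the edge from `a` to `b` is an edge of the shortest path DAG of `s`, where `s`,
`a`, `b` are variables and the matrices `10` and `11` hold weights and distances. -/
def tightTest (s a b : ℕ) : BExp :=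
  .and (nonneg (cell 11 s a)) (.and (nonneg (cell 10 a b))
    (.req (cell 11 s b) (.add (cell 11 s a) (cell 10 a b))))

theorem holds_tightTest {n w : ℕ} {H : WDigraph (Fin n)} {σ : Store} (hE : Env n w σ)
    (hw : IsMat (σ.rarr 10) (weightCode H)) (hd : IsMat (σ.rarr 11) (distCode H))
    {x y z : ℕ} {s a b : Fin n} (hx : σ.ivar x = s) (hy : σ.ivar y = a) (hz : σ.ivar z = b) :
    (tightTest x y z).holds σ ↔ H.Tight s a b := by
  simp only [tightTest, BExp.holds, holds_nonneg, RExp.eval, eval_cell, hx, hy, hz,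
    hE.rows s s.2, hE.rows a a.2, hd s a, hd s b, hw a b, tight_iff_distCode]

theorem holds_tightTest_set {n w : ℕ} {H : WDigraph (Fin n)} {σ : Store} (hE : Env n w σ)
    (hw : IsMat (σ.rarr 10) (weightCode H)) (hd : IsMat (σ.rarr 11) (distCode H))
    {x : ℕ} (h6 : x ≠ 6) (h7 : x ≠ 7) {s : Fin n} (hx : σ.ivar x = s) (a b : Fin n) :
    (tightTest x 6 7).holds ((σ.setIvar 6 a).setIvar 7 b) ↔ H.Tight s a b :=
  holds_tightTest (w := w) (σ := (σ.setIvar 6 a).setIvar 7 b)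
    ⟨by simpa using hE.size, by simpa using hE.vertex, hE.rows⟩ hw hd
    (by simpa [h6, h7] using hx) (by simp) (by simp)

theorem wp_fetch {e f : IExp} {test : BExp} {σ : Store} {a b : ℕ} {p : Prop} (ha : e.eval σ = a)
    (hb : f.eval (σ.setIvar 6 a) = b)
    (ht : test.holds ((σ.setIvar 6 a).setIvar 7 b) ↔ p) :
    (Cmd.iset 6 e ;; .iset 7 f).wp
      (fun τ => τ.ivar 6 = a ∧ τ.ivar 7 = b ∧ (test.holds τ ↔ p)) σ := by
  subst ha hb
  exact ⟨by simp, by simp, ht⟩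

/-- Writes the shortest path DAG of `v` to the arrays `16` and `17`, and its size to the
variable `8`. -/
def rootDag : Cmd :=
  .iset 8 (.const 0) ;;
  forLoop 3 0 (filterLoop 4 0 (.iset 6 (.var 3) ;; .iset 7 (.var 4)) (tightTest 1 6 7) 16 17 8)

open scoped Classical in
theorem runsIn_rootDag {n : ℕ} {H : WDigraph (Fin n)} {v : Fin n} {σ : Store} (hE : Env n v σ)
    (hw : IsMat (σ.rarr 10) (weightCode H)) (hd : IsMat (σ.rarr 11) (distCode H)) :
    RunsIn rootDag σ (150 * n ^ 2) fun τ => ∃ M : List (Fin n × Fin n), M.Nodup ∧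
      (∀ e, e ∈ M ↔ H.Tight v e.1 e.2) ∧ Seg (τ.iarr 16) (τ.iarr 17) 0 M ∧
      τ.ivar 8 = M.length := by
  have hn := v.pos
  set row : Fin n → List (Fin n × Fin n) := fun a => (List.finRange n).map fun b => (a, b)
  set P : Fin n × Fin n → Prop := fun e => H.Tight v e.1 e.2
  refine RunsIn.mono (RunsIn.seq (T₁ := 2) (T₂ := n * (n * 100 + 6 + 8) + 6)
    (Q₁ := fun τ => τ.ivar 8 = 0) (RunsIn.straight (by decide) (by simp)) fun τ₀ hF₀ h8 =>
    RunsIn.forLoop (m := n) ((hF₀.ivar 0 rfl).trans hE.size) (by decide) rfl rfl (n * 100 + 6)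
      (fun i τ => ∃ M : List (Fin n × Fin n), M.Nodup ∧
        (∀ e, e ∈ M ↔ (e.1 : ℕ) < i ∧ P e) ∧ Seg (τ.iarr 16) (τ.iarr 17) 0 M ∧
        τ.ivar 8 = M.length) ?_ ?_) (by nlinarith) ?_
  · exact ⟨[], List.nodup_nil, by simp, fun i hi => by simp at hi, by simp [h8]⟩
  · rintro i τ hi h3 hF ⟨M, hMn, hMm, hMs, hMl⟩
    have hE' : Env n v τ := (hE.of_frame hF₀ rfl rfl rfl).of_frame hF rfl rfl rfl
    have hw' := (hw.of_frame hF₀ rfl).of_frame hF rfl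
    have hd' := (hd.of_frame hF₀ rfl).of_frame hF rfl
    have hloop := runsIn_filterLoop (x := 4) (b := 0) (S := 16) (D := 17) (k := 8) (p := 0)
      (fetch := .iset 6 (.var 3) ;; .iset 7 (.var 4)) (test := tightTest 1 6 7) (σ := τ)
      (row ⟨i, hi⟩) M P 100 (by simp [row, hE'.size]) (by decide) (by decide) (by decide)
      (by decide) rfl rfl rfl rfl rfl (by decide) (by rw [hMl, zero_add]) hMs ?_
    · refine hloop.mono (by simp [row]) ?_
      rintro ρ - ⟨hs, hl, -⟩
      refine ⟨_, ?_, fun e => ?_, hs, by simpa using hl⟩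
      · refine List.Nodup.append hMn (List.Nodup.filter _ ?_) ?_
        · exact (List.nodup_finRange n).map fun b c h => (Prod.mk.inj h).2
        · intro e he he'
          have h1 := ((hMm e).1 he).1
          have h2 := (List.mem_filter.1 he').1
          simp only [row, List.mem_map] at h2
          obtain ⟨b, -, rfl⟩ := h2
          simp at h1
      · simp only [List.mem_append, hMm, List.mem_filter, row, List.mem_map, List.mem_finRange,
          true_and, decide_eq_true_eq, Nat.lt_succ_iff_lt_or_eq]
        constructor
        · rintro (h | ⟨⟨b, rfl⟩, h⟩)
          · exact ⟨.inl h.1, h.2⟩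
          · exact ⟨.inr rfl, h⟩
        · rintro ⟨h | h, hp⟩
          · exact .inl ⟨h, hp⟩
          · exact .inr ⟨⟨e.2, Prod.ext (Fin.ext h.symm) rfl⟩, hp⟩
    · intro j hj ρ hFρ h4
      have hjn : j < n := by simpa [row] using hj
      have hEρ := hE'.of_frame hFρ rfl rfl rfl
      have h3ρ := (hFρ.ivar 3 rfl).trans h3
      refine wp_fetch (by simp [row, h3ρ]) (by simp [row, h4]) ?_
      simpa [row] using holds_tightTest_set hEρ (hw'.of_frame hFρ rfl) (hd'.of_frame hFρ rfl)
        (x := 1) (by decide) (by decide) hEρ.vertex ⟨i, hi⟩ ⟨j, hjn⟩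
  · rintro τ - ⟨M, hMn, hMm, hMs, hMl⟩
    exact ⟨M, hMn, fun e => by rw [hMm]; simp [P], hMs, hMl⟩

open scoped Classical in
/-- The new shortest path DAG of `s`: the edges of that of `v`, then edges into `v`, then old
edges. -/
noncomputable def newDag {n : ℕ} (H : WDigraph (Fin n)) (v : Fin n) (M : List (Fin n × Fin n))
    (L : Fin n → List (Fin n × Fin n)) (s : Fin n) : List (Fin n × Fin n) :=
  M.filter (fun e => H.Tight s e.1 e.2) ++
    (((List.finRange n).map fun a => (a, v)).filter fun e => H.Tight s e.1 e.2) ++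
    (L s).filter fun e => e.2 ≠ v ∧ H.Tight s e.1 e.2 ∧ ¬ H.Tight v e.1 e.2

/-- By `WDigraph.IncUpdate.tight_or`, the three sources of candidates give all edges of the new
shortest path DAG, and the tests keep the three parts disjoint. -/
theorem lists_newDag {n : ℕ} {G H : WDigraph (Fin n)} {v : Fin n} (h : G.IncUpdate H v)
    {M : List (Fin n × Fin n)} (hMn : M.Nodup) (hM : ∀ e, e ∈ M ↔ H.Tight v e.1 e.2)
    {L : Fin n → List (Fin n × Fin n)} (hL : Lists L G.DagEdge) :
    Lists (newDag H v M L) H.DagEdge where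
  nodup s := by
    have hnv : ∀ e ∈ M, e.2 ≠ v := fun e he hev => by
      have := (hM e).1 he
      rw [hev] at this
      exact H.not_tight_self_right _ _ this
    refine List.Nodup.append (List.Nodup.append (hMn.filter _) (List.Nodup.filter _ ?_) ?_)
      ((hL.nodup s).filter _) ?_
    · exact (List.nodup_finRange n).map fun b c h => (Prod.mk.inj h).1
    · intro e he he'
      obtain ⟨a, -, rfl⟩ := List.mem_map.1 (List.mem_filter.1 he').1
      exact hnv _ (List.mem_filter.1 he).1 rfl
    · intro e he he'
      have h3 := (List.mem_filter.1 he').2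
      simp only [decide_eq_true_eq] at h3
      rcases List.mem_append.1 he with he | he
      · exact h3.2.2 ((hM e).1 (List.mem_filter.1 he).1)
      · obtain ⟨a, -, rfl⟩ := List.mem_map.1 (List.mem_filter.1 he).1
        exact h3.1 rfl
  mem_iff s e := by
    simp only [newDag, List.mem_append, List.mem_filter, hM, decide_eq_true_eq, List.mem_map,
      List.mem_finRange, true_and, hL.mem_iff, WDigraph.dagEdge_iff_tight]
    constructor
    · rintro ((h | h) | h)
      · exact h.2
      · exact h.2
      · exact h.2.2.1
    · intro ht
      by_cases hv : H.Tight v e.1 e.2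
      · exact .inl (.inl ⟨hv, ht⟩)
      by_cases he : e.2 = v
      · exact .inl (.inr ⟨⟨e.1, Prod.ext rfl he.symm⟩, ht⟩)
      rcases h.tight_or ht with h' | h' | h'
      · exact absurd h' hv
      · exact absurd h' he
      · exact .inr ⟨h', he, ht, hv⟩

/-- Appends the new shortest path DAG of the vertex `3` to the list in the arrays `14`, `15`. -/
def appendDag : Cmd :=
  filterLoop 4 8 (.iset 6 (.get 16 (.var 4)) ;; .iset 7 (.get 17 (.var 4))) (tightTest 3 6 7)
    14 15 5 ;;
  filterLoop 4 0 (.iset 6 (.var 4) ;; .iset 7 (.var 1)) (tightTest 3 6 7) 14 15 5 ;;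
  (.iset 9 (.get 10 (.var 3)) ;;
    .iset 10 (.sub (.get 10 (.add (.var 3) (.const 1))) (.var 9))) ;;
  filterLoop 4 10 (.iset 6 (.get 11 (.add (.var 9) (.var 4))) ;;
      .iset 7 (.get 12 (.add (.var 9) (.var 4))))
    (.and (.not (.ieq (.var 7) (.var 1))) (.and (tightTest 3 6 7) (.not (tightTest 1 6 7))))
    14 15 5

/-- Computes the new shortest path DAGs from the old ones, which are stored in the arrays `10`,
`11`, `12`, and writes them to the arrays `13`, `14`, `15`. -/
def dagUpdate : Cmd :=
  rootDag ;; (.iset 5 (.const 0) ;; .iput 13 (.const 0) (.const 0)) ;;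
  forLoop 3 0 (appendDag ;; .iput 13 (.add (.var 3) (.const 1)) (.var 5))

theorem runsIn_appendDag {n : ℕ} {H : WDigraph (Fin n)} {v s : Fin n} {σ : Store}
    (hE : Env n v σ) (hw : IsMat (σ.rarr 10) (weightCode H)) (hd : IsMat (σ.rarr 11) (distCode H))
    {M : List (Fin n × Fin n)} (hM : Seg (σ.iarr 16) (σ.iarr 17) 0 M) (h8 : σ.ivar 8 = M.length)
    {L : Fin n → List (Fin n × Fin n)}
    (hL : HasLists (σ.iarr 10) (σ.iarr 11) (σ.iarr 12) L) (h3 : σ.ivar 3 = s) :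
    RunsIn appendDag σ (M.length * 150 + n * 150 + (L s).length * 150 + 32) fun τ =>
      Seg (τ.iarr 14) (τ.iarr 15) (σ.ivar 5) (newDag H v M L s) ∧
      τ.ivar 5 = σ.ivar 5 + (newDag H v M L s).length ∧
      ∀ j < σ.ivar 5, τ.iarr 14 j = σ.iarr 14 j ∧ τ.iarr 15 j = σ.iarr 15 j := by
  classical
  refine RunsIn.mono (T := (M.length * 150 + 6) + ((n * 150 + 6) +
    (12 + ((L s).length * 150 + 6)))) ?_ (by omega) fun _ _ h => h
  refine (runsIn_filterLoop (x := 4) (b := 8) (S := 14) (D := 15) (k := 5) (p := σ.ivar 5)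
    (fetch := .iset 6 (.get 16 (.var 4)) ;; .iset 7 (.get 17 (.var 4))) (test := tightTest 3 6 7)
    M [] (fun e => H.Tight s e.1 e.2) 150 h8 (by decide) (by decide) (by decide) (by decide) rfl rfl
    rfl rfl rfl (by decide) rfl (fun i hi => by simp at hi) ?_).seq
    fun τ₁ hF₁ ⟨hs₁, hk₁, hl₁⟩ => ?_
  · intro i hi ρ hF h4
    obtain ⟨m1, m2⟩ := hM i hi
    rw [zero_add] at m1 m2
    refine wp_fetch (by simp [hF.iarr 16 rfl, h4, m1]) (by simp [hF.iarr 17 rfl, h4, m2]) ?_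
    exact holds_tightTest_set (hE.of_frame hF rfl rfl rfl) (hw.of_frame hF rfl) (hd.of_frame hF rfl)
      (by decide) (by decide) ((hF.ivar 3 rfl).trans h3) _ _
  replace hE := hE.of_frame hF₁ rfl rfl rfl
  replace hw := hw.of_frame hF₁ rfl
  replace hd := hd.of_frame hF₁ rfl
  replace h3 := (hF₁.ivar 3 rfl).trans h3
  rw [← hF₁.iarr 10 rfl, ← hF₁.iarr 11 rfl, ← hF₁.iarr 12 rfl] at hL
  have hlenF : ((List.finRange n).map fun a => (a, v)).length = n := by simp
  refine RunsIn.seq (T₁ := n * 150 + 6) ((runsIn_filterLoop (x := 4) (b := 0) (S := 14) (D := 15)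
    (k := 5) (p := σ.ivar 5) (fetch := .iset 6 (.var 4) ;; .iset 7 (.var 1))
    (test := tightTest 3 6 7) ((List.finRange n).map fun a => (a, v)) _
    (fun e => H.Tight s e.1 e.2) 150 (by rw [hlenF, hE.size])
    (by decide) (by decide) (by decide) (by decide) rfl rfl
    rfl rfl rfl (by decide) hk₁ hs₁ ?_).mono (by rw [hlenF]) fun _ _ h => h)
    fun τ₂ hF₂ ⟨hs₂, hk₂, hl₂⟩ => ?_
  · intro i hi ρ hF h4
    have hin : i < n := by rwa [hlenF] at hi
    have hEρ := hE.of_frame hF rfl rfl rfl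
    refine wp_fetch (by simp [h4]) (by simp [hEρ.vertex]) ?_
    simpa using holds_tightTest_set hEρ (hw.of_frame hF rfl) (hd.of_frame hF rfl)
      (by decide) (by decide) ((hF.ivar 3 rfl).trans h3) ⟨i, hin⟩ v
  replace hE := hE.of_frame hF₂ rfl rfl rfl
  replace hw := hw.of_frame hF₂ rfl
  replace hd := hd.of_frame hF₂ rfl
  replace h3 := (hF₂.ivar 3 rfl).trans h3
  rw [← hF₂.iarr 10 rfl, ← hF₂.iarr 11 rfl, ← hF₂.iarr 12 rfl] at hL
  refine RunsIn.seq (T₁ := 12) (Q₁ := fun τ => τ.ivar 9 = offset L s ∧ τ.ivar 10 = (L s).length)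
    (RunsIn.straight (by decide) ?_) fun τ₃ hF₃ ⟨h9, h10⟩ => ?_
  · have o1 := hL.off_eq s s.2.le
    have o2 := hL.off_eq (s + 1) s.2
    simp [h3, o1, o2, offset_succ]
  replace hE := hE.of_frame hF₃ rfl rfl rfl
  replace hw := hw.of_frame hF₃ rfl
  replace hd := hd.of_frame hF₃ rfl
  replace h3 := (hF₃.ivar 3 rfl).trans h3
  rw [← hF₃.iarr 10 rfl, ← hF₃.iarr 11 rfl, ← hF₃.iarr 12 rfl] at hL
  refine (runsIn_filterLoop (x := 4) (b := 10) (S := 14) (D := 15) (k := 5) (p := σ.ivar 5)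
    (fetch := .iset 6 (.get 11 (.add (.var 9) (.var 4))) ;;
      .iset 7 (.get 12 (.add (.var 9) (.var 4))))
    (test := .and (.not (.ieq (.var 7) (.var 1))) (.and (tightTest 3 6 7) (.not (tightTest 1 6 7))))
    (L s) _ (fun e => e.2 ≠ v ∧ H.Tight s e.1 e.2 ∧ ¬ H.Tight v e.1 e.2) 150 h10
    (by decide) (by decide) (by decide) (by decide) rfl rfl
    rfl rfl rfl (by decide) ((hF₃.ivar 5 rfl).trans hk₂)
    (by rw [hF₃.iarr 14 rfl, hF₃.iarr 15 rfl]; exact hs₂) ?_).mono le_rfl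
    fun τ₄ hF₄ ⟨hs₄, hk₄, hl₄⟩ => ⟨by simpa [newDag] using hs₄, by simpa [newDag] using hk₄, ?_⟩
  · intro i hi ρ hF h4
    obtain ⟨m1, m2⟩ := hL.seg s i hi
    have e9 : ρ.ivar 9 = offset L s := (hF.ivar 9 rfl).trans h9
    have hEρ := hE.of_frame hF rfl rfl rfl
    have ht := fun {x : ℕ} (h6 : x ≠ 6) (h7 : x ≠ 7) (s' : Fin n) (hx : ρ.ivar x = s') =>
      holds_tightTest_set hEρ (hw.of_frame hF rfl) (hd.of_frame hF rfl) h6 h7 hx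
        (L s)[i].1 (L s)[i].2
    refine wp_fetch (by simp [hF.iarr 11 rfl, h4, e9, m1]) (by simp [hF.iarr 12 rfl, h4, e9, m2]) ?_
    rw [BExp.holds, BExp.holds, BExp.holds, BExp.holds, BExp.holds,
      ht (x := 3) (by decide) (by decide) s ((hF.ivar 3 rfl).trans h3),
      ht (x := 1) (by decide) (by decide) v hEρ.vertex]
    simp [hEρ.vertex, Fin.ext_iff]
  · intro j hj
    rw [(hl₄ j hj).1, (hl₄ j hj).2, hF₃.iarr 14 rfl, hF₃.iarr 15 rfl, (hl₂ j hj).1, (hl₂ j hj).2]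
    exact hl₁ j hj

/-- For each source, the loops run over the shortest path DAG of `v`, all vertices, and the old
shortest path DAG of the source; the full edge set of the graph is not scanned again. -/
theorem runsIn_dagUpdate {n : ℕ} {G H : WDigraph (Fin n)} {v : Fin n} {σ : Store}
    (hGH : G.IncUpdate H v) (hE : Env n v σ)
    (hw : IsMat (σ.rarr 10) (weightCode H)) (hd : IsMat (σ.rarr 11) (distCode H))
    {L : Fin n → List (Fin n × Fin n)} (hLG : Lists L G.DagEdge)
    (hL : HasLists (σ.iarr 10) (σ.iarr 11) (σ.iarr 12) L) :
    RunsIn dagUpdate σ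
      (500 * n ^ 2 + 150 * (n * {e : Fin n × Fin n | H.DagEdge v e.1 e.2}.ncard) +
        150 * offset L n)
      fun τ => ∃ L', Lists L' H.DagEdge ∧
        HasLists (τ.iarr 13) (τ.iarr 14) (τ.iarr 15) L' := by
  have hn := v.pos
  set m := {e : Fin n × Fin n | H.DagEdge v e.1 e.2}.ncard with hm
  refine RunsIn.mono (T := 150 * n ^ 2 +
    (5 + (n * (m * 150 + n * 150 + 60) + 150 * offset L n + 6))) ?_ ?_ fun _ _ h => h
  swap
  · have h1 : n ≤ n ^ 2 := by nlinarith
    have h2 : n * (m * 150 + n * 150 + 60) = 150 * (n * m) + 150 * n ^ 2 + 60 * n := by ring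
    omega
  refine (runsIn_rootDag hE hw hd).seq fun τ₁ hF₁ ⟨M, hMn, hMm, hMs, hMl⟩ => ?_
  have hMm' : M.length = m := by
    classical
    rw [← List.toFinset_card_of_nodup hMn, ← Set.ncard_coe_finset, hm]
    congr 1
    ext e
    simp [hMm, WDigraph.dagEdge_iff_tight]
  refine RunsIn.seq (T₁ := 5) (Q₁ := fun τ => τ.ivar 5 = 0 ∧ τ.iarr 13 0 = 0)
    (RunsIn.straight (by decide) (by simp)) fun τ₂ hF₂ ⟨h5, h13⟩ => ?_
  set L' := newDag H v M L with hL'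
  have hE₂ : Env n v τ₂ := (hE.of_frame hF₁ rfl rfl rfl).of_frame hF₂ rfl rfl rfl
  refine RunsIn.mono (RunsIn.forLoop_of_potential hE₂.size (by decide) rfl rfl
    (fun i => i * (m * 150 + n * 150 + 60) + 150 * offset L i)
    (fun i τ => τ.ivar 5 = offset L' i ∧ (∀ j ≤ i, τ.iarr 13 j = offset L' j) ∧
      ∀ s : Fin n, (s : ℕ) < i → Seg (τ.iarr 14) (τ.iarr 15) (offset L' s) (L' s)) ?_ ?_)
    (by omega) ?_
  · refine ⟨by simpa [offset_zero] using h5, fun j hj => ?_, by simp⟩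
    obtain rfl : j = 0 := by omega
    simpa [offset_zero] using h13
  · rintro i τ hi h3 hF ⟨hI5, hI13, hIs⟩
    set s : Fin n := ⟨i, hi⟩ with hs
    have hsi : (s : ℕ) = i := rfl
    have hEτ := hE₂.of_frame hF rfl rfl rfl
    have hrun := runsIn_appendDag (s := s) hEτ
      (((hw.of_frame hF₁ rfl).of_frame hF₂ rfl).of_frame hF rfl)
      (((hd.of_frame hF₁ rfl).of_frame hF₂ rfl).of_frame hF rfl) (M := M)
      (by rw [hF.iarr 16 rfl, hF.iarr 17 rfl, hF₂.iarr 16 rfl, hF₂.iarr 17 rfl]; exact hMs)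
      (by rw [hF.ivar 8 rfl, hF₂.ivar 8 rfl]; exact hMl) (L := L)
      (by rw [hF.iarr 10 rfl, hF.iarr 11 rfl, hF.iarr 12 rfl, hF₂.iarr 10 rfl, hF₂.iarr 11 rfl,
            hF₂.iarr 12 rfl, hF₁.iarr 10 rfl, hF₁.iarr 11 rfl, hF₁.iarr 12 rfl]; exact hL) h3
    refine ⟨_, ?_, hrun.seq (T₂ := 5) fun ρ hFρ ⟨hρs, hρ5, hρl⟩ =>
      RunsIn.straight (by decide) ?_⟩
    · have := offset_succ L s
      rw [hsi] at this
      have h2 := Nat.succ_mul i (m * 150 + n * 150 + 60)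
      rw [Nat.succ_eq_add_one] at h2
      rw [this, hMm', h2]
      omega
    · have e3 : ρ.ivar 3 = i := (hFρ.ivar 3 rfl).trans h3
      have e5 : ρ.ivar 5 = offset L' (i + 1) := by
        rw [hρ5, hI5, show i + 1 = (s : ℕ) + 1 from rfl, offset_succ]
      simp only [Cmd.wp, IExp.eval, Store.setIvar, Store.setIarr, e3, e5]
      refine ⟨by simpa using e5, fun j hj => ?_, fun t ht => ?_⟩
      · by_cases hji : j = i + 1
        · simp [hji]
        · have := hI13 j (by omega)
          simp only [Function.update_self, Function.update_of_ne hji, hFρ.iarr 13 rfl]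
          exact this
      · have hseg : Seg (ρ.iarr 14) (ρ.iarr 15) (offset L' t) (L' t) := by
          by_cases hti : (t : ℕ) = i
          · obtain rfl : t = s := Fin.ext hti
            rw [hsi, ← hI5]; exact hρs
          · refine (hIs t (by omega)).congr fun j hj => hρl j ?_
            rw [← offset_succ] at hj
            rw [hI5]
            exact hj.trans_le (offset_mono L' (show (t : ℕ) + 1 ≤ i by omega))
        simpa using hseg
  · rintro τ - ⟨-, h13, hs⟩
    exact ⟨L', lists_newDag hGH hMn hMm hLG, h13, fun s => hs s s.2⟩

end BCData

/-! ### Accumulation of the dependencies -/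

namespace BCData

open RealRAM

/-- What the edge `e` of the shortest path DAG of `s` contributes to the dependency of its first
vertex. -/
noncomputable def edgeVal {n : ℕ} (H : WDigraph (Fin n)) (s : Fin n) (e : Fin n × Fin n) : ℝ :=
  (H.numShortest s e.1 : ℝ) / H.numShortest s e.2 * (1 + H.dependency s e.2)

/-- The state of the accumulation for the source `s` when the edges in `F` have been removed from
the shortest path DAG with edge set `D`: array `16` holds the number of remaining edges out of each
vertex, the real array `13` the contributions of the removed ones, and the list `Q` in array `19`,
of the length given by variable `5`, consists of the vertices without remaining outgoing edges. -/
structure Peel {n : ℕ} (H : WDigraph (Fin n)) (s : Fin n) (D F : Finset (Fin n × Fin n))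
    (Q : List (Fin n)) (τ : Store) : Prop where
  deg : ∀ a : Fin n, τ.iarr 16 a = ((D \ F).filter fun e => e.1 = a).card
  acc : ∀ a : Fin n, τ.rarr 13 a = ∑ e ∈ F with e.1 = a, edgeVal H s e
  nodup : Q.Nodup
  mem_iff : ∀ a : Fin n, a ∈ Q ↔ τ.iarr 16 a = 0
  len : τ.ivar 5 = Q.length
  queue : ∀ (k : ℕ) (hk : k < Q.length), τ.iarr 19 k = (Q[k] : Fin n)

/-- Removes the edge number `11` into the vertex `7`. -/
def peelEdge : Cmd :=
  .iset 6 (.get 18 (.add (.get 6 (.var 7)) (.var 11))) ;;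
  .rput 13 (.var 6) (.add (.get 13 (.var 6))
    (.mul (.div (cell 2 3 6) (cell 2 3 7)) (.add (.const 1) (.get 13 (.var 7))))) ;;
  .iput 16 (.var 6) (.sub (.get 16 (.var 6)) (.const 1)) ;;
  .ite (.ieq (.get 16 (.var 6)) (.const 0))
    (.iput 19 (.var 5) (.var 6) ;; .iset 5 (.add (.var 5) (.const 1))) .skip

theorem wp_peelEdge {n w : ℕ} {H : WDigraph (Fin n)} {s a b : Fin n}
    {D F : Finset (Fin n × Fin n)} {Q : List (Fin n)} {τ : Store} (h : Peel H s D F Q τ)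
    (hE : Env n w τ) (hc : IsMat (τ.rarr 2) fun s t => (H.numShortest s t : ℝ))
    (he : (a, b) ∈ D) (heF : (a, b) ∉ F) (hab : a ≠ b)
    (h3 : τ.ivar 3 = s) (h7 : τ.ivar 7 = b) (h18 : τ.iarr 18 (b * n + τ.ivar 11) = a)
    (hb : τ.rarr 13 b = H.dependency s b) :
    peelEdge.wp (fun τ' => τ'.rarr 13 b = H.dependency s b ∧
      ∃ Q', Q <+: Q' ∧ Peel H s D (insert (a, b) F) Q' τ') τ := by
  have hab' : (b : ℕ) ≠ a := fun h => hab (Fin.ext h.symm)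
  have hba : ¬ (b : ℕ) = a := hab'
  have herase : D \ insert (a, b) F = (D \ F).erase (a, b) := by
    ext e; simp only [Finset.mem_sdiff, Finset.mem_insert, Finset.mem_erase]; tauto
  have hmem : (a, b) ∈ (D \ F).filter fun e => e.1 = a := by simp [he, heF]
  have hdeg : ∀ x : Fin n, ((D \ insert (a, b) F).filter fun e => e.1 = x).card =
      if x = a then τ.iarr 16 a - 1 else τ.iarr 16 x := by
    intro x
    have hf : ((D \ insert (a, b) F).filter fun e => e.1 = x) =
        ((D \ F).filter fun e => e.1 = x).erase (a, b) := by
      rw [herase]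
      ext e; simp only [Finset.mem_filter, Finset.mem_erase]; tauto
    rw [hf]
    split_ifs with hx
    · rw [hx, Finset.card_erase_of_mem hmem, h.deg]
    · rw [Finset.erase_eq_of_notMem, h.deg]
      simp only [Finset.mem_filter, not_and]
      exact fun _ h' => hx h'.symm
  have hacc : ∀ x : Fin n, ∑ e ∈ insert (a, b) F with e.1 = x, edgeVal H s e =
      if x = a then τ.rarr 13 a + (H.numShortest s a : ℝ) / H.numShortest s b *
        (1 + H.dependency s b) else τ.rarr 13 x := by
    intro x
    rw [Finset.filter_insert]
    split_ifs with hx hx' hx'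
    · rw [Finset.sum_insert (by simp [heF]), h.acc, hx', add_comm]
      rfl
    · exact absurd hx.symm hx'
    · exact absurd hx'.symm hx
    · rw [h.acc]
  have hpos : 0 < τ.iarr 16 a := by
    rw [h.deg]; exact Finset.card_pos.2 ⟨_, hmem⟩
  have haQ : a ∉ Q := fun hQ => by
    have := (h.mem_iff a).1 hQ
    omega
  have hval : ∀ x : Fin n, ((x : ℕ) = (a : ℕ)) = (x = a) := fun x => by rw [Fin.ext_iff]
  simp only [peelEdge, Cmd.wp, BExp.holds, IExp.eval, RExp.eval, eval_cell, Store.setIvar,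
    Store.setIarr, Store.setRarr, h7, hE.rows b b.2, h18, Function.update_apply,
    Nat.reduceEqDiff, if_true, if_false, h3, hE.rows s s.2, hc s a, hc s b, hb,
    Nat.cast_one, h.len, hba]
  refine ⟨fun h0 => ⟨trivial, Q ++ [a], List.prefix_append _ _, ?_, ?_, ?_, ?_, ?_, ?_⟩,
    fun h0 => ⟨trivial, Q, List.prefix_rfl, ?_, ?_, ?_, ?_, ?_, ?_⟩⟩
  · intro x; rw [hdeg]; simp [hval]
  · intro x; rw [hacc]; simp [hval]
  · exact List.Nodup.append h.nodup (List.nodup_singleton a) (by simpa using haQ)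
  · intro x
    by_cases hx : x = a
    · simp [hx, h0]
    · have hx' : ¬ (x : ℕ) = a := fun h' => hx (Fin.ext h')
      simp [hx, hx', h.mem_iff]
  · simp
  · intro k hk
    by_cases hkl : k = Q.length
    · subst hkl; simp
    · have hk' : k < Q.length := by simp at hk; omega
      rw [List.getElem_append_left hk', ← h.queue k hk']
      simp [hkl]
  · intro x; rw [hdeg]; simp [hval]
  · intro x; rw [hacc]; simp [hval]
  · exact h.nodup
  · intro x
    by_cases hx : x = a
    · simp [hx, h0, haQ]
    · have hx' : ¬ (x : ℕ) = a := fun h' => hx (Fin.ext h')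
      simp [hx', h.mem_iff]
  · exact h.len
  · intro k hk
    rw [← h.queue k hk]
    simp

/-- The first vertices of the edges of `E` that end at `b`. -/
def preds {n : ℕ} (E : List (Fin n × Fin n)) (b : Fin n) : List (Fin n) :=
  (E.filter fun e => e.2 = b).map Prod.fst

theorem mem_preds {n : ℕ} {E : List (Fin n × Fin n)} {a b : Fin n} :
    a ∈ preds E b ↔ (a, b) ∈ E := by
  simp [preds]

theorem nodup_preds {n : ℕ} {E : List (Fin n × Fin n)} (hE : E.Nodup) (b : Fin n) :
    (preds E b).Nodup := by
  refine List.Nodup.map_on ?_ (hE.filter _)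
  rintro ⟨a, c⟩ h ⟨a', c'⟩ h' rfl
  simp at h h'
  rw [h.2, h'.2]

/-- The list of predecessors of each vertex `b` is stored in row `b` of the matrix in array `18`,
and its length in array `17`. -/
def HasPreds {n : ℕ} (E : List (Fin n × Fin n)) (τ : Store) : Prop :=
  ∀ b : Fin n, τ.iarr 17 b = (preds E b).length ∧
    ∀ (k : ℕ) (hk : k < (preds E b).length), τ.iarr 18 (b * n + k) = ((preds E b)[k] : Fin n)

/-- Prepares the accumulation for the source `3`. -/
def initSource : Cmd :=
  forLoop 4 0 (.rput 13 (.var 4) (.const 0) ;; .iput 16 (.var 4) (.const 0) ;;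
    .iput 17 (.var 4) (.const 0)) ;;
  (.iset 9 (.get 0 (.var 3)) ;; .iset 10 (.sub (.get 0 (.add (.var 3) (.const 1))) (.var 9))) ;;
  forLoop 4 10 (
    .iset 6 (.get 1 (.add (.var 9) (.var 4))) ;; .iset 7 (.get 2 (.add (.var 9) (.var 4))) ;;
    .iput 16 (.var 6) (.add (.get 16 (.var 6)) (.const 1)) ;;
    .iput 18 (.add (.get 6 (.var 7)) (.get 17 (.var 7))) (.var 6) ;;
    .iput 17 (.var 7) (.add (.get 17 (.var 7)) (.const 1))) ;;
  .iset 5 (.const 0) ;;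
  forLoop 4 0 (.ite (.ieq (.get 16 (.var 4)) (.const 0))
    (.iput 19 (.var 5) (.var 4) ;; .iset 5 (.add (.var 5) (.const 1))) .skip)

theorem runsIn_initSource {n w : ℕ} {H : WDigraph (Fin n)} {s : Fin n} {σ : Store}
    (hE : Env n w σ) {L : Fin n → List (Fin n × Fin n)}
    (hL : HasLists (σ.iarr 0) (σ.iarr 1) (σ.iarr 2) L) (hLn : (L s).Nodup) (h3 : σ.ivar 3 = s) :
    RunsIn initSource σ (n * 50 + (L s).length * 50 + 40) fun τ =>
      HasPreds (L s) τ ∧ ∃ Q, Peel H s (L s).toFinset ∅ Q τ := by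
  have hn := s.pos
  refine RunsIn.mono (T := (n * 17 + 6) + (12 + ((L s).length * 45 + 6 + (2 + (n * 25 + 6)))))
    ?_ (by omega) fun _ _ h => h
  refine RunsIn.seq (T₁ := n * 17 + 6) (Q₁ := fun τ => ∀ a < n, τ.rarr 13 a = 0 ∧
    τ.iarr 16 a = 0 ∧ τ.iarr 17 a = 0) (RunsIn.forLoop hE.size (by decide) rfl rfl 9
      (fun i τ => ∀ a < i, τ.rarr 13 a = 0 ∧ τ.iarr 16 a = 0 ∧ τ.iarr 17 a = 0) (by simp) ?_)
    fun τ₁ hF₁ h₁ => ?_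
  · intro i τ hi h4 hF hI
    refine RunsIn.straight (by decide) fun a ha => ?_
    by_cases hai : a = i
    · simp [h4, hai]
    · simpa [h4, hai] using hI a (by omega)
  replace hE := hE.of_frame hF₁ rfl rfl rfl
  replace h3 := (hF₁.ivar 3 rfl).trans h3
  rw [← hF₁.iarr 0 rfl, ← hF₁.iarr 1 rfl, ← hF₁.iarr 2 rfl] at hL
  refine RunsIn.seq (T₁ := 12) (Q₁ := fun τ => τ.ivar 9 = offset L s ∧ τ.ivar 10 = (L s).length)
    (RunsIn.straight (by decide) ?_) fun τ₂ hF₂ ⟨h9, h10⟩ => ?_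
  · have o1 := hL.off_eq s s.2.le
    have o2 := hL.off_eq (s + 1) s.2
    simp [h3, o1, o2, offset_succ]
  replace hE := hE.of_frame hF₂ rfl rfl rfl
  replace h3 := (hF₂.ivar 3 rfl).trans h3
  rw [← hF₂.iarr 0 rfl, ← hF₂.iarr 1 rfl, ← hF₂.iarr 2 rfl] at hL
  rw [← hF₂.iarr 16 rfl, ← hF₂.iarr 17 rfl, ← hF₂.rarr 13 rfl] at h₁
  refine RunsIn.seq (T₁ := (L s).length * 45 + 6) (Q₁ := fun τ => HasPreds (L s) τ ∧
      ∀ a : Fin n, τ.iarr 16 a = ((L s).filter fun e => e.1 = a).length)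
    (RunsIn.mono (RunsIn.forLoop h10 (by decide) rfl rfl 37
      (fun i τ => HasPreds ((L s).take i) τ ∧
        ∀ a : Fin n, τ.iarr 16 a = (((L s).take i).filter fun e => e.1 = a).length) ?_ ?_) le_rfl
      ?_) fun τ₃ hF₃ ⟨hP, hdeg⟩ => ?_
  · refine ⟨fun b => ⟨?_, fun k hk => by simp [preds] at hk⟩, fun a => ?_⟩
    · simpa [preds] using (h₁ b b.2).2.2
    · simpa using (h₁ a a.2).2.1
  · rintro i τ hi h4 hF ⟨hIP, hId⟩
    obtain ⟨m1, m2⟩ := hL.seg s i hi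
    set e := (L s)[i] with he
    have htake : (L s).take (i + 1) = (L s).take i ++ [e] := by simp [he]
    have hpreds : ∀ b, preds ((L s).take (i + 1)) b =
        preds ((L s).take i) b ++ if e.2 = b then [e.1] else [] := fun b => by
      rw [preds, htake, List.filter_append, List.map_append, ← preds]
      by_cases hb : e.2 = b <;> simp [hb]
    have hlt : (preds ((L s).take i) e.2).length < n := by
      have h1 := (nodup_preds ((List.take_sublist (i + 1) (L s)).nodup hLn) e.2).length_le_card
      rw [hpreds, if_pos rfl, List.length_append, List.length_singleton, Fintype.card_fin] at h1
      omega
    have hlt' : ∀ b, (preds ((L s).take i) b).length ≤ n := fun b => by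
      have h1 := (nodup_preds ((List.take_sublist i (L s)).nodup hLn) b).length_le_card
      rwa [Fintype.card_fin] at h1
    have e9 : τ.ivar 9 = offset L s := (hF.ivar 9 rfl).trans h9
    have e6 : τ.iarr 1 (offset L s + i) = e.1 := by rw [hF.iarr 1 rfl, m1]
    have e7 : τ.iarr 2 (offset L s + i) = e.2 := by rw [hF.iarr 2 rfl, m2]
    have er : τ.iarr 6 e.2 = e.2 * n := by rw [hF.iarr 6 rfl]; exact hE.rows _ e.2.2
    refine RunsIn.straight (by decide) ?_
    simp only [Cmd.wp, IExp.eval, Store.setIvar, Store.setIarr, Function.update_apply,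
      Nat.reduceEqDiff, if_true, if_false, h4, e9, e6, e7, er]
    refine ⟨fun b => ?_, fun a => ?_⟩
    · obtain ⟨hIl, hIk⟩ := hIP b
      by_cases hb : e.2 = b
      · have hbv : (b : ℕ) = e.2 := by rw [hb]
        simp only [hpreds, hb, if_true, hIl]
        refine ⟨by simp, fun k hk => ?_⟩
        by_cases hkl : k = (preds ((L s).take i) b).length
        · subst hkl; simp
        · have hk' : k < (preds ((L s).take i) b).length := by simp at hk; omega
          rw [List.getElem_append_left hk', ← hIk k hk']
          simp [hkl]
      · have hbv : ¬ (b : ℕ) = e.2 := fun h => hb (Fin.ext h.symm)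
        have hbv' : ¬ (e.2 : ℕ) = b := fun h => hbv h.symm
        simp only [hpreds, hb, if_false, List.append_nil]
        refine ⟨by simp [hbv, hIl], fun k hk => ?_⟩
        suffices hpos : ¬ (b : ℕ) * n + k = e.2 * n + τ.iarr 17 e.2 by
          rw [← hIk k hk]; simp [hpos]
        -- entries of different rows have different positions
        intro hpos
        have hkn : k < n := hk.trans_le (hlt' b)
        rw [(hIP e.2).1] at hpos
        refine hbv ?_
        have h1 : ((b : ℕ) * n + k) / n = b := by
          rw [mul_comm, Nat.mul_add_div hn, Nat.div_eq_of_lt hkn, add_zero]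
        rw [hpos, mul_comm, Nat.mul_add_div hn, Nat.div_eq_of_lt hlt, add_zero] at h1
        exact h1.symm
    · rw [htake, List.filter_append, List.length_append, ← hId]
      by_cases ha : e.1 = a
      · simp [ha]
      · have hav : ¬ (a : ℕ) = e.1 := fun h => ha (Fin.ext h.symm)
        simp [ha, hav, hId]
  · rintro τ - h
    simpa only [List.take_length] using h
  replace hE := hE.of_frame hF₃ rfl rfl rfl
  rw [← hF₃.rarr 13 rfl] at h₁
  refine RunsIn.seq (T₁ := 2) (Q₁ := fun τ => τ.ivar 5 = 0) (RunsIn.straight (by decide) (by simp))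
    fun τ₄ hF₄ h5 => ?_
  replace hE := hE.of_frame hF₄ rfl rfl rfl
  rw [← hF₄.iarr 16 rfl] at hdeg
  refine RunsIn.mono (RunsIn.forLoop hE.size (by decide) rfl rfl 17
    (fun i τ => ∃ Q : List (Fin n), Q.Nodup ∧ (∀ a : Fin n, a ∈ Q ↔ (a : ℕ) < i ∧ τ.iarr 16 a = 0) ∧
      τ.ivar 5 = Q.length ∧ ∀ (k : ℕ) (hk : k < Q.length), τ.iarr 19 k = (Q[k] : Fin n)) ?_ ?_)
    (by omega) ?_
  · exact ⟨[], List.nodup_nil, by simp, by simpa using h5, by simp⟩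
  · rintro i τ hi h4 hF ⟨Q, hQn, hQm, hQl, hQk⟩
    refine RunsIn.straight (by decide) ?_
    simp only [Cmd.wp, BExp.holds, IExp.eval, Store.setIvar, Store.setIarr, Function.update_apply,
      Nat.reduceEqDiff, if_true, if_false, h4, hQl]
    refine ⟨fun h0 => ⟨Q ++ [⟨i, hi⟩], ?_, fun a => ?_, by simp, fun k hk => ?_⟩,
      fun h0 => ⟨Q, hQn, fun a => ?_, rfl, hQk⟩⟩
    · refine List.Nodup.append hQn (List.nodup_singleton _) ?_
      simp [hQm]
    · rw [List.mem_append, List.mem_singleton, hQm, Nat.lt_succ_iff_lt_or_eq, Fin.ext_iff]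
      constructor
      · rintro (h | h)
        · exact ⟨.inl h.1, h.2⟩
        · exact ⟨.inr h, by rw [h]; exact h0⟩
      · rintro ⟨h | h, h'⟩
        · exact .inl ⟨h, h'⟩
        · exact .inr h
    · by_cases hkl : k = Q.length
      · subst hkl; simp
      · have hk' : k < Q.length := by simp at hk; omega
        rw [List.getElem_append_left hk', ← hQk k hk']
        simp [hkl]
    · rw [hQm, Nat.lt_succ_iff_lt_or_eq]
      constructor
      · exact fun h => ⟨.inl h.1, h.2⟩
      · rintro ⟨h | h, h'⟩
        · exact ⟨h, h'⟩
        · exact absurd (h ▸ h') h0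
  · rintro τ hF ⟨Q, hQn, hQm, hQl, hQk⟩
    refine ⟨fun b => ?_, Q, fun a => ?_, fun a => ?_, hQn, fun a => ?_, hQl, hQk⟩
    · rw [hF.iarr 17 rfl, hF.iarr 18 rfl, hF₄.iarr 17 rfl, hF₄.iarr 18 rfl]
      exact hP b
    · rw [hF.iarr 16 rfl, hdeg, Finset.sdiff_empty,
        ← List.toFinset_card_of_nodup (hLn.filter _), List.toFinset_filter]
      congr 1
      ext e; simp
    · rw [hF.rarr 13 rfl, hF₄.rarr 13 rfl]
      simpa using (h₁ a a.2).1
    · rw [hQm]; simp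

/-- Removes all edges into the vertices of the queue, in the order of the queue, and adds the
dependencies on the source `3` to the centralities. -/
def accumulate : Cmd :=
  forLoop 4 0 (
    (.iset 7 (.get 19 (.var 4)) ;;
      .ite (.ieq (.var 7) (.var 3)) .skip
        (.rput 3 (.var 7) (.add (.get 3 (.var 7)) (.get 13 (.var 7)))) ;;
      .iset 8 (.get 17 (.var 7))) ;;
    forLoop 11 8 peelEdge)

theorem Peel.congr {n : ℕ} {H : WDigraph (Fin n)} {s : Fin n} {D F : Finset (Fin n × Fin n)}
    {Q : List (Fin n)} {σ τ : Store} (h : Peel H s D F Q σ) (h16 : τ.iarr 16 = σ.iarr 16)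
    (h19 : τ.iarr 19 = σ.iarr 19) (h13 : τ.rarr 13 = σ.rarr 13) (h5 : τ.ivar 5 = σ.ivar 5) :
    Peel H s D F Q τ :=
  ⟨fun a => h16 ▸ h.deg a, fun a => h13 ▸ h.acc a, h.nodup, fun a => h16 ▸ h.mem_iff a,
    h5.trans h.len, fun k hk => h19 ▸ h.queue k hk⟩

/-- No edges leave the vertices of the queue any more, so that their dependencies are complete. -/
theorem Peel.acc_eq_dependency {n : ℕ} {H : WDigraph (Fin n)} {s a : Fin n}
    {D F : Finset (Fin n × Fin n)} {Q : List (Fin n)} {τ : Store} (h : Peel H s D F Q τ)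
    (hD : ∀ a b, (a, b) ∈ D ↔ H.Tight s a b) (hF : F ⊆ D) (ha : a ∈ Q) :
    τ.rarr 13 a = H.dependency s a := by
  classical
  have h0 := (h.mem_iff a).1 ha
  rw [h.deg, Finset.card_eq_zero, Finset.filter_eq_empty_iff] at h0
  rw [h.acc, WDigraph.dependency_eq_sum]
  refine Finset.sum_bij (fun e _ => e.2) ?_ ?_ ?_ ?_
  · rintro ⟨c, b⟩ he
    simp only [Finset.mem_filter] at he
    obtain ⟨he, rfl⟩ := he
    simpa using (hD _ _).1 (hF he)
  · rintro ⟨c, b⟩ he ⟨c', b'⟩ he' hb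
    simp only [Finset.mem_filter] at he he' hb
    rw [he.2, he'.2, hb]
  · intro b hb
    have hb := (hD _ _).2 (Finset.mem_filter.1 hb).2
    refine ⟨(a, b), Finset.mem_filter.2 ⟨?_, rfl⟩, rfl⟩
    by_contra hn
    exact h0 (Finset.mem_sdiff.2 ⟨hb, hn⟩) rfl
  · rintro ⟨c, b⟩ he
    simp only [Finset.mem_filter] at he
    rw [edgeVal, he.2]

/-- The queue is exhausted only when it contains all vertices: among the vertices outside the queue,
one at maximum distance from the source has no remaining edge, as it would have to lead to a vertex
outside the queue that is farther away. -/
theorem Peel.mem_of_exhausted {n : ℕ} {H : WDigraph (Fin n)} {s : Fin n}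
    {D F : Finset (Fin n × Fin n)} {Q : List (Fin n)} {τ : Store} (h : Peel H s D F Q τ)
    (hD : ∀ a b, (a, b) ∈ D ↔ H.Tight s a b) (hF : ∀ e ∈ D, e.2 ∈ Q → e ∈ F) (a : Fin n) :
    a ∈ Q := by
  by_contra ha
  obtain ⟨c, hc, hmax⟩ := (Finset.univ.filter fun c => c ∉ Q).exists_max_image (H.dist s)
    ⟨a, by simpa using ha⟩
  rw [Finset.mem_filter] at hc
  have h0 := mt (h.mem_iff c).2 hc.2
  rw [h.deg, Finset.card_eq_zero, ← ne_eq, ← Finset.nonempty_iff_ne_empty] at h0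
  obtain ⟨⟨c', b⟩, he⟩ := h0
  simp only [Finset.mem_filter, Finset.mem_sdiff] at he
  obtain ⟨⟨heD, heF⟩, rfl⟩ := he
  have hb : b ∉ Q := fun hb => heF (hF _ heD hb)
  exact ((hD _ _).1 heD).dist_lt.not_ge (hmax b (by simpa using hb))

theorem length_preds {n : ℕ} {E : List (Fin n × Fin n)} (hE : E.Nodup) (b : Fin n) :
    (preds E b).length = (E.toFinset.filter fun e => e.2 = b).card := by
  rw [preds, List.length_map, ← List.toFinset_card_of_nodup (hE.filter _), List.toFinset_filter]
  congr 1
  ext e; simp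

/-- Removing the edges into a vertex `b` without remaining outgoing edges, whose dependency is
therefore known, passes its share on to the predecessors of `b`. -/
theorem runsIn_peelEdges {n w : ℕ} {H : WDigraph (Fin n)} {s b : Fin n}
    {E : List (Fin n × Fin n)} {F : Finset (Fin n × Fin n)} {Q : List (Fin n)} {σ : Store}
    (hE : Env n w σ) (hc : IsMat (σ.rarr 2) fun s t => (H.numShortest s t : ℝ))
    (hEn : E.Nodup) (hP : HasPreds E σ) (h : Peel H s E.toFinset F Q σ) (h3 : σ.ivar 3 = s)
    (h7 : σ.ivar 7 = b) (h8 : σ.ivar 8 = (preds E b).length) (hF : ∀ e ∈ F, e.2 ≠ b)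
    (hb : σ.rarr 13 b = H.dependency s b) (hEb : ∀ a, (a, b) ∈ E → a ≠ b) :
    RunsIn (forLoop 11 8 peelEdge) σ ((preds E b).length * 80 + 6) fun τ =>
      ∃ Q', Q <+: Q' ∧ Peel H s E.toFinset (F ∪ E.toFinset.filter fun e => e.2 = b) Q' τ := by
  set P := preds E b with hPdef
  have hPn : P.Nodup := nodup_preds hEn b
  refine RunsIn.mono (RunsIn.forLoop h8 (by decide) rfl rfl 72
    (fun k τ => τ.rarr 13 b = H.dependency s b ∧ ∃ Q', Q <+: Q' ∧ Peel H s E.toFinset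
      (F ∪ E.toFinset.filter fun e => e.2 = b ∧ e.1 ∈ P.take k) Q' τ) ?_ ?_) (by omega) ?_
  · refine ⟨hb, Q, List.prefix_rfl, ?_⟩
    have : (E.toFinset.filter fun e => e.2 = b ∧ e.1 ∈ P.take 0) = ∅ := by simp
    rw [this, Finset.union_empty]
    exact h.congr rfl rfl rfl rfl
  · rintro k τ hk h11 hFr ⟨hbτ, Q', hQ', hPl⟩
    have hmem : (P[k], b) ∈ E := mem_preds.1 (List.getElem_mem hk)
    have hnot : P[k] ∉ P.take k := fun hm => by
      obtain ⟨j, hj, hjk⟩ := List.mem_take_iff_getElem.1 hm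
      have := (hPn.getElem_inj_iff).1 hjk
      omega
    refine RunsIn.mono (RunsIn.straight (T := 72) (by decide) (wp_peelEdge hPl
      (hE.of_frame hFr rfl rfl rfl) (hFr.rarr 2 rfl ▸ hc) (a := P[k]) (b := b) (by simpa using hmem)
      ?_ (hEb _ hmem) ((hFr.ivar 3 rfl).trans h3) ((hFr.ivar 7 rfl).trans h7) ?_ hbτ)) le_rfl ?_
    · simp only [Finset.mem_union, Finset.mem_filter, not_or, not_and]
      exact ⟨fun h' => hF _ h' rfl, fun _ _ => hnot⟩
    · rw [hFr.iarr 18 rfl, h11]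
      exact (hP b).2 k hk
    · rintro τ' - ⟨hb', Q'', hQ'', hPl'⟩
      refine ⟨hb', Q'', hQ'.trans hQ'', ?_⟩
      have : (F ∪ E.toFinset.filter fun e => e.2 = b ∧ e.1 ∈ P.take (k + 1)) =
          insert (P[k], b) (F ∪ E.toFinset.filter fun e => e.2 = b ∧ e.1 ∈ P.take k) := by
        ext ⟨c, d⟩
        simp only [Finset.mem_union, Finset.mem_filter, Finset.mem_insert, Prod.mk.injEq,
          List.mem_toFinset, List.take_succ_eq_append_getElem hk, List.mem_append,
          List.mem_singleton]
        constructor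
        · rintro (h' | ⟨h', rfl, h'' | rfl⟩)
          · exact .inr (.inl h')
          · exact .inr (.inr ⟨h', rfl, h''⟩)
          · exact .inl ⟨rfl, rfl⟩
        · rintro (⟨rfl, rfl⟩ | h' | ⟨h', rfl, h''⟩)
          · exact .inr ⟨hmem, rfl, .inr rfl⟩
          · exact .inl h'
          · exact .inr ⟨h', rfl, .inl h''⟩
      rw [this]
      exact hPl'.congr rfl rfl rfl rfl
  · rintro τ - ⟨-, Q', hQ', hPl⟩
    refine ⟨Q', hQ', ?_⟩
    convert hPl using 2
    ext ⟨c, d⟩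
    simp only [Finset.mem_filter, List.take_length, List.mem_toFinset, and_congr_right_iff]
    rintro h'
    refine ⟨fun hd => ⟨hd, ?_⟩, fun h => h.1⟩
    obtain rfl : d = b := hd
    exact mem_preds.2 h'

/-- Every vertex of the queue is handled once, in constant time apart from the removal of the edges
into it, and every edge is removed once. -/
theorem runsIn_accumulate {n w : ℕ} {H : WDigraph (Fin n)} {s : Fin n}
    {E : List (Fin n × Fin n)} {Q : List (Fin n)} {σ : Store}
    (hE : Env n w σ) (hc : IsMat (σ.rarr 2) fun s t => (H.numShortest s t : ℝ))
    (hEn : E.Nodup) (hEm : ∀ a b, (a, b) ∈ E ↔ H.Tight s a b) (hP : HasPreds E σ)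
    (h : Peel H s E.toFinset ∅ Q σ) (h3 : σ.ivar 3 = s) :
    RunsIn accumulate σ (n * 50 + E.length * 80 + 6) fun τ =>
      ∀ x : Fin n, τ.rarr 3 x = σ.rarr 3 x + if x ≠ s then H.dependency s x else 0 := by
  have hD : ∀ a b, (a, b) ∈ E.toFinset ↔ H.Tight s a b := by simpa using hEm
  refine Runs.mono (Runs.forLoop hE.size (by decide) rfl rfl (fun i t τ => ∃ Q : List (Fin n),
    t ≤ i * 50 + 80 * (E.toFinset.filter fun e => e.2 ∈ Q.take i).card ∧ i ≤ Q.length ∧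
    Peel H s E.toFinset (E.toFinset.filter fun e => e.2 ∈ Q.take i) Q τ ∧
    ∀ x : Fin n, τ.rarr 3 x = σ.rarr 3 x + if x ∈ Q.take i ∧ x ≠ s then H.dependency s x else 0)
    ?_ ?_) ?_
  · refine ⟨Q, by simp, by simp, ?_, by simp⟩
    have : (E.toFinset.filter fun e => e.2 ∈ Q.take 0) = ∅ := by simp
    rw [this]
    exact h.congr rfl rfl rfl rfl
  · rintro i t τ hi h4 hF ⟨Q, ht, hiQ, hPl, hB⟩
    have hlt : i < Q.length := by
      by_contra hge
      have hQi : Q.take i = Q := List.take_of_length_le (by omega)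
      have hall := hPl.mem_of_exhausted hD (by simp +contextual [hQi])
      have h1 : (Finset.univ : Finset (Fin n)).card ≤ Q.toFinset.card :=
        Finset.card_le_card fun a _ => by simpa using hall a
      have h2 := Q.toFinset_card_le
      rw [Finset.card_univ, Fintype.card_fin] at h1
      omega
    set b := Q[i] with hb
    have htake : Q.take (i + 1) = Q.take i ++ [b] := List.take_succ_eq_append_getElem hlt
    have hbQ : b ∉ Q.take i := fun hm => by
      obtain ⟨j, hj, hji⟩ := List.mem_take_iff_getElem.1 hm
      have := (hPl.nodup.getElem_inj_iff).1 hji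
      omega
    have hdep : τ.rarr 13 b = H.dependency s b :=
      hPl.acc_eq_dependency hD (Finset.filter_subset _ _) (List.getElem_mem hlt)
    have h19 : τ.iarr 19 i = b := hPl.queue i hlt
    have h3τ : τ.ivar 3 = s := (hF.ivar 3 rfl).trans h3
    have hPτ : ∀ b : Fin n, τ.iarr 17 b = (preds E b).length ∧
        ∀ (k : ℕ) (hk : k < (preds E b).length),
          τ.iarr 18 (b * n + k) = ((preds E b)[k] : Fin n) := by
      rw [hF.iarr 17 rfl, hF.iarr 18 rfl]; exact hP
    have hEτ := hE.of_frame hF rfl rfl rfl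
    refine Runs.mono (RunsIn.seq (T₁ := 32) (Q₁ := fun τ' => τ'.ivar 7 = b ∧
      τ'.ivar 8 = (preds E b).length ∧ ∀ x : Fin n, τ'.rarr 3 x = σ.rarr 3 x +
        if x ∈ Q.take (i + 1) ∧ x ≠ s then H.dependency s x else 0)
      (RunsIn.straight (by decide) ?_) fun τ₁ hF₁ ⟨h7, h8, hB₁⟩ => ?_)
      (Q := fun t' τ' => t' ≤ 32 + ((preds E b).length * 80 + 6) ∧ ∃ Q', Q <+: Q' ∧
        Peel H s E.toFinset ((E.toFinset.filter fun e => e.2 ∈ Q.take i) ∪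
          E.toFinset.filter fun e => e.2 = b) Q' τ' ∧ ∀ x : Fin n, τ'.rarr 3 x = σ.rarr 3 x +
        if x ∈ Q.take (i + 1) ∧ x ≠ s then H.dependency s x else 0) ?_
    · have hx : ∀ x : Fin n, (if x = b then τ.rarr 3 x + (if x = s then 0 else H.dependency s x)
          else τ.rarr 3 x) = σ.rarr 3 x +
          if x ∈ Q.take (i + 1) ∧ x ≠ s then H.dependency s x else 0 := fun x => by
        simp only [htake, List.mem_append, List.mem_singleton, hB]
        by_cases hxb : x = b
        · by_cases hxs : x = s
          · simp [hxs]
          · simp [hxb, hbQ]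
        · simp [hxb]
      have hbs : (b : ℕ) = s ↔ b = s := Fin.ext_iff.symm
      have hl := (hPτ b).1
      simp only [Cmd.wp, BExp.holds, IExp.eval, RExp.eval, Store.setIvar, Store.setRarr,
        Function.update_apply, Nat.reduceEqDiff, if_true, if_false, h4, h19, h3τ, hl, hdep, hbs,
        true_and]
      refine ⟨fun hs x => ?_, fun hs x => ?_⟩
      · rw [← hx]
        by_cases hxb : x = b
        · simp [hxb, hs]
        · simp [hxb]
      · rw [← hx]
        by_cases hxb : x = b
        · simp [hxb, hs]
        · have hxb' : ¬ (x : ℕ) = b := fun h' => hxb (Fin.ext h')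
          simp [hxb, hxb']
    · have hE₁ := hEτ.of_frame hF₁ rfl rfl rfl
      refine RunsIn.mono (runsIn_peelEdges hE₁ ?_ hEn ?_ (hPl.congr (hF₁.iarr 16 rfl)
        (hF₁.iarr 19 rfl) (hF₁.rarr 13 rfl) (hF₁.ivar 5 rfl)) ((hF₁.ivar 3 rfl).trans h3τ) h7 h8 ?_
        (by rw [hF₁.rarr 13 rfl, hdep]) ?_) le_rfl ?_
      · rw [hF₁.rarr 2 rfl, hF.rarr 2 rfl]; exact hc
      · intro c
        rw [hF₁.iarr 17 rfl, hF₁.iarr 18 rfl]; exact hPτ c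
      · intro e he heb
        exact hbQ (heb ▸ (Finset.mem_filter.1 he).2)
      · rintro a ha rfl
        exact ((hEm _ _).1 ha).dist_lt.false
      · rintro τ' hF' ⟨Q', hQ', hPl'⟩
        exact ⟨Q', hQ', hPl', by rw [hF'.rarr 3 rfl]; exact hB₁⟩
    · rintro t' τ' - ⟨ht', Q', hQ', hPl', hB'⟩
      have hlen := hQ'.length_le
      have hQ'i : Q'.take (i + 1) = Q.take (i + 1) := by
        obtain ⟨R, rfl⟩ := hQ'
        exact List.take_append_of_le_length (by omega)
      have hfil : (E.toFinset.filter fun e => e.2 ∈ Q.take (i + 1)) =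
          (E.toFinset.filter fun e => e.2 ∈ Q.take i) ∪ E.toFinset.filter fun e => e.2 = b := by
        rw [← Finset.filter_or]
        simp only [htake, List.mem_append, List.mem_singleton]
      refine ⟨Q', ?_, by omega, ?_, ?_⟩
      · rw [hQ'i, hfil, Finset.card_union_of_disjoint, ← length_preds hEn]
        · omega
        · refine Finset.disjoint_left.2 fun e he he' => hbQ ?_
          rw [Finset.mem_filter] at he he'
          exact he'.2 ▸ he.2
      · rw [hQ'i, hfil]
        exact hPl'.congr rfl rfl rfl rfl
      · rw [hQ'i]; exact hB'
  · rintro t τ - ⟨t', rfl, Q, ht, hnQ, hPl, hB⟩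
    have h1 := hPl.nodup.length_le_card
    rw [Fintype.card_fin] at h1
    have hQn : Q.take n = Q := List.take_of_length_le h1
    have hall : ∀ x, x ∈ Q := fun x => by
      have := (Finset.card_eq_iff_eq_univ Q.toFinset).1
        (by rw [List.toFinset_card_of_nodup hPl.nodup, Fintype.card_fin]; omega)
      exact List.mem_toFinset.1 (this ▸ Finset.mem_univ x)
    refine ⟨?_, fun x => ?_⟩
    · have h2 := (Finset.card_filter_le E.toFinset fun e => e.2 ∈ Q.take n).trans E.toFinset_card_le
      omega
    · rw [hB, hQn]
      simp [hall]

end BCData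

/-! ### The whole program -/

namespace BCData

open RealRAM

/-- Computes the centralities from the shortest path DAGs and the numbers of shortest paths. -/
def brandes : Cmd :=
  forLoop 3 0 (.rput 3 (.var 3) (.const 0)) ;; forLoop 3 0 (initSource ;; accumulate)

theorem runsIn_brandes {n w : ℕ} {H : WDigraph (Fin n)} {σ : Store} (hE : Env n w σ) (hn : 0 < n)
    (hc : IsMat (σ.rarr 2) fun s t => (H.numShortest s t : ℝ))
    {L : Fin n → List (Fin n × Fin n)} (hL : Lists L H.DagEdge)
    (hS : HasLists (σ.iarr 0) (σ.iarr 1) (σ.iarr 2) L) :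
    RunsIn brandes σ (200 * n ^ 2 + 130 * offset L n) fun τ =>
      ∀ x : Fin n, τ.rarr 3 x = H.betweenness x := by
  have hn2 : n ≤ n ^ 2 := by nlinarith
  refine RunsIn.mono (T := (n * 12 + 6) + ((n * (n * 100 + 54) + 130 * offset L n) + 6)) ?_
    (by nlinarith) fun _ _ h => h
  refine (RunsIn.forLoop hE.size (by decide) rfl rfl 4 (fun i τ => ∀ x < i, τ.rarr 3 x = 0)
    (by simp) ?_).seq fun τ₁ hF₁ h₁ => ?_
  · intro i τ hi h3 hF hI
    refine RunsIn.straight (by decide) fun x hx => ?_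
    by_cases hxi : x = i
    · simp [h3, hxi]
    · simpa [h3, hxi] using hI x (by omega)
  replace hE := hE.of_frame hF₁ rfl rfl rfl
  rw [← hF₁.iarr 0 rfl, ← hF₁.iarr 1 rfl, ← hF₁.iarr 2 rfl] at hS
  rw [← hF₁.rarr 2 rfl] at hc
  refine RunsIn.mono (RunsIn.forLoop_of_potential hE.size (by decide) rfl rfl
    (fun i => i * (n * 100 + 54) + 130 * offset L i) (fun i τ => ∀ x : Fin n, τ.rarr 3 x =
      ∑ s ∈ Finset.univ.filter fun s : Fin n => (s : ℕ) < i ∧ s ≠ x, H.dependency s x) ?_ ?_)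
    le_rfl ?_
  · intro x
    simpa using h₁ x x.2
  · intro i τ hi h3 hF hI
    set s : Fin n := ⟨i, hi⟩ with hs
    have hEτ := hE.of_frame hF rfl rfl rfl
    refine ⟨(n * 50 + (L s).length * 50 + 40) + (n * 50 + (L s).length * 80 + 6), ?_, ?_⟩
    · have : offset L (i + 1) = offset L i + (L s).length := offset_succ L s
      rw [this, Nat.succ_mul i]
      omega
    refine RunsIn.seq (runsIn_initSource (H := H) (s := s) hEτ (L := L) ?_ (hL.nodup s) h3)
      fun τ₂ hF₂ ⟨hP, Q, hQ⟩ => ?_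
    · rw [hF.iarr 0 rfl, hF.iarr 1 rfl, hF.iarr 2 rfl]; exact hS
    refine RunsIn.mono (runsIn_accumulate (hEτ.of_frame hF₂ rfl rfl rfl) ?_ (hL.nodup s) ?_ hP hQ
      ((hF₂.ivar 3 rfl).trans h3)) le_rfl fun τ₃ _ h x => ?_
    · rw [hF₂.rarr 2 rfl, hF.rarr 2 rfl]; exact hc
    · intro a b
      rw [hL.mem_iff, WDigraph.dagEdge_iff_tight]
    · refine (h x).trans ?_
      rw [hF₂.rarr 3 rfl, hI]
      have hlt : ∀ s' : Fin n, (s' : ℕ) < i + 1 ↔ s' = s ∨ (s' : ℕ) < i := fun s' => by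
        rw [Fin.ext_iff, hs]; simp only; omega
      by_cases hx : x = s
      · rw [if_neg (not_not.2 hx), add_zero]
        refine Finset.sum_congr (Finset.filter_congr fun s' _ => ?_) fun _ _ => rfl
        rw [hlt, hx]
        tauto
      · rw [if_pos hx, add_comm, ← Finset.sum_insert (a := s) (f := fun s => H.dependency s x)
          (by simp [hs])]
        refine Finset.sum_congr ?_ fun _ _ => rfl
        ext s'
        simp only [Finset.mem_insert, Finset.mem_filter, Finset.mem_univ, true_and, hlt]
        constructor
        · rintro (rfl | h)
          · exact ⟨.inl rfl, fun h => hx h.symm⟩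
          · exact ⟨.inr h.1, h.2⟩
        · rintro ⟨h | h, h'⟩
          · exact .inl h
          · exact .inr ⟨h, h'⟩
  · intro τ _ h x
    rw [h, WDigraph.betweenness_eq_sum_dependency]
    exact Finset.sum_congr (Finset.filter_congr fun s _ => by simp) fun _ _ => rfl

/-- Updates the edge lists in the integer arrays `A`, `A + 1`, `A + 2`. -/
def updateLists (A : ℕ) : Cmd := copyLists A 10 ;; dagUpdate ;; copyLists 13 A

theorem runsIn_updateLists {n A M M' : ℕ} {G H : WDigraph (Fin n)} {v : Fin n} {σ : Store}
    (hGH : G.IncUpdate H v) (hE : Env n v σ)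
    (hw : IsMat (σ.rarr 10) (weightCode H)) (hd : IsMat (σ.rarr 11) (distCode H)) (hA : A < 4)
    (hL : StoresEdgeLists (σ.iarr A) (σ.iarr (A + 1)) (σ.iarr (A + 2)) G.DagEdge)
    (hM : ∀ L, Lists L G.DagEdge → offset L n ≤ M)
    (hM' : ∀ L, Lists L H.DagEdge → offset L n ≤ M') :
    RunsIn (updateLists A) σ (700 * n ^ 2 +
      150 * (n * {e : Fin n × Fin n | H.DagEdge v e.1 e.2}.ncard) + 200 * M + 40 * M')
      fun τ => StoresEdgeLists (τ.iarr A) (τ.iarr (A + 1)) (τ.iarr (A + 2)) H.DagEdge := by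
  obtain ⟨L, hLG, hS⟩ := storesEdgeLists_iff.1 hL
  have hn := v.pos
  have hn2 : n ≤ n ^ 2 := by nlinarith
  have hML := hM L hLG
  refine RunsIn.mono (T := (n * 18 + 36 * M + 60) + ((500 * n ^ 2 +
    150 * (n * {e : Fin n × Fin n | H.DagEdge v e.1 e.2}.ncard) + 150 * M) +
    (n * 18 + 36 * M' + 60))) ?_ (by omega) fun _ _ h => h
  refine ((runsIn_copyLists hE.size (by omega) hS).mono (by omega) fun _ _ h => h).seq
    fun τ₁ hF₁ h₁ => ?_
  replace hE : Env n v τ₁ := hE.of_frame hF₁ rfl rfl rfl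
  replace hw := hw.of_frame hF₁ rfl
  replace hd := hd.of_frame hF₁ rfl
  refine ((runsIn_dagUpdate hGH hE hw hd hLG h₁).mono (by omega) fun _ _ h => h).seq
    fun τ₂ hF₂ ⟨L', hL', h₂⟩ => ?_
  replace hE : Env n v τ₂ := hE.of_frame hF₂ rfl rfl rfl
  have := hM' L' hL'
  exact (runsIn_copyLists hE.size (by omega) h₂).mono (by omega) fun _ _ h =>
    storesEdgeLists_iff.2 ⟨L', hL', h⟩

/-- Updates the shortest path DAGs. -/
def updateDags : Cmd := copyMat 0 10 ;; copyMat 1 11 ;; updateLists 0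

/-- Updates the shortest path DAGs of the reversed graph. -/
def updateRevDags : Cmd := transposeMat 0 10 ;; transposeMat 1 11 ;; updateLists 3

/-- Incremental betweenness centrality. -/
def update : Cmd := rowOffsets ;; updateMatrices ;; updateDags ;; updateRevDags ;; brandes

/-- The running time in terms of the sizes of the shortest path DAGs, which are at most the numbers
`m*_x`. -/
theorem runsIn_update {n : ℕ} {G H : WDigraph (Fin n)} {v : Fin n} {σ : Store}
    (hGH : G.IncUpdate H v) (hG : Holds G σ) (hH : HoldsUpdate H v σ) :
    RunsIn update σ
      (4000 * n ^ 2 + 600 * (∑ x, G.mStar x + ∑ x, H.mStar x + n * H.mStar v)) (Holds H) := by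
  have hn := v.pos
  have hn2 : n ≤ n ^ 2 := by nlinarith
  set M := ∑ x, G.mStar x
  set M' := ∑ x, H.mStar x
  have hm1 := Nat.mul_le_mul_left n (H.ncard_dagEdge_le v)
  have hm2 := Nat.mul_le_mul_left n (H.ncard_dagEdge_reverse_le v)
  refine RunsIn.mono (T := (n * 20 + 10) + (1500 * n ^ 2 + ((50 * n ^ 2 + (50 * n ^ 2 +
    (700 * n ^ 2 + 150 * (n * H.mStar v) + 200 * M + 40 * M'))) + ((50 * n ^ 2 + (50 * n ^ 2 +
    (700 * n ^ 2 + 150 * (n * H.mStar v) + 200 * M + 40 * M'))) + (200 * n ^ 2 + 130 * M')))))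
    ?_ (by omega) fun _ _ h => h
  refine (runsIn_rowOffsets hG.size).seq fun τ₁ hF₁ h₁ => ?_
  have hE : Env n v τ₁ :=
    ⟨(hF₁.ivar 0 rfl).trans hG.size, (hF₁.ivar 1 rfl).trans hH.vertex, h₁⟩
  have hG₁ : Holds G τ₁ := by
    refine ⟨hE.size, ?_, ?_, ?_, ?_, ?_, ?_⟩
    · rw [hF₁.rarr 0 rfl]; exact hG.weights
    · rw [hF₁.rarr 1 rfl]; exact hG.dists
    · rw [hF₁.rarr 2 rfl]; exact hG.counts
    · rw [hF₁.rarr 3 rfl]; exact hG.centralities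
    · rw [hF₁.iarr 0 rfl, hF₁.iarr 1 rfl, hF₁.iarr 2 rfl]; exact hG.dags
    · rw [hF₁.iarr 3 rfl, hF₁.iarr 4 rfl, hF₁.iarr 5 rfl]; exact hG.revDags
  have hH₁ : HoldsUpdate H v τ₁ := by
    refine ⟨hE.vertex, ?_, ?_⟩
    · rw [hF₁.rarr 4 rfl]; exact hH.incoming
    · rw [hF₁.rarr 5 rfl]; exact hH.outgoing
  refine (runsIn_updateMatrices hGH hE hG₁ hH₁).seq fun τ₂ hF₂ ⟨hw, hd, hc⟩ => ?_
  replace hE := hE.of_frame hF₂ rfl rfl rfl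
  have hL := hG₁.dags
  have hR := hG₁.revDags
  rw [← hF₂.iarr 0 rfl, ← hF₂.iarr 1 rfl, ← hF₂.iarr 2 rfl] at hL
  rw [← hF₂.iarr 3 rfl, ← hF₂.iarr 4 rfl, ← hF₂.iarr 5 rfl] at hR
  refine RunsIn.seq (Q₁ := fun τ => StoresEdgeLists (τ.iarr 0) (τ.iarr 1) (τ.iarr 2) H.DagEdge)
    ((runsIn_copyMat hE hn (by decide) hw).seq fun τ₃ hF₃ hw' =>
      (runsIn_copyMat (hE.of_frame hF₃ rfl rfl rfl) hn (by decide) (hd.of_frame hF₃ rfl)).seq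
        fun τ₄ hF₄ hd' => ?_) fun τ₅ hF₅ hL' => ?_
  · refine (runsIn_updateLists (M := M) (M' := M') hGH
      ((hE.of_frame hF₃ rfl rfl rfl).of_frame hF₄ rfl rfl rfl)
      (hw'.of_frame hF₄ rfl) hd' (by decide) ?_ (fun L hL => hL.offset_le)
      (fun L hL => hL.offset_le)).mono (by omega) fun _ _ h => h
    rw [hF₄.iarr 0 rfl, hF₄.iarr 1 rfl, hF₄.iarr 2 rfl, hF₃.iarr 0 rfl, hF₃.iarr 1 rfl,
      hF₃.iarr 2 rfl]
    exact hL
  replace hE := hE.of_frame hF₅ rfl rfl rfl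
  replace hw := hw.of_frame hF₅ rfl
  replace hd := hd.of_frame hF₅ rfl
  replace hc := hc.of_frame hF₅ rfl
  rw [← hF₅.iarr 3 rfl, ← hF₅.iarr 4 rfl, ← hF₅.iarr 5 rfl] at hR
  refine RunsIn.seq (Q₁ := fun τ => StoresEdgeLists (τ.iarr 3) (τ.iarr 4) (τ.iarr 5)
      H.reverse.DagEdge)
    ((runsIn_transposeMat hE hn (by decide) hw).seq fun τ₆ hF₆ hw' =>
      (runsIn_transposeMat (hE.of_frame hF₆ rfl rfl rfl) hn (by decide) (hd.of_frame hF₆ rfl)).seq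
        fun τ₇ hF₇ hd' => ?_) fun τ₈ hF₈ hR' => ?_
  · refine (runsIn_updateLists (M := M) (M' := M') hGH.reverse
      ((hE.of_frame hF₆ rfl rfl rfl).of_frame hF₇ rfl rfl rfl)
      (hw'.of_frame hF₇ rfl) (fun s t => (hd' s t).trans (distCode_reverse H s t).symm) (by decide)
      ?_ (fun L hL => hL.offset_le_of_reverse) (fun L hL => hL.offset_le_of_reverse)).mono
      (by omega) fun _ _ h => h
    rw [hF₇.iarr 3 rfl, hF₇.iarr 4 rfl, hF₇.iarr 5 rfl, hF₆.iarr 3 rfl, hF₆.iarr 4 rfl,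
      hF₆.iarr 5 rfl]
    exact hR
  replace hE := hE.of_frame hF₈ rfl rfl rfl
  replace hw := hw.of_frame hF₈ rfl
  replace hd := hd.of_frame hF₈ rfl
  replace hc := hc.of_frame hF₈ rfl
  rw [← hF₈.iarr 0 rfl, ← hF₈.iarr 1 rfl, ← hF₈.iarr 2 rfl] at hL'
  obtain ⟨L, hLH, hS⟩ := storesEdgeLists_iff.1 hL'
  have hLM := hLH.offset_le
  refine (runsIn_brandes hE hn hc hLH hS).mono (by omega) fun τ hF hB => ?_
  refine ⟨(hE.of_frame hF rfl rfl rfl).size, hw.of_frame hF rfl, hd.of_frame hF rfl,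
    hc.of_frame hF rfl, hB, ?_, ?_⟩
  · rw [hF.iarr 0 rfl, hF.iarr 1 rfl, hF.iarr 2 rfl]; exact hL'
  · rw [hF.iarr 3 rfl, hF.iarr 4 rfl, hF.iarr 5 rfl]; exact hR'

theorem exists_exec_update {n : ℕ} {G H : WDigraph (Fin n)} {v : Fin n} {σ : Store}
    (hGH : G.IncUpdate H v) (hG : Holds G σ) (hH : HoldsUpdate H v σ) :
    ∃ (t : ℕ) (τ : Store), Exec update σ t τ ∧ Holds H τ ∧
      (t : ℝ) ≤ 4000 * (WDigraph.mPrime G H v * (n : ℝ) + (n : ℝ) ^ 2) := by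
  obtain ⟨t, τ, he, ht, hτ⟩ := runsIn_update hGH hG hH
  refine ⟨t, τ, he, hτ, ?_⟩
  have : Nonempty (Fin n) := ⟨v⟩
  have hS := WDigraph.sum_mStar_add_le G H v
  rw [Fintype.card_fin] at hS
  set S := ∑ x, G.mStar x + ∑ x, H.mStar x + n * H.mStar v
  have ht' : (t : ℝ) ≤ 4000 * (n : ℝ) ^ 2 + 600 * (S : ℝ) := by exact_mod_cast ht
  have hS0 : (0 : ℝ) ≤ S := Nat.cast_nonneg S
  linarith

end BCData

theorem theorem1 :
    ∃ (prog : RealRAM.Cmd) (C : ℝ),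
      (∀ (n : ℕ) (G H : WDigraph (Fin n)) (v : Fin n), G.IncUpdate H v →
        ∀ σ : RealRAM.Store, BCData.Holds G σ → BCData.HoldsUpdate H v σ →
          ∃ (t : ℕ) (τ : RealRAM.Store), RealRAM.Exec prog σ t τ ∧ BCData.Holds H τ ∧
            (t : ℝ) ≤ C * (WDigraph.mPrime G H v * (n : ℝ) + (n : ℝ) ^ 2)) ∧
      (∀ (n : ℕ) (G H : WGraph (Fin n)) (v : Fin n), G.IncUpdate H v →
        ∀ σ : RealRAM.Store, BCData.Holds G.toDigraph σ → BCData.HoldsUpdate H.toDigraph v σ →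
          ∃ (t : ℕ) (τ : RealRAM.Store), RealRAM.Exec prog σ t τ ∧ BCData.Holds H.toDigraph τ ∧
            (t : ℝ) ≤ C * (WGraph.mPrime G H v * (n : ℝ) + (n : ℝ) ^ 2)) := by
  refine ⟨BCData.update, 8000, fun n G H v hGH σ hG hH => ?_, fun n G H v hGH σ hG hH => ?_⟩
  · obtain ⟨t, τ, he, hτ, ht⟩ := BCData.exists_exec_update hGH hG hH
    have : (0 : ℝ) ≤ t := Nat.cast_nonneg t
    exact ⟨t, τ, he, hτ, by linarith⟩
  · obtain ⟨t, τ, he, hτ, ht⟩ := BCData.exists_exec_update hGH.toDigraph hG hH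
    refine ⟨t, τ, he, hτ, ht.trans ?_⟩
    -- every undirected edge has two orientations
    have hm := mul_le_mul_of_nonneg_right (WGraph.mPrime_toDigraph_le G H v) (Nat.cast_nonneg n)
    have := sq_nonneg (n : ℝ)
    linarith
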